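/- **Notation.** Let $n\ge 1$ and let $Q_{j,k}=2^{-j}k+2^{-j}[0,1)^n$ ($j\in\mathbb Z$, $k\in\mathbb Z^n$) be the dyadic cubes of $\mathbb R^n$. Put $\phi=1_{[0,1)^n}$, and let $E$ be the set of the $2^n-1$ tensor-product Haar wavelets $\psi(x)=\prod_i h_{\varepsilon_i}(x_i)$, $0\ne\varepsilon\in\{0,1\}^n$, where $h_0=1_{[0,1)}$ and $h_1=1_{[0,1/2)}-1_{[1/2,1)}$. Write $\phi_{j,k}(x)=2^{nj/2}\phi(2^jx-k)$, $\psi_{j,k}(x)=2^{nj/2}\psi(2^jx-k)$, $\langle g,f\rangle=\int_{\mathbb R^n} g f\,dx$ (no conjugation), and let $|\cdot|$ be the sup norm on $\mathbb Z^n$. Let $T$ be an operator for which the following coefficients are defined for all $j\in\mathbb Z$, $k,\ell\in\mathbb Z^n$ and $\psi,\psi'\in E$ (nothing else about $T$ is used; the dependence on $\psi,\psi'$ is not displayed on the left): $$a^j_{k,\ell}=\langle\psi_{j,k},T\psi'_{j,\ell}\rangle,\qquad b^j_{k,\ell}=\langle\psi_{j,k},T\phi_{j,\ell}\rangle,\qquad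 c^j_{k,\ell}=\langle\phi_{j,k},T\psi'_{j,\ell}\rangle .$$ For $k\neq\ell$ put $\alpha^j_{k,\ell}=a^j_{k,\ell}$, $\beta^j_{k,\ell}=b^j_{k,\ell}$, $\gamma^j_{k,\ell}=c^j_{k,\ell}$, and on the diagonal $$\alpha^j_{k,k}=0,\qquad \beta^j_{k,k}=-\sum_{m\ne0}b^j_{k,k+m},\qquad \gamma^j_{k,k}=-\sum_{m\neq0}c^j_{k+m,k}.$$ Let $\mathcal U,\mathcal V,\mathcal W$ be the operators given by $$\langle g,\mathcal Uf\rangle=\sum_{j\in\mathbb Z}\sum_{\psi,\psi'}\sum_{k,\ell}\langle g,\psi_{j,k}\rangle\alpha^j_{k,\ell}\langle\psi'_{j,\ell},f\rangle,$$ $$\langle g,\mathcal Vf\rangle=\sum_{j\in\mathbb Z}\sum_{\psi}\sum_{k,\ell}\langle g,\psi_{j,k}\rangle\beta^j_{k,\ell}\langle\phi_{j,\ell},f\rangle,\qquad \langle g,\mathcal Wf\rangle=\sum_{j\in\mathbb Z}\sum_{\psi'}\sum_{k,\ell}\langle g,\phi_{j,k}\rangle\gamma^j_{k,\ell}\langle\psi'_{j,\ell},f\rangle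 .$$ A dyadic atom is a function $a$ supported in a dyadic cube $Q$ with $\|a\|_\infty\le 1/|Q|$ and $\int a=0$. The space $H^1_d$ consists of the sums $f=\sum_i\lambda_ia_i$ (in $L^1$) with dyadic atoms $a_i$ and $\sum_i|\lambda_i|<\infty$, normed by the infimum of $\sum_i|\lambda_i|$ over all such representations. The space $\mathrm{BMO}_d$ consists of the locally integrable $F$ with $\|F\|_{\mathrm{BMO}_d}=\sup_Q\frac1{|Q|}\int_Q\bigl|F-\frac1{|Q|}\int_QF\bigr|<\infty$, the supremum being over dyadic cubes. **Theorem 2.1.** Assume that for some $s>0$ and $C>0$, for all $j$, all $k\ne\ell$ and all $\psi,\psi'\in E$, $$|a^j_{k,\ell}|+|b^j_{k,\ell}|+|c^j_{k,\ell}|\le C(1+|k-\ell|)^{-n-s}.$$ Then $\mathcal U$, $\mathcal V$ and $\mathcal W$ are bounded on $L^p(\mathbb R^n)$ for all $1<p<\infty$, from $H^1_d(\mathbb R^n)$ into $L^1(\mathbb R^n)$, and from $L^\infty(\mathbb R^n)$ into $\mathrm{BMO}_d(\mathbb R^n)$. That is, there are bounded linear operators between these spaces for which the above formulas hold for all $f$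 in the source space and all $g$ in $L^{p'}$ ($1/p+1/p'=1$), in $L^\infty$, and among the dyadic atoms, respectively; here at each scale $j$ the inner sum converges absolutely, and then so does the sum over $j$. Moreover $\mathcal V(1)=\mathcal V^*(1)=0$ and $\mathcal W(1)=\mathcal W^*(1)=0$, in the sense that for every $h\in L^1(\mathbb R^n)$ the series for $\langle h,\mathcal V1\rangle$, $\langle1,\mathcal Vh\rangle$, $\langle h,\mathcal W1\rangle$ and $\langle1,\mathcal Wh\rangle$ converge (in the same sense) to $0$. -/

import Mathlib

open MeasureTheory
open scoped ENNReal

noncomputable section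

namespace BCR

/-- The one-dimensional profiles: `1_{[0,1)}` for `false` and the Haar wavelet
`1_{[0,1/2)} - 1_{[1/2,1)}` for `true`. -/
def profile : Bool → ℝ → ℂ
  | false, t => if 0 ≤ t ∧ t < 1 then 1 else 0
  | true, t => if 0 ≤ t ∧ t < 1 / 2 then 1 else if 1 / 2 ≤ t ∧ t < 1 then -1 else 0

/-- The tensor-product Haar functions on `ℝⁿ`, normalized in `L²`:
`x ↦ 2^{nj/2} ∏ᵢ h_{εᵢ}(2ʲ xᵢ - kᵢ)`. -/
def haar {n : ℕ} (ε : Fin n → Bool) (j : ℤ) (k : Fin n → ℤ) (x : Fin n → ℝ) : ℂ :=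
  (((2 : ℝ) ^ ((n : ℝ) * (j : ℝ) / 2) : ℝ) : ℂ) *
    ∏ i, profile (ε i) ((2 : ℝ) ^ j * x i - (k i : ℝ))

/-- The index set `E` of the `2ⁿ - 1` Haar wavelets. -/
abbrev Wavelet (n : ℕ) : Type := {ε : Fin n → Bool // ε ≠ fun _ => false}

/-- `φ_{j,k}`, the normalized indicator function of the dyadic cube `Q_{j,k}`. -/
def phi {n : ℕ} (j : ℤ) (k : Fin n → ℤ) : (Fin n → ℝ) → ℂ :=
  haar (fun _ => false) j k

/-- The Haar wavelets `ψ_{j,k}`, for `ψ = q.1 ∈ E` and `k = q.2`. -/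
def psi {n : ℕ} (j : ℤ) (q : Wavelet n × (Fin n → ℤ)) : (Fin n → ℝ) → ℂ :=
  haar q.1.1 j q.2

/-- The dyadic cube `Q_{j,k} = 2^{-j} k + 2^{-j} [0,1)ⁿ`. -/
def dyadicCube {n : ℕ} (j : ℤ) (k : Fin n → ℤ) : Set (Fin n → ℝ) :=
  {x | ∀ i, (k i : ℝ) ≤ (2 : ℝ) ^ j * x i ∧ (2 : ℝ) ^ j * x i < (k i : ℝ) + 1}

/-- The bilinear duality bracket (no complex conjugation). -/
def bracket {n : ℕ} (g f : (Fin n → ℝ) → ℂ) : ℂ := ∫ x, g x * f x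

/-! ### Haar coefficients

`T g f` stands for `⟨g, T f⟩`. Only its values on Haar functions of equal scale are ever used, so
that no condition on the domain of the operator is needed. -/

/-- `⟨ψ_{j,k}, T ψ_{j,ℓ}⟩`. -/
def coeffA {n : ℕ} (T : ((Fin n → ℝ) → ℂ) → ((Fin n → ℝ) → ℂ) → ℂ)
    (j : ℤ) (q r : Wavelet n × (Fin n → ℤ)) : ℂ := T (psi j q) (psi j r)

/-- `⟨ψ_{j,k}, T φ_{j,ℓ}⟩`. -/
def coeffB {n : ℕ} (T : ((Fin n → ℝ) → ℂ) → ((Fin n → ℝ) → ℂ) → ℂ)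
    (j : ℤ) (q : Wavelet n × (Fin n → ℤ)) (l : Fin n → ℤ) : ℂ := T (psi j q) (phi j l)

/-- `⟨φ_{j,k}, T ψ_{j,ℓ}⟩`. -/
def coeffC {n : ℕ} (T : ((Fin n → ℝ) → ℂ) → ((Fin n → ℝ) → ℂ) → ℂ)
    (j : ℤ) (k : Fin n → ℤ) (r : Wavelet n × (Fin n → ℤ)) : ℂ := T (phi j k) (psi j r)

/-- `α`: the diagonal `k = ℓ` is put equal to zero. -/
def alpha {n : ℕ} (T : ((Fin n → ℝ) → ℂ) → ((Fin n → ℝ) → ℂ) → ℂ)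
    (j : ℤ) (q r : Wavelet n × (Fin n → ℤ)) : ℂ :=
  if q.2 = r.2 then 0 else coeffA T j q r

/-- `β`: the diagonal is `-∑_{m ≠ 0} b_{k,k+m}`. -/
def beta {n : ℕ} (T : ((Fin n → ℝ) → ℂ) → ((Fin n → ℝ) → ℂ) → ℂ)
    (j : ℤ) (q : Wavelet n × (Fin n → ℤ)) (l : Fin n → ℤ) : ℂ :=
  if q.2 = l then -∑' m : {m : Fin n → ℤ // m ≠ 0}, coeffB T j q (q.2 + m.1)
  else coeffB T j q l

/-- `γ`: the diagonal is `-∑_{m ≠ 0} c_{k+m,k}`. -/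
def gamma {n : ℕ} (T : ((Fin n → ℝ) → ℂ) → ((Fin n → ℝ) → ℂ) → ℂ)
    (j : ℤ) (k : Fin n → ℤ) (r : Wavelet n × (Fin n → ℤ)) : ℂ :=
  if k = r.2 then -∑' m : {m : Fin n → ℤ // m ≠ 0}, coeffC T j (r.2 + m.1) r
  else coeffC T j k r

/-! ### The operators, through their bilinear forms -/

/-- The series `∑_j ∑_{q,r} ⟨g, u_{j,q}⟩ M^j_{q,r} ⟨v_{j,r}, f⟩` converges to `z`: at each scale
the inner sum converges absolutely, and then so does the sum over the scales. -/
def SeriesHasSum {n : ℕ} {ι κ : Type} (u : ℤ → ι → (Fin n → ℝ) → ℂ) (M : ℤ → ι → κ → ℂ)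
    (v : ℤ → κ → (Fin n → ℝ) → ℂ) (g f : (Fin n → ℝ) → ℂ) (z : ℂ) : Prop :=
  (∀ j, Summable fun q : ι × κ => bracket g (u j q.1) * M j q.1 q.2 * bracket (v j q.2) f) ∧
    HasSum (fun j => ∑' q : ι × κ, bracket g (u j q.1) * M j q.1 q.2 * bracket (v j q.2) f) z

/-- `⟨g, 𝒰 f⟩ = z`. -/
def FormU {n : ℕ} (T : ((Fin n → ℝ) → ℂ) → ((Fin n → ℝ) → ℂ) → ℂ)
    (g f : (Fin n → ℝ) → ℂ) (z : ℂ) : Prop := SeriesHasSum psi (alpha T) psi g f z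

/-- `⟨g, 𝒱 f⟩ = z`. -/
def FormV {n : ℕ} (T : ((Fin n → ℝ) → ℂ) → ((Fin n → ℝ) → ℂ) → ℂ)
    (g f : (Fin n → ℝ) → ℂ) (z : ℂ) : Prop := SeriesHasSum psi (beta T) phi g f z

/-- `⟨g, 𝒲 f⟩ = z`. -/
def FormW {n : ℕ} (T : ((Fin n → ℝ) → ℂ) → ((Fin n → ℝ) → ℂ) → ℂ)
    (g f : (Fin n → ℝ) → ℂ) (z : ℂ) : Prop := SeriesHasSum phi (gamma T) psi g f z

/-! ### The dyadic Hardy space -/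

/-- `L^∞` dyadic atoms. -/
def IsDyadicAtom {n : ℕ} (a : Lp ℂ 1 (volume : Measure (Fin n → ℝ))) : Prop :=
  ∃ (j : ℤ) (k : Fin n → ℤ),
    (∀ᵐ x, x ∉ dyadicCube j k → a x = 0) ∧
    (∀ᵐ x, ‖a x‖ ≤ (volume.real (dyadicCube j k))⁻¹) ∧
    ∫ x, a x = 0

/-- `f = ∑ cᵢ aᵢ` in `L¹` with atoms `aᵢ` and `∑ |cᵢ| < ∞`. -/
def IsAtomicDecomposition {n : ℕ} (f : Lp ℂ 1 (volume : Measure (Fin n → ℝ)))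
    (c : ℕ → ℂ) (a : ℕ → Lp ℂ 1 (volume : Measure (Fin n → ℝ))) : Prop :=
  (∀ i, IsDyadicAtom (a i)) ∧ (Summable fun i => ‖c i‖) ∧ HasSum (fun i => c i • a i) f

/-- The dyadic Hardy space `H¹_d(ℝⁿ)`. -/
def dyadicHardy (n : ℕ) : Submodule ℂ (Lp ℂ 1 (volume : Measure (Fin n → ℝ))) where
  carrier := {f | ∃ c a, IsAtomicDecomposition f c a}
  zero_mem' := by
    refine ⟨fun _ => 0, fun _ => 0, fun _ => ⟨0, 0, ?_, ?_, ?_⟩, ?_, ?_⟩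
    · filter_upwards [Lp.coeFn_zero ℂ 1 (volume : Measure (Fin n → ℝ))] with x hx _ using hx
    · filter_upwards [Lp.coeFn_zero ℂ 1 (volume : Measure (Fin n → ℝ))] with x hx
      rw [hx]; simp
    · rw [integral_congr_ae (Lp.coeFn_zero ℂ 1 (volume : Measure (Fin n → ℝ)))]; simp
    · simp
    · simp
  add_mem' := by
    rintro f g ⟨c, a, ha, hc, hf⟩ ⟨d, b, hb, hd, hg⟩
    let e := Equiv.natSumNatEquivNat.symm
    refine ⟨fun i => Sum.elim c d (e i), fun i => Sum.elim a b (e i), fun i => ?_, ?_, ?_⟩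
    · show IsDyadicAtom (Sum.elim a b (e i))
      rcases e i with m | m
      · exact ha m
      · exact hb m
    · refine (e.summable_iff (f := fun i => ‖Sum.elim c d i‖)).2 ?_
      exact (hc.hasSum.sum (f := fun i => ‖Sum.elim c d i‖) hd.hasSum).summable
    · refine (e.hasSum_iff (f := fun i => Sum.elim c d i • Sum.elim a b i)).2 ?_
      exact hf.sum (f := fun i => Sum.elim c d i • Sum.elim a b i) hg
  smul_mem' := by
    rintro t f ⟨c, a, ha, hc, hf⟩
    refine ⟨fun i => t * c i, a, ha, ?_, ?_⟩
    · simpa using hc.mul_left ‖t‖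
    · simpa [mul_smul] using hf.const_smul t

/-- The atomic norm on `H¹_d(ℝⁿ)`. -/
def hardyNorm {n : ℕ} (f : dyadicHardy n) : ℝ :=
  sInf {r | ∃ c a, IsAtomicDecomposition f.1 c a ∧ r = ∑' i, ‖c i‖}

/-! ### The dyadic BMO space -/

/-- Mean oscillation on the dyadic cube `Q_{j,k}`. -/
def oscillation {n : ℕ} (F : (Fin n → ℝ) → ℂ) (j : ℤ) (k : Fin n → ℤ) : ℝ :=
  ⨍ x in dyadicCube j k, ‖F x - ⨍ y in dyadicCube j k, F y‖

lemma oscillation_congr {n : ℕ} {F G : (Fin n → ℝ) → ℂ} (h : F =ᵐ[volume] G) (j : ℤ)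
    (k : Fin n → ℤ) : oscillation F j k = oscillation G j k := by
  have h' : F =ᵐ[volume.restrict (dyadicCube j k)] G := ae_restrict_of_ae h
  have hm : (⨍ y in dyadicCube j k, F y) = ⨍ y in dyadicCube j k, G y := average_congr h'
  unfold oscillation
  rw [hm]
  refine average_congr ?_
  filter_upwards [h'] with x hx
  rw [hx]

lemma integrableOn_dyadicCube {n : ℕ} {F : (Fin n → ℝ) → ℂ} (h : LocallyIntegrable F volume)
    (j : ℤ) (k : Fin n → ℤ) : IntegrableOn F (dyadicCube j k) volume := by
  have hp : (0 : ℝ) < 2 ^ j := by positivity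
  refine (h.integrableOn_isCompact (isCompact_Icc (a := fun i => (k i : ℝ) / 2 ^ j)
    (b := fun i => ((k i : ℝ) + 1) / 2 ^ j))).mono_set fun x hx => ⟨fun i => ?_, fun i => ?_⟩
  · have := (hx i).1
    simp only [div_le_iff₀ hp]
    linarith [mul_comm (x i) ((2 : ℝ) ^ j)]
  · have := (hx i).2
    simp only [le_div_iff₀ hp]
    linarith [mul_comm (x i) ((2 : ℝ) ^ j)]

lemma volume_dyadicCube_ne_top {n : ℕ} (j : ℤ) (k : Fin n → ℤ) :
    volume (dyadicCube j k) ≠ ∞ := by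
  have h := integrableOn_dyadicCube
    (continuous_const (y := (1 : ℂ)) : Continuous fun _ : Fin n → ℝ => (1 : ℂ)).locallyIntegrable j k
  rw [integrableOn_const_iff] at h
  simpa [lt_top_iff_ne_top] using h

lemma oscillation_add_le {n : ℕ} {F G : (Fin n → ℝ) → ℂ} (hF : LocallyIntegrable F volume)
    (hG : LocallyIntegrable G volume) (j : ℤ) (k : Fin n → ℤ) :
    oscillation (F + G) j k ≤ oscillation F j k + oscillation G j k := by
  have hF' := integrableOn_dyadicCube hF j k
  have hG' := integrableOn_dyadicCube hG j k
  have hc (w : ℂ) : IntegrableOn (fun _ : Fin n → ℝ => w) (dyadicCube j k) volume :=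
    integrableOn_const (volume_dyadicCube_ne_top j k)
  have hm : (⨍ y in dyadicCube j k, (F + G) y) =
      (⨍ y in dyadicCube j k, F y) + ⨍ y in dyadicCube j k, G y := by
    simp only [setAverage_eq, Pi.add_apply]
    rw [integral_add hF' hG', smul_add]
  unfold oscillation
  rw [hm]
  generalize (⨍ y in dyadicCube j k, F y) = u
  generalize (⨍ y in dyadicCube j k, G y) = v
  simp only [setAverage_eq, Pi.add_apply]
  have hs := integral_add (hF'.sub (hc u)).norm (hG'.sub (hc v)).norm
  simp only [Pi.sub_apply] at hs
  rw [← smul_add, ← hs]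
  refine smul_le_smul_of_nonneg_left (integral_mono ?_ ?_ fun x => ?_) (by positivity)
  · exact ((hF'.add hG').sub (hc (u + v))).norm
  · exact (hF'.sub (hc u)).norm.add (hG'.sub (hc v)).norm
  · calc ‖F x + G x - (u + v)‖ = ‖(F x - u) + (G x - v)‖ := by congr 1; ring
      _ ≤ _ := norm_add_le _ _

lemma oscillation_smul {n : ℕ} (t : ℂ) (F : (Fin n → ℝ) → ℂ) (j : ℤ) (k : Fin n → ℤ) :
    oscillation (t • F) j k = ‖t‖ * oscillation F j k := by
  have hm : (⨍ y in dyadicCube j k, (t • F) y) = t • ⨍ y in dyadicCube j k, F y := by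
    simp only [setAverage_eq, Pi.smul_apply]
    rw [integral_smul, smul_comm]
  unfold oscillation
  rw [hm]
  generalize (⨍ y in dyadicCube j k, F y) = u
  simp only [setAverage_eq, Pi.smul_apply, ← smul_sub, norm_smul, integral_const_mul]
  simp only [smul_eq_mul]
  ring

/-- The space `BMO_d(ℝⁿ)`: classes modulo null sets of locally integrable functions with bounded
mean oscillation over the dyadic cubes. The functions of seminorm zero are not divided out. -/
def dyadicBMO (n : ℕ) : Submodule ℂ ((Fin n → ℝ) →ₘ[volume] ℂ) where
  carrier := {F | LocallyIntegrable F volume ∧ ∃ K : ℝ, ∀ j k, oscillation F j k ≤ K}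
  zero_mem' := by
    have h0 : ((0 : (Fin n → ℝ) →ₘ[volume] ℂ) : (Fin n → ℝ) → ℂ) =ᵐ[volume] (fun _ => 0) :=
      AEEqFun.coeFn_zero
    refine ⟨(continuous_const.locallyIntegrable).congr h0.symm, 0, fun j k => ?_⟩
    rw [oscillation_congr h0]
    simp [oscillation]
  add_mem' := by
    rintro F G ⟨hF, A, hA⟩ ⟨hG, B, hB⟩
    refine ⟨(hF.add hG).congr (AEEqFun.coeFn_add F G).symm, A + B, fun j k => ?_⟩
    rw [oscillation_congr (AEEqFun.coeFn_add F G)]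
    exact (oscillation_add_le hF hG j k).trans (add_le_add (hA j k) (hB j k))
  smul_mem' := by
    rintro t F ⟨hF, A, hA⟩
    refine ⟨(hF.smul t).congr (AEEqFun.coeFn_smul t F).symm, ‖t‖ * A, fun j k => ?_⟩
    rw [oscillation_congr (AEEqFun.coeFn_smul t F), oscillation_smul]
    exact mul_le_mul_of_nonneg_left (hA j k) (norm_nonneg t)

/-- The seminorm of `BMO_d(ℝⁿ)`. -/
def bmoSeminorm {n : ℕ} (F : dyadicBMO n) : ℝ :=
  ⨆ q : ℤ × (Fin n → ℤ), oscillation F.1 q.1 q.2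

/-! ### Boundedness of the operator with a given bilinear form

`B g f z` stands for `⟨g, S f⟩ = z`. -/

/-- A bounded operator on `L^p` with the form `B` on `L^{p'} × L^p`. -/
def BoundedOnLp {n : ℕ} (B : ((Fin n → ℝ) → ℂ) → ((Fin n → ℝ) → ℂ) → ℂ → Prop) (p : ℝ≥0∞)
    [Fact (1 ≤ p)] : Prop :=
  ∃ S : Lp ℂ p (volume : Measure (Fin n → ℝ)) →L[ℂ] Lp ℂ p (volume : Measure (Fin n → ℝ)),
    ∀ (g : Lp ℂ p.conjExponent (volume : Measure (Fin n → ℝ)))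
      (f : Lp ℂ p (volume : Measure (Fin n → ℝ))), B g f (bracket g (S f))

/-- A bounded operator from `H¹_d` to `L¹` with the form `B` on `L^∞ × H¹_d`. -/
def BoundedHardyToL1 {n : ℕ} (B : ((Fin n → ℝ) → ℂ) → ((Fin n → ℝ) → ℂ) → ℂ → Prop) : Prop :=
  ∃ (S : dyadicHardy n →ₗ[ℂ] Lp ℂ 1 (volume : Measure (Fin n → ℝ))) (K : ℝ),
    (∀ f, ‖S f‖ ≤ K * hardyNorm f) ∧
    ∀ (g : Lp ℂ ∞ (volume : Measure (Fin n → ℝ))) (f : dyadicHardy n),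
      B g f.1 (bracket g (S f))

/-- A bounded operator from `L^∞` to `BMO_d` with the form `B`; an element of `BMO_d` is tested
against the atoms, which determine it up to functions of seminorm zero. -/
def BoundedLinftyToBMO {n : ℕ} (B : ((Fin n → ℝ) → ℂ) → ((Fin n → ℝ) → ℂ) → ℂ → Prop) : Prop :=
  ∃ (S : Lp ℂ ∞ (volume : Measure (Fin n → ℝ)) →ₗ[ℂ] dyadicBMO n) (K : ℝ),
    (∀ f, bmoSeminorm (S f) ≤ K * ‖f‖) ∧
    ∀ (g : Lp ℂ 1 (volume : Measure (Fin n → ℝ))) (f : Lp ℂ ∞ (volume : Measure (Fin n → ℝ))),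
      IsDyadicAtom g → B g f (bracket g (S f).1)

/-- All the boundedness properties together. -/
def IsBounded {n : ℕ} (B : ((Fin n → ℝ) → ℂ) → ((Fin n → ℝ) → ℂ) → ℂ → Prop) : Prop :=
  (∀ (p : ℝ≥0∞) [Fact (1 ≤ p)], 1 < p → p < ∞ → BoundedOnLp B p) ∧
    BoundedHardyToL1 B ∧ BoundedLinftyToBMO B

/-- `S(1) = 0` and `S^*(1) = 0` for the operator `S` with the form `B`: the series for `⟨h, S 1⟩` and
`⟨1, S h⟩` converge to zero for all integrable `h`. -/
def AnnihilatesOne {n : ℕ} (B : ((Fin n → ℝ) → ℂ) → ((Fin n → ℝ) → ℂ) → ℂ → Prop) : Prop :=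
  ∀ h : (Fin n → ℝ) → ℂ, Integrable h → B h (fun _ => 1) 0 ∧ B (fun _ => 1) h 0

end BCR

end

noncomputable section

namespace BCR

variable {n : ℕ}

/-! ### Dyadic blocks of the integer lattice -/

/-! All three operators are sums over scales of forms `∑ ⟨g, h_q⟩ M_{q,r} ⟨h_r, f⟩`, where `h` runs
over the Haar functions of one scale, the `φ` included. The matrices are dominated by an even weight
`w (k - l)`, a multiple of `(1 + |k - l|) ^ (-n - s)`, which has a finite moment of some order `0 <
δ ≤ 1`. The diagonal is chosen so that two cancellations hold for `𝒰` and `𝒱`: only wavelets occur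
on the left, and the row sums over the `φ` on the right vanish. `𝒲` is the transpose of such an
operator, namely of `𝒱` for the transposed `T`. The two cancellations make every single scale
annihilate `1` from both sides.

One scale is bounded on `L^p` by Hölder's inequality, uniformly in the scale; the point is to sum
over the scales. Let `E_i` be the averages over dyadic blocks of side `2 ^ i` and `D_i = E_i -
E_(i+1)`. The kernel of scale `i` is constant on blocks of side `2 ^ i` in both variables and has
mean zero on blocks of side `2 ^ (i + 1)` in the first one, so the form sees only `D_i g` and `E_i
f`, the latter a sum of `D_a f` with `a ≥ i`. If `u` is constant on blocks of side `2 ^ a`, the row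
sums allow `u y` to be replaced by `u y - u x`, and only pairs in different blocks count. The kernel
mass across their boundaries is a fraction `O(2 ^ (-δ (a - i)))`. Cauchy–Schwarz turns this into a
gain `2 ^ (-δ (a - i) / 2)`, and geometric sums give the `ℓ²` bound (`enorm_kernelForm_le`,
`sum_enorm_kernelForm_le`).

For `1 < p < 2` a dyadic Calderón–Zygmund decomposition is used. A bad piece on a block is
annihilated by all kernels which are constant on that block; the kernels of finer scales reach it
from outside the tripled block only through the tail of the weight. Thus no smoothness of kernels is
needed. A refined weak type estimate (`tsum_lt_totalOp_le`) is integrated over the levels.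
Multiplying each scale by a factor of modulus at most one preserves the hypotheses, whence absolute
convergence over the scales; `p > 2` follows by transposition.

These estimates are made for finitely supported functions on `ℤⁿ`, the lattice of small dyadic
cubes. The constants do not depend on the mesh, and truncation leads back to `ℝⁿ`
(`exists_sum_enorm_scaleForm_le`).

At the endpoints the test function `g` is split at the neighbourhood of the cube of an atom: the
near part is handled in `L²`, the far part by the tail of the weight
(`exists_sum_enorm_scaleForm_atom_le`). The `L²` image of an atom is then integrable by the converse
of Hölder's inequality, and atomic series are summed. For `L^∞ → BMO_d` the functional on atoms is
represented on each unit cube by Riesz' theorem in `L²`; the local functions glue within each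
orthant, since no dyadic cube meets two orthants. -/

/-- The index of the dyadic block of side `2 ^ i` which contains `x`. -/
def cell (i : ℕ) (x : Fin n → ℤ) : Fin n → ℤ := fun a => x a / 2 ^ i

/-- The dyadic block of side `2 ^ i` with index `k`. -/
def block (i : ℕ) (k : Fin n → ℤ) : Finset (Fin n → ℤ) :=
  Fintype.piFinset fun a => Finset.Ico (k a * 2 ^ i) (k a * 2 ^ i + 2 ^ i)

lemma ediv_two_pow_eq_iff (i : ℕ) (a k : ℤ) :
    a / 2 ^ i = k ↔ k * 2 ^ i ≤ a ∧ a < k * 2 ^ i + 2 ^ i := by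
  have hp : (0 : ℤ) < 2 ^ i := by positivity
  rw [Int.ediv_eq_iff_of_pos hp, mul_comm k]

lemma mem_block {i : ℕ} {k x : Fin n → ℤ} : x ∈ block i k ↔ cell i x = k := by
  simp only [block, Fintype.mem_piFinset, Finset.mem_Ico, cell, funext_iff, ediv_two_pow_eq_iff]

lemma toNat_two_pow (i : ℕ) : ((2 : ℤ) ^ i).toNat = 2 ^ i := by
  rw [Int.toNat_pow_of_nonneg (by norm_num)]; rfl

lemma card_block (i : ℕ) (k : Fin n → ℤ) : (block i k).card = 2 ^ (n * i) := by
  simp [block, Fintype.card_piFinset, pow_mul, mul_comm n i, toNat_two_pow]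

lemma cell_zero (x : Fin n → ℤ) : cell 0 x = x := by
  funext a; simp [cell]

lemma cell_cell (i r : ℕ) (x : Fin n → ℤ) : cell r (cell i x) = cell (i + r) x := by
  funext a
  simp only [cell, pow_add]
  rw [Int.ediv_ediv_of_nonneg (by positivity)]

lemma cell_eq_of_le {i i' : ℕ} (h : i ≤ i') {x y : Fin n → ℤ} (hxy : cell i x = cell i y) :
    cell i' x = cell i' y := by
  obtain ⟨r, rfl⟩ := Nat.exists_eq_add_of_le h
  rw [← cell_cell, ← cell_cell, hxy]

lemma cell_sub_mul (i : ℕ) (x m : Fin n → ℤ) :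
    cell i (x - fun a => 2 ^ i * m a) = cell i x - m := by
  funext a
  simp only [cell, Pi.sub_apply]
  rw [Int.sub_mul_ediv_left _ _ (by positivity)]

/-- The lattice is the disjoint union of its blocks. -/
def blockEquiv (i : ℕ) : (Σ k : Fin n → ℤ, {x // x ∈ block i k}) ≃ (Fin n → ℤ) where
  toFun p := p.2.1
  invFun x := ⟨cell i x, x, mem_block.2 rfl⟩
  left_inv := by
    rintro ⟨k, x, hx⟩
    obtain rfl := mem_block.1 hx
    rfl
  right_inv _ := rfl

lemma tsum_block (i : ℕ) (F : (Fin n → ℤ) → ℝ≥0∞) :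
    ∑' x, F x = ∑' k, ∑ x ∈ block i k, F x := by
  rw [← (blockEquiv i).tsum_eq F]
  refine (ENNReal.summable.tsum_sigma' fun _ => ENNReal.summable).trans ?_
  exact tsum_congr fun k => by
    rw [tsum_fintype, ← Finset.sum_coe_sort (block i k)]; rfl

lemma tsum_block_of_summable {F : (Fin n → ℤ) → ℂ} (i : ℕ) (hF : Summable F) :
    ∑' x, F x = ∑' k, ∑ x ∈ block i k, F x := by
  rw [← (blockEquiv i).tsum_eq F]
  have h := (blockEquiv i).summable_iff.2 hF
  refine (h.tsum_sigma).trans ?_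
  exact tsum_congr fun k => by
    rw [tsum_fintype, ← Finset.sum_coe_sort (block i k)]; rfl

/-- Only the coordinate `a` matters. The integers of an interval which a shift by `h a` moves out of
it form a slab of at most `|h a|` integers at one end, and the other `n - 1` coordinates are free.
-/
lemma card_block_shift_le (i : ℕ) (k h : Fin n → ℤ) (a : Fin n) :
    ((((block i k).filter fun x => (x - h) a / 2 ^ i ≠ k a).card : ℕ) : ℝ) ≤
      2 ^ (n * i) * min 1 (‖h‖ / 2 ^ i) := by
  have hcard : ((((block i k).filter fun x => (x - h) a / 2 ^ i ≠ k a).card : ℕ) : ℝ) ≤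
      2 ^ (n * i) := by
    exact_mod_cast (Finset.card_filter_le _ _).trans (card_block i k).le
  rcases le_total 1 (‖h‖ / 2 ^ i) with h1 | h1
  · rwa [min_eq_left h1, mul_one]
  rw [min_eq_right h1]
  set S : Finset ℤ := (Finset.Ico (k a * 2 ^ i) (k a * 2 ^ i + 2 ^ i)).filter
    fun t => (t - h a) / 2 ^ i ≠ k a with hS
  have hScard : (S.card : ℝ) ≤ ‖h‖ := by
    -- The sign of `h a` decides which end is lost; the other interval is empty.
    have hsub : S ⊆ Finset.Ico (k a * 2 ^ i) (k a * 2 ^ i + h a) ∪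
        Finset.Ico (k a * 2 ^ i + 2 ^ i + h a) (k a * 2 ^ i + 2 ^ i) := by
      intro t ht
      simp only [hS, Finset.mem_filter, Finset.mem_Ico, ne_eq, ediv_two_pow_eq_iff,
        Finset.mem_union] at ht ⊢
      omega
    have h2 : S.card ≤ (h a).natAbs := by
      refine (Finset.card_le_card hsub).trans ((Finset.card_union_le _ _).trans ?_)
      simp only [Int.card_Ico]
      omega
    calc (S.card : ℝ) ≤ ((h a).natAbs : ℝ) := by exact_mod_cast h2
      _ = ‖h a‖ := by rw [Int.norm_eq_abs, ← Int.cast_abs, Int.abs_eq_natAbs]; simp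
      _ ≤ ‖h‖ := norm_le_pi_norm h a
  have hsub : (block i k).filter (fun x => (x - h) a / 2 ^ i ≠ k a) ⊆
      Fintype.piFinset (Function.update
        (fun b => Finset.Ico (k b * 2 ^ i) (k b * 2 ^ i + 2 ^ i)) a S) := by
    intro x hx
    rw [Finset.mem_filter, block, Fintype.mem_piFinset] at hx
    rw [Fintype.mem_piFinset]
    intro b
    by_cases hb : b = a
    · subst hb
      rw [Function.update_self, hS, Finset.mem_filter]
      exact ⟨hx.1 b, hx.2⟩
    · rw [Function.update_of_ne hb]; exact hx.1 b
  have hn : 1 ≤ n := Nat.one_le_iff_ne_zero.2 fun h0 => by subst h0; exact a.elim0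
  have hprod : (Fintype.piFinset (Function.update
      (fun b => Finset.Ico (k b * 2 ^ i) (k b * 2 ^ i + 2 ^ i)) a S)).card =
      S.card * 2 ^ (i * (n - 1)) := by
    rw [Fintype.card_piFinset, ← Finset.mul_prod_erase _ _ (Finset.mem_univ a),
      Function.update_self]
    congr 1
    rw [Finset.prod_congr rfl (g := fun _ => 2 ^ i)]
    · simp [pow_mul]
    · intro b hb
      rw [Function.update_of_ne (Finset.ne_of_mem_erase hb)]
      simp [toNat_two_pow]
  have hle := Finset.card_le_card hsub
  rw [hprod] at hle
  calc _ ≤ ((S.card * 2 ^ (i * (n - 1)) : ℕ) : ℝ) := by exact_mod_cast hle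
    _ = (S.card : ℝ) * 2 ^ (i * (n - 1)) := by push_cast; ring
    _ ≤ ‖h‖ * 2 ^ (i * (n - 1)) := by gcongr
    _ = 2 ^ (n * i) * (‖h‖ / 2 ^ i) := by
      obtain ⟨m, rfl⟩ := Nat.exists_eq_add_of_le hn
      have : (2 : ℝ) ^ ((1 + m) * i) = 2 ^ i * 2 ^ (i * (1 + m - 1)) := by
        rw [← pow_add]; congr 1; simp; ring
      rw [this]; field_simp

/-- A translation by `h` moves few points of a block out of it. -/
lemma card_block_boundary_le (i : ℕ) (k h : Fin n → ℤ) :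
    ((((block i k).filter fun x => cell i (x - h) ≠ k).card : ℕ) : ℝ) ≤
      2 ^ (n * i) * (n * min 1 (‖h‖ / 2 ^ i)) := by
  classical
  have hsub : (block i k).filter (fun x => cell i (x - h) ≠ k) ⊆
      Finset.univ.biUnion fun a : Fin n =>
        (block i k).filter fun x => (x - h) a / 2 ^ i ≠ k a := by
    intro x hx
    rw [Finset.mem_filter, Function.ne_iff] at hx
    obtain ⟨hx, a, ha⟩ := hx
    exact Finset.mem_biUnion.2 ⟨a, Finset.mem_univ a, Finset.mem_filter.2 ⟨hx, ha⟩⟩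
  calc _ ≤ ((∑ a : Fin n, ((block i k).filter fun x => (x - h) a / 2 ^ i ≠ k a).card : ℕ) : ℝ) := by
        exact_mod_cast (Finset.card_le_card hsub).trans Finset.card_biUnion_le
    _ ≤ ∑ _a : Fin n, 2 ^ (n * i) * min 1 (‖h‖ / 2 ^ i) := by
        push_cast
        exact Finset.sum_le_sum fun a _ => card_block_shift_le i k h a
    _ = _ := by simp; ring

/-! ### The majorants -/

/-- The majorant of a kernel at scale `i`, for the weight `w`. -/
def majorant (w : (Fin n → ℤ) → ℝ≥0∞) (i : ℕ) (x y : Fin n → ℤ) : ℝ≥0∞ :=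
  ((2 : ℝ≥0∞) ^ (n * (i + 1)))⁻¹ * w (cell (i + 1) x - cell (i + 1) y)

/-- The moment of order `δ` of a weight. -/
def moment (w : (Fin n → ℤ) → ℝ≥0∞) (δ : ℝ) : ℝ≥0∞ :=
  ∑' m, w m * ENNReal.ofReal ((1 + ‖m‖) ^ δ)

/-- The rate `2 ^ (-δ)`. -/
def rate (δ : ℝ) : ℝ≥0∞ := ENNReal.ofReal (2 ^ (-δ))

lemma rate_pow (δ : ℝ) (r : ℕ) : rate δ ^ r = ENNReal.ofReal (((2 : ℝ) ^ r) ^ (-δ)) := by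
  rw [rate, ← ENNReal.ofReal_pow (by positivity), ← Real.rpow_natCast, ← Real.rpow_mul (by norm_num),
    ← Real.rpow_natCast, ← Real.rpow_mul (by norm_num), mul_comm]

lemma rate_lt_one {δ : ℝ} (hδ : 0 < δ) : rate δ < 1 := by
  rw [rate, ENNReal.ofReal_lt_one]
  exact Real.rpow_lt_one_of_one_lt_of_neg (by norm_num) (by linarith)

lemma one_le_two_mul_rate {δ : ℝ} (hδ : δ ≤ 1) : 1 ≤ 2 * rate δ := by
  have h : (2 : ℝ≥0∞) = ENNReal.ofReal 2 := by simp
  rw [rate, h, ← ENNReal.ofReal_mul (by norm_num), ENNReal.one_le_ofReal]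
  have : (2 : ℝ) ^ (-1 : ℝ) ≤ 2 ^ (-δ) :=
    Real.rpow_le_rpow_of_exponent_le (by norm_num) (by linarith)
  rw [Real.rpow_neg_one] at this
  linarith

lemma tsum_weight_le_moment (w : (Fin n → ℤ) → ℝ≥0∞) {δ : ℝ} (hδ : 0 < δ) :
    ∑' m, w m ≤ moment w δ := by
  refine ENNReal.tsum_le_tsum fun m => ?_
  refine le_mul_of_one_le_right' ?_
  rw [ENNReal.one_le_ofReal]
  exact Real.one_le_rpow (by linarith [norm_nonneg m]) hδ.le

/-- A block of side `2 ^ (i + 1)` has `2 ^ (n (i + 1))` points, which cancels the normalization of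
the majorant. The predicate sees only the block of `y`; its choices give the total mass, the mass
far away and the mass across a boundary. -/
lemma tsum_majorant_ite (w : (Fin n → ℤ) → ℝ≥0∞) (i : ℕ) (x : Fin n → ℤ)
    (p : (Fin n → ℤ) → Prop) [DecidablePred p] :
    ∑' y, (if p (cell (i + 1) y) then majorant w i x y else 0) =
      ∑' m, if p (cell (i + 1) x - m) then w m else 0 := by
  rw [tsum_block (i + 1), ← (Equiv.subLeft (cell (i + 1) x)).tsum_eq]
  refine tsum_congr fun m => ?_
  have : ∀ y ∈ block (i + 1) (Equiv.subLeft (cell (i + 1) x) m),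
      (if p (cell (i + 1) y) then majorant w i x y else 0) =
      ((2 : ℝ≥0∞) ^ (n * (i + 1)))⁻¹ * if p (cell (i + 1) x - m) then w m else 0 := by
    intro y hy
    rw [mem_block, Equiv.subLeft_apply] at hy
    rw [majorant, hy, sub_sub_cancel]
    split_ifs <;> simp
  rw [Finset.sum_congr rfl this, Finset.sum_const, card_block, nsmul_eq_mul, ← mul_assoc]
  push_cast
  rw [ENNReal.mul_inv_cancel (by positivity) (by finiteness), one_mul]

lemma tsum_majorant (w : (Fin n → ℤ) → ℝ≥0∞) (i : ℕ) (x : Fin n → ℤ) :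
    ∑' y, majorant w i x y = ∑' m, w m := by
  simpa using tsum_majorant_ite w i x fun _ => True

lemma majorant_comm {w : (Fin n → ℤ) → ℝ≥0∞} (hw : ∀ m, w (-m) = w m) (i : ℕ)
    (x y : Fin n → ℤ) : majorant w i x y = majorant w i y x := by
  rw [majorant, majorant, ← hw, neg_sub]

/-- Far from a block, the mass of the majorant at a smaller scale is small. -/
lemma tsum_majorant_far_le (w : (Fin n → ℤ) → ℝ≥0∞) {δ : ℝ} (hδ : 0 < δ) (hδ1 : δ ≤ 1) {i i' : ℕ}
    (hi : i < i') (x : Fin n → ℤ) :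
    ∑' y, (if ‖cell i' x - cell i' y‖ ≤ 1 then 0 else majorant w i x y) ≤
      2 * moment w δ * rate δ ^ (i' - i) := by
  obtain ⟨r, rfl⟩ := Nat.exists_eq_add_of_le (Nat.succ_le_of_lt hi)
  have h1 := tsum_majorant_ite w i x
    fun k => ¬ ‖cell (i + 1 + r) x - cell r k‖ ≤ 1
  simp only [cell_cell, ite_not] at h1
  rw [Nat.succ_eq_add_one, h1]
  have hr : i + 1 + r - i = r + 1 := by omega
  rw [hr, moment, mul_right_comm, ← ENNReal.tsum_mul_left]
  refine ENNReal.tsum_le_tsum fun m => ?_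
  split_ifs with hm
  · exact zero_le
  -- A translation by less than `2 ^ r` changes a quotient by `2 ^ r` by at most one, so
  -- non-adjacent blocks of side `2 ^ i'` force `m` to be large.
  have hm2 : (2 : ℝ) ^ r ≤ ‖m‖ := by
    by_contra hlt
    push Not at hlt
    apply hm
    rw [pi_norm_le_iff_of_nonneg zero_le_one]
    intro a
    have ha : ‖m a‖ < 2 ^ r := (norm_le_pi_norm m a).trans_lt hlt
    rw [Int.norm_eq_abs] at ha
    have ha' : |m a| < 2 ^ r := by exact_mod_cast ha
    rw [← cell_cell]
    simp only [cell, Pi.sub_apply, Int.norm_eq_abs]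
    have hp : (0 : ℤ) < 2 ^ r := by positivity
    generalize x a / 2 ^ (i + 1) = t
    rw [abs_lt] at ha'
    have e1 : t / 2 ^ r ≤ (t - m a) / 2 ^ r + 1 := by
      rw [← Int.add_mul_ediv_right _ 1 hp.ne', one_mul]
      exact Int.ediv_le_ediv hp (by linarith)
    have e2 : (t - m a) / 2 ^ r ≤ t / 2 ^ r + 1 := by
      rw [← Int.add_mul_ediv_right _ 1 hp.ne', one_mul]
      exact Int.ediv_le_ediv hp (by linarith)
    have : |t / 2 ^ r - (t - m a) / 2 ^ r| ≤ 1 := abs_le.2 ⟨by linarith, by linarith⟩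
    exact_mod_cast this
  have h2 : 1 ≤ rate δ ^ r * ENNReal.ofReal ((1 + ‖m‖) ^ δ) := by
    rw [rate_pow, ← ENNReal.ofReal_mul (by positivity), ENNReal.one_le_ofReal,
      Real.rpow_neg (by positivity), ← div_eq_inv_mul, ← Real.div_rpow (by positivity) (by positivity)]
    refine Real.one_le_rpow ?_ hδ.le
    rw [one_le_div (by positivity)]; linarith
  -- The moment yields only the power `r = i' - i - 1` of the rate; the missing factor is paid by `1
  -- ≤ 2 * rate δ`, where `δ ≤ 1` enters.
  calc w m = 1 * 1 * w m := by ring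
    _ ≤ (2 * rate δ) * (rate δ ^ r * ENNReal.ofReal ((1 + ‖m‖) ^ δ)) * w m := by
      gcongr; exact one_le_two_mul_rate hδ1
    _ = _ := by ring

lemma min_one_le_rpow {t δ : ℝ} (ht : 0 ≤ t) (hδ : 0 < δ) (hδ1 : δ ≤ 1) : min 1 t ≤ t ^ δ := by
  rcases le_total 1 t with h | h
  · exact (min_le_left _ _).trans (Real.one_le_rpow h hδ.le)
  · exact (min_le_right _ _).trans (Real.self_le_rpow_of_le_one ht h hδ1)

/-- The mass of the majorant which crosses the boundary of a larger block is small. -/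
lemma sum_majorant_boundary_le (w : (Fin n → ℤ) → ℝ≥0∞) {δ : ℝ} (hδ : 0 < δ) (hδ1 : δ ≤ 1)
    {i i' : ℕ} (hi : i ≤ i') (k : Fin n → ℤ) :
    ∑ x ∈ block i' k, ∑' y, (if cell i' y = k then 0 else majorant w i x y) ≤
      2 ^ (n * i') * ((2 * n + 1) * moment w δ * rate δ ^ (i' - i)) := by
  -- At equal scales there is no gain and the total mass is used; the summand `1` in `2 * n + 1`
  -- covers this case.
  rcases hi.eq_or_lt with rfl | hlt
  · calc _ ≤ ∑ x ∈ block i k, moment w δ := by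
          refine Finset.sum_le_sum fun x _ => ?_
          refine le_trans ?_ ((tsum_majorant w i x).trans_le (tsum_weight_le_moment w hδ))
          refine ENNReal.tsum_le_tsum fun y => ?_
          split_ifs <;> simp
      _ = 2 ^ (n * i) * (1 * moment w δ * rate δ ^ (i - i)) := by
          rw [Finset.sum_const, card_block]; simp
      _ ≤ _ := by gcongr; exact le_add_self
  obtain ⟨r, rfl⟩ := Nat.exists_eq_add_of_le (Nat.succ_le_of_lt hlt)
  rw [Nat.succ_eq_add_one] at *
  have hr : i + 1 + r - i = r + 1 := by omega
  -- The sum over `y` becomes a sum over translations of `x` by multiples of `2 ^ (i + 1)`, weighted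
  -- by `w`. It remains to count the points which a translation moves out of the block.
  have h1 : ∀ x, ∑' y, (if cell (i + 1 + r) y = k then 0 else majorant w i x y) =
      ∑' m, if cell (i + 1 + r) (x - fun a => 2 ^ (i + 1) * m a) = k then 0 else w m := by
    intro x
    have := tsum_majorant_ite w i x fun l => ¬ cell r l = k
    simp only [cell_cell, ite_not] at this
    rw [this]
    simp only [← cell_sub_mul, cell_cell]
  simp only [h1]
  rw [← Summable.tsum_finsetSum (fun _ _ => ENNReal.summable), hr]
  calc _ ≤ ∑' m, (2 : ℝ≥0∞) ^ (n * (i + 1 + r)) * (n * rate δ ^ r) *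
        (w m * ENNReal.ofReal ((1 + ‖m‖) ^ δ)) := by
        refine ENNReal.tsum_le_tsum fun m => ?_
        set h : Fin n → ℤ := fun a => 2 ^ (i + 1) * m a with hh
        have e1 : ∑ x ∈ block (i + 1 + r) k, (if cell (i + 1 + r) (x - h) = k then 0 else w m) =
            (((block (i + 1 + r) k).filter fun x => cell (i + 1 + r) (x - h) ≠ k).card : ℝ≥0∞) *
              w m := by
          rw [Finset.card_filter]
          push_cast
          rw [Finset.sum_mul]
          refine Finset.sum_congr rfl fun x _ => ?_
          by_cases hx : cell (i + 1 + r) (x - h) = k <;> simp [hx]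
        rw [e1]
        have hnorm : ‖h‖ ≤ 2 ^ (i + 1) * ‖m‖ := by
          rw [pi_norm_le_iff_of_nonneg (by positivity)]
          intro a
          rw [hh, norm_mul]
          gcongr
          · simp [Int.norm_eq_abs]
          · exact norm_le_pi_norm m a
        -- The relative shift is at most `(1 + ‖m‖) / 2 ^ r`. Then `min 1 t ≤ t ^ δ` trades the
        -- count for the moment and the decay in `r`.
        have e2 : ((((block (i + 1 + r) k).filter
            fun x => cell (i + 1 + r) (x - h) ≠ k).card : ℕ) : ℝ) ≤
            2 ^ (n * (i + 1 + r)) * (n * ((2 ^ r) ^ (-δ))) * (1 + ‖m‖) ^ δ := by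
          refine (card_block_boundary_le _ k h).trans ?_
          rw [mul_assoc, mul_assoc]
          gcongr
          refine (min_one_le_rpow (by positivity) hδ hδ1).trans ?_
          rw [Real.rpow_neg (by positivity), ← div_eq_inv_mul, ← Real.div_rpow (by positivity) (by positivity)]
          refine Real.rpow_le_rpow (by positivity) ?_ hδ.le
          rw [div_le_div_iff₀ (by positivity) (by positivity), pow_add (2 : ℝ) (i + 1) r]
          have : ‖h‖ ≤ 2 ^ (i + 1) * (1 + ‖m‖) := hnorm.trans (by gcongr; linarith)
          calc ‖h‖ * 2 ^ r ≤ 2 ^ (i + 1) * (1 + ‖m‖) * 2 ^ r := by gcongr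
            _ = _ := by ring
        have e3 := ENNReal.ofReal_le_ofReal e2
        rw [ENNReal.ofReal_natCast, ENNReal.ofReal_mul (by positivity),
          ENNReal.ofReal_mul (by positivity), ENNReal.ofReal_mul (by positivity), ← rate_pow,
          ENNReal.ofReal_natCast, ENNReal.ofReal_pow (by norm_num), ENNReal.ofReal_ofNat] at e3
        calc _ ≤ _ := mul_le_mul_left e3 _
          _ = _ := by ring
    _ = 2 ^ (n * (i + 1 + r)) * (n * moment w δ * 1 * rate δ ^ r) := by
        rw [ENNReal.tsum_mul_left, moment]; ring
    _ ≤ 2 ^ (n * (i + 1 + r)) * (n * moment w δ * (2 * rate δ) * rate δ ^ r) := by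
        gcongr; exact one_le_two_mul_rate hδ1
    _ = 2 ^ (n * (i + 1 + r)) * (2 * n * moment w δ * rate δ ^ (r + 1)) := by ring
    _ ≤ _ := by gcongr; exact le_self_add

/-! ### Averages over blocks -/

/-- The average of `f` over the block of side `2 ^ i` around a point. -/
def avg (i : ℕ) (f : (Fin n → ℤ) → ℂ) (x : Fin n → ℤ) : ℂ :=
  ((2 : ℂ) ^ (n * i))⁻¹ * ∑ y ∈ block i (cell i x), f y

/-- The square of the `ℓ²` norm. -/
def sqNorm (f : (Fin n → ℤ) → ℂ) : ℝ≥0∞ := ∑' x, ‖f x‖ₑ ^ 2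

lemma avg_congr {i : ℕ} {x x' : Fin n → ℤ} (f : (Fin n → ℤ) → ℂ) (h : cell i x = cell i x') :
    avg i f x = avg i f x' := by rw [avg, avg, h]

lemma avg_zero (f : (Fin n → ℤ) → ℂ) : avg 0 f = f := by
  funext x
  have : block 0 x = {x} := by ext y; rw [mem_block, cell_zero, Finset.mem_singleton]
  rw [avg, cell_zero, this]; simp

lemma finite_support_avg {f : (Fin n → ℤ) → ℂ} (hf : f.support.Finite) (i : ℕ) :
    (avg i f).support.Finite := by
  refine (hf.biUnion fun y _ => (block i (cell i y)).finite_toSet).subset fun x hx => ?_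
  simp only [Function.mem_support, avg] at hx
  obtain ⟨y, hy, hy0⟩ := Finset.exists_ne_zero_of_sum_ne_zero (right_ne_zero_of_mul hx)
  simp only [Set.mem_iUnion]
  exact ⟨y, hy0, by simpa [mem_block] using (mem_block.1 hy).symm⟩

lemma sum_block_mul_avg (i : ℕ) {h : (Fin n → ℤ) → ℂ}
    (hh : ∀ x x', cell i x = cell i x' → h x = h x') (f : (Fin n → ℤ) → ℂ) (k : Fin n → ℤ) :
    ∑ y ∈ block i k, h y * f y = ∑ y ∈ block i k, h y * avg i f y := by
  rcases (block i k).eq_empty_or_nonempty with h0 | ⟨x, hx⟩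
  · simp [h0]
  have h1 : ∀ y ∈ block i k, h y = h x := fun y hy =>
    hh _ _ ((mem_block.1 hy).trans (mem_block.1 hx).symm)
  have e1 : ∑ y ∈ block i k, h y * f y = h x * ∑ z ∈ block i k, f z := by
    rw [Finset.mul_sum]
    exact Finset.sum_congr rfl fun y hy => by rw [h1 y hy]
  have e2 : ∑ y ∈ block i k, h y * avg i f y =
      ∑ _y ∈ block i k, h x * (((2 : ℂ) ^ (n * i))⁻¹ * ∑ z ∈ block i k, f z) :=
    Finset.sum_congr rfl fun y hy => by rw [h1 y hy, avg, mem_block.1 hy]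
  rw [e1, e2, Finset.sum_const, card_block, nsmul_eq_mul]
  push_cast
  field_simp

lemma summable_mul_of_finite {f : (Fin n → ℤ) → ℂ} (hf : f.support.Finite) (h : (Fin n → ℤ) → ℂ) :
    Summable fun x => h x * f x :=
  summable_of_hasFiniteSupport (hf.subset fun _ hx => right_ne_zero_of_mul hx)

lemma tsum_mul_avg {f : (Fin n → ℤ) → ℂ} (hf : f.support.Finite) {i : ℕ} {h : (Fin n → ℤ) → ℂ}
    (hh : ∀ x x', cell i x = cell i x' → h x = h x') :
    ∑' x, h x * f x = ∑' x, h x * avg i f x := by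
  rw [tsum_block_of_summable i (summable_mul_of_finite hf h),
    tsum_block_of_summable i (summable_mul_of_finite (finite_support_avg hf i) h)]
  exact tsum_congr fun k => sum_block_mul_avg i hh f k

lemma sum_block_avg {f : (Fin n → ℤ) → ℂ} (hf : f.support.Finite) {i i' : ℕ} (hi : i ≤ i')
    (k : Fin n → ℤ) : ∑ x ∈ block i' k, avg i f x = ∑ x ∈ block i' k, f x := by
  have key := tsum_mul_avg hf (i := i) (h := fun x => if cell i' x = k then 1 else 0)
    fun x x' hx => by rw [cell_eq_of_le hi hx]
  have h1 : ∀ F : (Fin n → ℤ) → ℂ, ∑' x, (if cell i' x = k then 1 else 0) * F x =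
      ∑ x ∈ block i' k, F x := by
    intro F
    rw [tsum_eq_sum (s := block i' k)]
    · exact Finset.sum_congr rfl fun x hx => by rw [if_pos (mem_block.1 hx), one_mul]
    · intro x hx; rw [if_neg fun h => hx (mem_block.2 h), zero_mul]
  rw [h1, h1] at key
  exact key.symm

/-- Pythagoras: the deviations from the mean are orthogonal to the constants. The additive form
avoids subtraction in `ℝ≥0∞`. -/
lemma sum_sq_norm_sub_add {ι : Type*} (s : Finset ι) (a : ι → ℂ) (m : ℂ)
    (h : ∑ x ∈ s, a x = s.card * m) :
    ∑ x ∈ s, ‖a x - m‖ₑ ^ 2 + ∑ _x ∈ s, ‖m‖ₑ ^ 2 = ∑ x ∈ s, ‖a x‖ₑ ^ 2 := by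
  have e : ∀ z : ℂ, ‖z‖ₑ ^ 2 = ENNReal.ofReal (‖z‖ ^ 2) := fun z => by
    rw [ENNReal.ofReal_pow (norm_nonneg z), ofReal_norm]
  simp only [e]
  rw [← ENNReal.ofReal_sum_of_nonneg fun _ _ => by positivity,
    ← ENNReal.ofReal_sum_of_nonneg fun _ _ => by positivity,
    ← ENNReal.ofReal_sum_of_nonneg fun _ _ => by positivity,
    ← ENNReal.ofReal_add (Finset.sum_nonneg fun _ _ => by positivity)
      (Finset.sum_nonneg fun _ _ => by positivity), ← Finset.sum_add_distrib]
  congr 1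
  have h1 : ∑ x ∈ s, (a x - m) = 0 := by
    rw [Finset.sum_sub_distrib, h, Finset.sum_const, nsmul_eq_mul, sub_self]
  have h2 : ∑ x ∈ s, ((a x - m) * (starRingEnd ℂ) m).re = 0 := by
    rw [← Complex.re_sum, ← Finset.sum_mul, h1, zero_mul, Complex.zero_re]
  have h3 : ∀ x, ‖a x‖ ^ 2 = ‖a x - m‖ ^ 2 + ‖m‖ ^ 2 + 2 * ((a x - m) * (starRingEnd ℂ) m).re := by
    intro x
    simp only [← Complex.normSq_eq_norm_sq]
    rw [← Complex.normSq_add]; ring_nf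
  simp only [h3, Finset.sum_add_distrib, ← Finset.mul_sum, h2, mul_zero, add_zero]

/-- The martingale difference `avg i f - avg (i + 1) f`. -/
def diff (i : ℕ) (f : (Fin n → ℤ) → ℂ) : (Fin n → ℤ) → ℂ := fun x => avg i f x - avg (i + 1) f x

lemma finite_support_diff {f : (Fin n → ℤ) → ℂ} (hf : f.support.Finite) (i : ℕ) :
    (diff i f).support.Finite :=
  ((finite_support_avg hf i).union (finite_support_avg hf (i + 1))).subset
    (Function.support_sub _ _)

/-- Pythagoras on each block of side `2 ^ (i + 1)`, over which `avg i f` and `f` have the same mean.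
-/
lemma sqNorm_diff_add {f : (Fin n → ℤ) → ℂ} (hf : f.support.Finite) (i : ℕ) :
    sqNorm (diff i f) + sqNorm (avg (i + 1) f) = sqNorm (avg i f) := by
  simp only [sqNorm]
  rw [tsum_block (i + 1) fun x => ‖diff i f x‖ₑ ^ 2, tsum_block (i + 1) fun x => ‖avg i f x‖ₑ ^ 2,
    tsum_block (i + 1) fun x => ‖avg (i + 1) f x‖ₑ ^ 2, ← ENNReal.tsum_add]
  refine tsum_congr fun k => ?_
  set m : ℂ := ((2 : ℂ) ^ (n * (i + 1)))⁻¹ * ∑ y ∈ block (i + 1) k, f y with hm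
  have hav : ∀ x ∈ block (i + 1) k, avg (i + 1) f x = m := fun x hx => by
    rw [avg, mem_block.1 hx]
  have e1 : ∑ x ∈ block (i + 1) k, ‖diff i f x‖ₑ ^ 2 =
      ∑ x ∈ block (i + 1) k, ‖avg i f x - m‖ₑ ^ 2 :=
    Finset.sum_congr rfl fun x hx => by rw [diff, hav x hx]
  have e2 : ∑ x ∈ block (i + 1) k, ‖avg (i + 1) f x‖ₑ ^ 2 = ∑ _x ∈ block (i + 1) k, ‖m‖ₑ ^ 2 :=
    Finset.sum_congr rfl fun x hx => by rw [hav x hx]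
  rw [e1, e2]
  refine sum_sq_norm_sub_add _ _ m ?_
  rw [sum_block_avg hf (Nat.le_succ i), card_block, hm]
  push_cast
  field_simp

lemma sum_sqNorm_diff {f : (Fin n → ℤ) → ℂ} (hf : f.support.Finite) (L : ℕ) :
    ∑ i ∈ Finset.range L, sqNorm (diff i f) + sqNorm (avg L f) = sqNorm f := by
  induction L with
  | zero => simp [avg_zero]
  | succ L ih => rw [Finset.sum_range_succ, add_assoc, sqNorm_diff_add hf, ih]

/-! ### Kernels -/

/-- A family of kernels on the lattice: the kernel at scale `i` is constant on blocks of side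
`2 ^ i` in each variable, and dominated by the majorant. -/
structure IsKernel (w : (Fin n → ℤ) → ℝ≥0∞) (K : ℕ → (Fin n → ℤ) → (Fin n → ℤ) → ℂ) : Prop where
  enorm_le : ∀ i x y, ‖K i x y‖ₑ ≤ majorant w i x y
  left_const : ∀ i x x' y, cell i x = cell i x' → K i x y = K i x' y
  right_const : ∀ i x y y', cell i y = cell i y' → K i x y = K i x y'

/-- The cancellation conditions: mean zero over the blocks of side `2 ^ (i + 1)` in the first
variable, and in total in the second one. -/
structure IsCancelling (K : ℕ → (Fin n → ℤ) → (Fin n → ℤ) → ℂ) : Prop where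
  sum_left : ∀ i k y, ∑ x ∈ block (i + 1) k, K i x y = 0
  tsum_right : ∀ i x, ∑' y, K i x y = 0

/-- The operator with kernel `K i`. -/
def kernelOp (K : ℕ → (Fin n → ℤ) → (Fin n → ℤ) → ℂ) (i : ℕ) (f : (Fin n → ℤ) → ℂ)
    (x : Fin n → ℤ) : ℂ := ∑' y, K i x y * f y

/-- The bilinear form with kernel `K i`. -/
def kernelForm (K : ℕ → (Fin n → ℤ) → (Fin n → ℤ) → ℂ) (i : ℕ) (g f : (Fin n → ℤ) → ℂ) : ℂ :=
  ∑' x, kernelOp K i f x * g x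

section

variable {w : (Fin n → ℤ) → ℝ≥0∞} {δ : ℝ} {K : ℕ → (Fin n → ℤ) → (Fin n → ℤ) → ℂ}

/-! ### Reduction of the forms to martingale differences -/

lemma kernelOp_avg (hK : IsKernel w K) {f : (Fin n → ℤ) → ℂ} (hf : f.support.Finite) (i : ℕ) :
    kernelOp K i (avg i f) = kernelOp K i f := by
  funext x
  exact (tsum_mul_avg hf fun y y' h => hK.right_const i x y y' h).symm

lemma kernelOp_const (hK : IsKernel w K) (f : (Fin n → ℤ) → ℂ) (i : ℕ) {x x' : Fin n → ℤ}
    (h : cell i x = cell i x') : kernelOp K i f x = kernelOp K i f x' :=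
  tsum_congr fun y => by rw [hK.left_const i x x' y h]

lemma sum_kernelOp_eq_zero (hK : IsCancelling K) {f : (Fin n → ℤ) → ℂ}
    (hf : f.support.Finite) (i : ℕ) (k : Fin n → ℤ) :
    ∑ x ∈ block (i + 1) k, kernelOp K i f x = 0 := by
  simp only [kernelOp]
  rw [← Summable.tsum_finsetSum fun x _ => summable_mul_of_finite hf _]
  simp only [← Finset.sum_mul, hK.sum_left, zero_mul, tsum_zero]

/-- Both functions may be averaged over blocks of side `2 ^ i`, on which the kernel is constant. The
part `avg (i + 1) g` is then killed by the mean zero condition in the first variable. -/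
lemma kernelForm_eq_diff_avg (hK : IsKernel w K) (hc : IsCancelling K)
    {g f : (Fin n → ℤ) → ℂ} (hg : g.support.Finite) (hf : f.support.Finite) (i : ℕ) :
    kernelForm K i g f = kernelForm K i (diff i g) (avg i f) := by
  simp only [kernelForm, kernelOp_avg hK hf]
  rw [tsum_mul_avg hg fun x x' h => kernelOp_const hK f i h]
  simp only [diff, mul_sub]
  rw [Summable.tsum_sub (summable_mul_of_finite (finite_support_avg hg i) _)
    (summable_mul_of_finite (finite_support_avg hg (i + 1)) _), eq_comm, sub_eq_self,
    tsum_block_of_summable (i + 1) (summable_mul_of_finite (finite_support_avg hg (i + 1)) _)]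
  refine (tsum_congr fun k => ?_).trans tsum_zero
  rcases (block (i + 1) k).eq_empty_or_nonempty with h0 | ⟨y, hy⟩
  · simp [h0]
  have h1 : ∀ x ∈ block (i + 1) k, kernelOp K i f x * avg (i + 1) g x =
      kernelOp K i f x * avg (i + 1) g y := fun x hx => by
    rw [avg_congr g ((mem_block.1 hx).trans (mem_block.1 hy).symm)]
  rw [Finset.sum_congr rfl h1, ← Finset.sum_mul, sum_kernelOp_eq_zero hc hf, zero_mul]

/-! ### Almost orthogonality and the `ℓ²` estimate -/

lemma mul_le_mul_sq_add (a b : ℝ≥0∞) {t : ℝ≥0∞} (ht : t ≠ 0) (ht' : t ≠ ∞) :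
    a * b ≤ t * a ^ 2 + t⁻¹ * b ^ 2 := by
  rcases le_total b (t * a) with h | h
  · refine le_add_right ?_
    calc a * b ≤ a * (t * a) := by gcongr
      _ = t * a ^ 2 := by ring
  · refine le_add_left ?_
    calc a * b = t⁻¹ * (t * a) * b := by rw [← mul_assoc, ENNReal.inv_mul_cancel ht ht', one_mul]
      _ ≤ t⁻¹ * b * b := by gcongr
      _ = t⁻¹ * b ^ 2 := by ring

lemma enorm_sub_sq_le (a b : ℂ) : ‖a - b‖ₑ ^ 2 ≤ 2 * (‖a‖ₑ ^ 2 + ‖b‖ₑ ^ 2) := by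
  calc ‖a - b‖ₑ ^ 2 ≤ (‖a‖ₑ + ‖b‖ₑ) ^ 2 := by gcongr; exact enorm_sub_le
    _ = ‖a‖ₑ ^ 2 + ‖b‖ₑ ^ 2 + 2 * (‖a‖ₑ * ‖b‖ₑ) := by ring
    _ ≤ ‖a‖ₑ ^ 2 + ‖b‖ₑ ^ 2 + (‖a‖ₑ ^ 2 + ‖b‖ₑ ^ 2) := by
      gcongr
      rcases eq_or_ne ‖b‖ₑ 0 with h | h
      · simp [h]
      have h' : ‖b‖ₑ ≠ ∞ := enorm_ne_top
      have := two_mul_le_add_sq (‖a‖) (‖b‖)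
      have h2 := ENNReal.ofReal_le_ofReal this
      rw [ENNReal.ofReal_add (by positivity) (by positivity), ENNReal.ofReal_mul (by positivity),
        ENNReal.ofReal_mul (by positivity), ENNReal.ofReal_pow (by positivity),
        ENNReal.ofReal_pow (by positivity), ofReal_norm, ofReal_norm, ENNReal.ofReal_ofNat,
        mul_assoc] at h2
      exact h2
    _ = _ := by ring

/-- The difference vanishes unless `x` and `y` lie in different blocks of side `2 ^ i'`, so only the
mass across the boundaries counts. The squares of `u x` and `u y` contribute equally because the
majorant is symmetric, which accounts for the factor `4`. -/
lemma tsum_majorant_mul_sq_sub_le (hw : ∀ m, w (-m) = w m) (hδ : 0 < δ) (hδ1 : δ ≤ 1) {i i' : ℕ}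
    (hi : i ≤ i') {u : (Fin n → ℤ) → ℂ} (hu : ∀ x x', cell i' x = cell i' x' → u x = u x') :
    ∑' x, ∑' y, majorant w i x y * ‖u y - u x‖ₑ ^ 2 ≤
      4 * ((2 * n + 1) * moment w δ * rate δ ^ (i' - i)) * sqNorm u := by
  set m : (Fin n → ℤ) → (Fin n → ℤ) → ℝ≥0∞ := fun x y =>
    if cell i' y = cell i' x then 0 else majorant w i x y with hm
  have hmc : ∀ x y, m x y = m y x := fun x y => by
    simp only [hm, majorant_comm hw i x y, eq_comm]
  have h1 : ∀ x y, majorant w i x y * ‖u y - u x‖ₑ ^ 2 ≤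
      2 * (m x y * ‖u x‖ₑ ^ 2 + m x y * ‖u y‖ₑ ^ 2) := by
    intro x y
    by_cases h : cell i' y = cell i' x
    · simp [hu y x h]
    · calc _ ≤ majorant w i x y * (2 * (‖u y‖ₑ ^ 2 + ‖u x‖ₑ ^ 2)) := by
            gcongr; exact enorm_sub_sq_le _ _
        _ = _ := by simp only [hm, if_neg h]; ring
  have h2 : ∑' x, ∑' y, m x y * ‖u x‖ₑ ^ 2 ≤
      ((2 * n + 1) * moment w δ * rate δ ^ (i' - i)) * sqNorm u := by
    rw [sqNorm, tsum_block i' fun x => ‖u x‖ₑ ^ 2, tsum_block i', ← ENNReal.tsum_mul_left]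
    refine ENNReal.tsum_le_tsum fun k => ?_
    rcases (block i' k).eq_empty_or_nonempty with h0 | ⟨z, hz⟩
    · simp [h0]
    have hz' : ∀ x ∈ block i' k, u x = u z := fun x hx =>
      hu _ _ ((mem_block.1 hx).trans (mem_block.1 hz).symm)
    calc ∑ x ∈ block i' k, ∑' y, m x y * ‖u x‖ₑ ^ 2
        = (∑ x ∈ block i' k, ∑' y, if cell i' y = k then 0 else majorant w i x y) *
            ‖u z‖ₑ ^ 2 := by
          rw [Finset.sum_mul]
          refine Finset.sum_congr rfl fun x hx => ?_
          rw [ENNReal.tsum_mul_right, hz' x hx, ← mem_block.1 hx]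
      _ ≤ _ := mul_le_mul_left (sum_majorant_boundary_le w hδ hδ1 hi k) _
      _ = _ := by
          rw [Finset.sum_congr rfl fun x hx => by rw [hz' x hx], Finset.sum_const, card_block,
            nsmul_eq_mul]
          push_cast; ring
  have h3 : ∑' x, ∑' y, m x y * ‖u y‖ₑ ^ 2 = ∑' x, ∑' y, m x y * ‖u x‖ₑ ^ 2 := by
    rw [ENNReal.tsum_comm]
    exact tsum_congr fun x => tsum_congr fun y => by rw [hmc]
  calc _ ≤ ∑' x, ∑' y, 2 * (m x y * ‖u x‖ₑ ^ 2 + m x y * ‖u y‖ₑ ^ 2) :=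
        ENNReal.tsum_le_tsum fun x => ENNReal.tsum_le_tsum fun y => h1 x y
    _ = 2 * (∑' x, ∑' y, m x y * ‖u x‖ₑ ^ 2 + ∑' x, ∑' y, m x y * ‖u x‖ₑ ^ 2) := by
        simp only [ENNReal.tsum_mul_left, ENNReal.tsum_add]
        rw [h3]
    _ ≤ 2 * (((2 * n + 1) * moment w δ * rate δ ^ (i' - i)) * sqNorm u +
          ((2 * n + 1) * moment w δ * rate δ ^ (i' - i)) * sqNorm u) := by gcongr
    _ = _ := by ring

lemma rate_half_sq (δ : ℝ) : rate (δ / 2) ^ 2 = rate δ := by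
  rw [rate_pow, rate, ← Real.rpow_natCast, ← Real.rpow_mul (by norm_num)]
  congr 2; push_cast; ring

lemma rate_ne_zero (δ : ℝ) : rate δ ≠ 0 := by
  rw [rate, ne_eq, ENNReal.ofReal_eq_zero, not_le]; positivity

lemma rate_ne_top (δ : ℝ) : rate δ ≠ ∞ := ENNReal.ofReal_ne_top

lemma IsKernel.summable (hK : IsKernel w K) (hδ : 0 < δ) (hm : moment w δ ≠ ∞) (i : ℕ)
    (x : Fin n → ℤ) : Summable fun y => K i x y := by
  refine Summable.of_norm (ENNReal.summable_toReal (f := fun y => ‖K i x y‖ₑ) ?_ |>.congr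
    fun y => by simp)
  refine ne_top_of_le_ne_top hm ?_
  exact (ENNReal.tsum_le_tsum fun y => hK.enorm_le i x y).trans
    ((tsum_majorant w i x).trans_le (tsum_weight_le_moment w hδ))

/-- Almost orthogonality: a cancelling kernel at scale `i` is small on functions which are constant
on much larger blocks. -/
lemma enorm_kernelForm_le (hK : IsKernel w K) (hc : IsCancelling K) (hw : ∀ m, w (-m) = w m)
    (hδ : 0 < δ) (hδ1 : δ ≤ 1) (hm : moment w δ ≠ ∞) {i i' : ℕ} (hi : i ≤ i')
    (v : (Fin n → ℤ) → ℂ) {u : (Fin n → ℤ) → ℂ}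
    (hu : ∀ x x', cell i' x = cell i' x' → u x = u x') (hus : u.support.Finite) :
    ‖kernelForm K i v u‖ₑ ≤ 4 * ((2 * n + 1) * moment w δ) * rate (δ / 2) ^ (i' - i) *
      (sqNorm v + sqNorm u) := by
  -- In `a b ≤ t a² + t⁻¹ b²` the term of `v` has no decay, while that of `u` decays like `rate δ ^
  -- (i' - i)`. The square root of this decay, taken as `t`, gives both terms the same gain.
  set t := rate (δ / 2) ^ (i' - i) with ht
  have ht0 : t ≠ 0 := pow_ne_zero _ (rate_ne_zero _)
  have ht1 : t ≠ ∞ := ENNReal.pow_ne_top (rate_ne_top _)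
  have htt : t⁻¹ * rate δ ^ (i' - i) = t := by
    rw [← rate_half_sq, ← pow_mul, mul_comm 2, pow_mul, ← ht, sq, ← mul_assoc,
      ENNReal.inv_mul_cancel ht0 ht1, one_mul]
  -- Subtracting `u x` costs nothing since the row sums vanish; this cancellation produces the
  -- decay.
  have h1 : ∀ x, kernelOp K i u x = ∑' y, K i x y * (u y - u x) := by
    intro x
    simp only [mul_sub]
    rw [Summable.tsum_sub (summable_mul_of_finite hus _)
      ((hK.summable hδ hm i x).mul_right _), tsum_mul_right, hc.tsum_right, zero_mul, sub_zero]
    rfl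
  calc ‖kernelForm K i v u‖ₑ ≤ ∑' x, ∑' y, majorant w i x y * (‖v x‖ₑ * ‖u y - u x‖ₑ) := by
        refine enorm_tsum_le_tsum_enorm.trans (ENNReal.tsum_le_tsum fun x => ?_)
        rw [enorm_mul, h1, tsum_congr fun y => (mul_assoc _ _ _).symm.trans
          (mul_right_comm _ _ _), ENNReal.tsum_mul_right]
        gcongr
        refine enorm_tsum_le_tsum_enorm.trans (ENNReal.tsum_le_tsum fun y => ?_)
        rw [enorm_mul]
        gcongr
        exact hK.enorm_le i x y
    _ ≤ ∑' x, ∑' y, (t * (majorant w i x y * ‖v x‖ₑ ^ 2) +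
          t⁻¹ * (majorant w i x y * ‖u y - u x‖ₑ ^ 2)) := by
        refine ENNReal.tsum_le_tsum fun x => ENNReal.tsum_le_tsum fun y => ?_
        calc _ ≤ majorant w i x y * (t * ‖v x‖ₑ ^ 2 + t⁻¹ * ‖u y - u x‖ₑ ^ 2) := by
              gcongr; exact mul_le_mul_sq_add _ _ ht0 ht1
          _ = _ := by ring
    _ = t * (∑' m, w m) * sqNorm v +
          t⁻¹ * ∑' x, ∑' y, majorant w i x y * ‖u y - u x‖ₑ ^ 2 := by
        simp only [ENNReal.tsum_add, ENNReal.tsum_mul_left, ENNReal.tsum_mul_right, tsum_majorant]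
        rw [sqNorm]; ring
    _ ≤ t * (4 * ((2 * n + 1) * moment w δ)) * sqNorm v +
          t⁻¹ * (4 * ((2 * n + 1) * moment w δ * rate δ ^ (i' - i)) * sqNorm u) := by
        gcongr
        · calc ∑' m, w m ≤ 1 * (1 * moment w δ) := by
                rw [one_mul, one_mul]; exact tsum_weight_le_moment w hδ
            _ ≤ _ := by
                gcongr
                · norm_num
                · exact le_add_self
        · exact tsum_majorant_mul_sq_sub_le hw hδ hδ1 hi hu
    _ = t * (4 * ((2 * n + 1) * moment w δ)) * sqNorm v +
          4 * ((2 * n + 1) * moment w δ) * (t⁻¹ * rate δ ^ (i' - i)) * sqNorm u := by ring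
    _ = _ := by rw [htt]; ring

lemma kernelForm_sum_right {ι : Type*} (s : Finset ι) {g : (Fin n → ℤ) → ℂ}
    (hg : g.support.Finite) {u : ι → (Fin n → ℤ) → ℂ} (hu : ∀ a ∈ s, (u a).support.Finite) (i : ℕ) :
    kernelForm K i g (fun x => ∑ a ∈ s, u a x) = ∑ a ∈ s, kernelForm K i g (u a) := by
  simp only [kernelForm]
  rw [← Summable.tsum_finsetSum fun a _ => summable_mul_of_finite hg _]
  refine tsum_congr fun x => ?_
  rw [← Finset.sum_mul]
  congr 1
  simp only [kernelOp, Finset.mul_sum]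
  rw [← Summable.tsum_finsetSum fun a ha => summable_mul_of_finite (hu a ha) _]

lemma avg_eq_sum_diff (f : (Fin n → ℤ) → ℂ) {i L : ℕ} (hi : i ≤ L) (x : Fin n → ℤ) :
    avg i f x = ∑ a ∈ Finset.Ico i L, diff a f x + avg L f x := by
  induction L, hi using Nat.le_induction with
  | base => simp
  | succ L hL ih => rw [Finset.sum_Ico_succ_top hL, ih, add_assoc, diff, sub_add_cancel]

/-- The constant in the `ℓ²` estimate. -/
def l2Const (w : (Fin n → ℤ) → ℝ≥0∞) (δ : ℝ) : ℝ≥0∞ :=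
  4 * ((2 * n + 1) * moment w δ) * (1 - rate (δ / 2))⁻¹

lemma l2Const_ne_top (hδ : 0 < δ) (hm : moment w δ ≠ ∞) : l2Const w δ ≠ ∞ := by
  have : (1 - rate (δ / 2))⁻¹ ≠ ∞ := by
    rw [ENNReal.inv_ne_top, ne_eq, tsub_eq_zero_iff_le, not_le]
    exact rate_lt_one (by linarith)
  have h2 : (2 * (n : ℝ≥0∞) + 1) ≠ ∞ := by finiteness
  unfold l2Const
  finiteness

/-- Schur's test for the triangular matrix `ρ ^ (i' - i)`, with the sequence attached to the larger
index; the variant below attaches it to the smaller one. -/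
lemma sum_range_geometric_le {ρ : ℝ≥0∞} (a : ℕ → ℝ≥0∞) (L : ℕ) :
    ∑ i ∈ Finset.range L, ∑ i' ∈ Finset.Ico i L, ρ ^ (i' - i) * a i' ≤
      (1 - ρ)⁻¹ * ∑ i ∈ Finset.range L, a i := by
  rw [← ENNReal.tsum_geometric, Finset.mul_sum]
  have : ∀ i ∈ Finset.range L, ∑ i' ∈ Finset.Ico i L, ρ ^ (i' - i) * a i' =
      ∑ i' ∈ Finset.range L, if i ≤ i' then ρ ^ (i' - i) * a i' else 0 := by
    intro i hi
    rw [← Finset.sum_filter]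
    congr 1
    ext j; simp [and_comm]
  rw [Finset.sum_congr rfl this, Finset.sum_comm]
  refine Finset.sum_le_sum fun i' _ => ?_
  rw [← Finset.sum_filter]
  calc _ ≤ ∑ i ∈ Finset.range (i' + 1), ρ ^ (i' - i) * a i' :=
        Finset.sum_le_sum_of_subset fun i hi => by
          simp only [Finset.mem_filter, Finset.mem_range] at hi ⊢; omega
    _ = ∑ r ∈ Finset.range (i' + 1), ρ ^ r * a i' := by
        rw [← Finset.sum_range_reflect (fun r => ρ ^ r * a i')]
        exact Finset.sum_congr rfl fun i _ => by rw [Nat.add_sub_cancel]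
    _ ≤ _ := by
        rw [← Finset.sum_mul]
        gcongr
        exact ENNReal.sum_le_tsum _

lemma sum_range_geometric_le' {ρ : ℝ≥0∞} (a : ℕ → ℝ≥0∞) (L : ℕ) :
    ∑ i ∈ Finset.range L, ∑ i' ∈ Finset.Ico i L, ρ ^ (i' - i) * a i ≤
      (1 - ρ)⁻¹ * ∑ i ∈ Finset.range L, a i := by
  rw [← ENNReal.tsum_geometric, Finset.mul_sum]
  refine Finset.sum_le_sum fun i _ => ?_
  rw [← Finset.sum_mul, Finset.sum_Ico_eq_sum_range]
  gcongr
  simp only [Nat.add_sub_cancel_left]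
  exact ENNReal.sum_le_tsum _

/-- The `ℓ²` estimate. -/
theorem sum_enorm_kernelForm_le (hK : IsKernel w K) (hc : IsCancelling K)
    (hw : ∀ m, w (-m) = w m) (hδ : 0 < δ) (hδ1 : δ ≤ 1) (hm : moment w δ ≠ ∞)
    {g f : (Fin n → ℤ) → ℂ} (hg : g.support.Finite) (hf : f.support.Finite) (L : ℕ) :
    ∑ i ∈ Finset.range (L + 1), ‖kernelForm K i g f‖ₑ ≤ l2Const w δ * (sqNorm g + sqNorm f) := by
  -- The remaining average `avg L f` serves as the last piece, so no limit in `L` is needed. The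
  -- piece `a ≤ L` is constant on blocks of side `2 ^ a`, and the squared norms of all pieces add up
  -- to that of `f`.
  set u : ℕ → (Fin n → ℤ) → ℂ := fun a => if a < L then diff a f else avg L f with hu
  have hus : ∀ a, (u a).support.Finite := fun a => by
    simp only [hu]; split_ifs
    exacts [finite_support_diff hf a, finite_support_avg hf L]
  have huc : ∀ a ≤ L, ∀ x x', cell a x = cell a x' → u a x = u a x' := fun a ha x x' h => by
    simp only [hu]; split_ifs
    · rw [diff, diff, avg_congr f h, avg_congr f (cell_eq_of_le (Nat.le_succ a) h)]
    · exact avg_congr f (cell_eq_of_le ha h)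
  have hsum : ∀ i ≤ L, avg i f = fun x => ∑ a ∈ Finset.Ico i (L + 1), u a x := fun i hi => by
    funext x
    rw [Finset.sum_Ico_succ_top hi, avg_eq_sum_diff f hi]
    congr 1
    · exact Finset.sum_congr rfl fun a ha => by simp only [hu, if_pos (Finset.mem_Ico.1 ha).2]
    · simp [hu]
  have hsqu : ∑ a ∈ Finset.range (L + 1), sqNorm (u a) = sqNorm f := by
    rw [← sum_sqNorm_diff hf L, Finset.sum_range_succ]
    congr 1
    · exact Finset.sum_congr rfl fun a ha => by simp only [hu, if_pos (Finset.mem_range.1 ha)]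
    · simp [hu]
  have hsqg : ∑ a ∈ Finset.range (L + 1), sqNorm (diff a g) ≤ sqNorm g :=
    le_self_add.trans (sum_sqNorm_diff hg (L + 1)).le
  set ρ := rate (δ / 2)
  set C := 4 * ((2 * n + 1) * moment w δ) with hC
  calc ∑ i ∈ Finset.range (L + 1), ‖kernelForm K i g f‖ₑ
      ≤ ∑ i ∈ Finset.range (L + 1), ∑ a ∈ Finset.Ico i (L + 1),
          C * (ρ ^ (a - i) * sqNorm (diff i g) + ρ ^ (a - i) * sqNorm (u a)) := by
        refine Finset.sum_le_sum fun i hi => ?_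
        rw [Finset.mem_range, Nat.lt_succ_iff] at hi
        rw [kernelForm_eq_diff_avg hK hc hg hf, hsum i hi,
          kernelForm_sum_right _ (finite_support_diff hg i) fun a _ => hus a]
        refine (enorm_sum_le _ _).trans (Finset.sum_le_sum fun a ha => ?_)
        rw [Finset.mem_Ico, Nat.lt_succ_iff] at ha
        refine (enorm_kernelForm_le hK hc hw hδ hδ1 hm ha.1 _ (huc a ha.2) (hus a)).trans ?_
        rw [← mul_add, mul_assoc C]
    _ = C * (∑ i ∈ Finset.range (L + 1), ∑ a ∈ Finset.Ico i (L + 1),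
            ρ ^ (a - i) * sqNorm (diff i g) +
          ∑ i ∈ Finset.range (L + 1), ∑ a ∈ Finset.Ico i (L + 1), ρ ^ (a - i) * sqNorm (u a)) := by
        simp only [← Finset.mul_sum, Finset.sum_add_distrib]
    _ ≤ C * ((1 - ρ)⁻¹ * sqNorm g + (1 - ρ)⁻¹ * sqNorm f) := by
        gcongr
        · exact (sum_range_geometric_le' _ _).trans (by gcongr)
        · exact (sum_range_geometric_le _ _).trans (by rw [hsqu])
    _ = _ := by rw [l2Const]; ring

end

/-! ### The dyadic Calderón–Zygmund decomposition on the lattice -/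

/-- The average of the modulus of `f` over the block of side `2 ^ i` around a point. -/
def absAvg (f : (Fin n → ℤ) → ℂ) (i : ℕ) (x : Fin n → ℤ) : ℝ≥0∞ :=
  ((2 : ℝ≥0∞) ^ (n * i))⁻¹ * ∑ y ∈ block i (cell i x), ‖f y‖ₑ

lemma absAvg_congr {i : ℕ} {x x' : Fin n → ℤ} (f : (Fin n → ℤ) → ℂ) (h : cell i x = cell i x') :
    absAvg f i x = absAvg f i x' := by rw [absAvg, absAvg, h]

lemma absAvg_zero (f : (Fin n → ℤ) → ℂ) (x : Fin n → ℤ) : absAvg f 0 x = ‖f x‖ₑ := by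
  have : block 0 x = {x} := by ext y; rw [mem_block, cell_zero, Finset.mem_singleton]
  rw [absAvg, cell_zero, this]; simp

lemma enorm_avg_le (f : (Fin n → ℤ) → ℂ) (i : ℕ) (x : Fin n → ℤ) :
    ‖avg i f x‖ₑ ≤ absAvg f i x := by
  rw [avg, absAvg, enorm_mul, enorm_inv (by simp)]
  gcongr
  · rw [enorm_pow]; gcongr; simp [enorm_eq_nnnorm]
  · exact enorm_sum_le _ _

lemma absAvg_le_absAvg_succ (f : (Fin n → ℤ) → ℂ) (i : ℕ) (x : Fin n → ℤ) :
    absAvg f i x ≤ 2 ^ n * absAvg f (i + 1) x := by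
  have h : ∑ y ∈ block i (cell i x), ‖f y‖ₑ ≤ ∑ y ∈ block (i + 1) (cell (i + 1) x), ‖f y‖ₑ :=
    Finset.sum_le_sum_of_subset fun y hy =>
      mem_block.2 (cell_eq_of_le (Nat.le_succ i) (mem_block.1 hy))
  have h2 : ((2 : ℝ≥0∞) ^ (n * i))⁻¹ = 2 ^ n * ((2 : ℝ≥0∞) ^ (n * (i + 1)))⁻¹ := by
    rw [mul_add, mul_one, pow_add, ENNReal.mul_inv (by simp) (by simp), mul_comm (2 ^ n : ℝ≥0∞),
      mul_assoc, ENNReal.inv_mul_cancel (by simp) (by finiteness), mul_one]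
  rw [absAvg, absAvg, h2, mul_assoc]
  gcongr

lemma tsum_mul_absAvg (f : (Fin n → ℤ) → ℂ) (i : ℕ) {h : (Fin n → ℤ) → ℝ≥0∞}
    (hh : ∀ x x', cell i x = cell i x' → h x = h x') :
    ∑' x, h x * absAvg f i x = ∑' x, h x * ‖f x‖ₑ := by
  rw [tsum_block i, tsum_block i fun x => h x * ‖f x‖ₑ]
  refine tsum_congr fun k => ?_
  rcases (block i k).eq_empty_or_nonempty with h0 | ⟨x, hx⟩
  · simp [h0]
  have h1 : ∀ y ∈ block i k, h y = h x := fun y hy =>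
    hh _ _ ((mem_block.1 hy).trans (mem_block.1 hx).symm)
  have e1 : ∑ y ∈ block i k, h y * ‖f y‖ₑ = h x * ∑ z ∈ block i k, ‖f z‖ₑ := by
    rw [Finset.mul_sum]
    exact Finset.sum_congr rfl fun y hy => by rw [h1 y hy]
  have e2 : ∑ y ∈ block i k, h y * absAvg f i y =
      ∑ _y ∈ block i k, h x * (((2 : ℝ≥0∞) ^ (n * i))⁻¹ * ∑ z ∈ block i k, ‖f z‖ₑ) :=
    Finset.sum_congr rfl fun y hy => by rw [h1 y hy, absAvg, mem_block.1 hy]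
  rw [e1, e2, Finset.sum_const, card_block, nsmul_eq_mul]
  push_cast
  rw [mul_left_comm, ← mul_assoc (2 ^ (n * i) : ℝ≥0∞),
    ENNReal.mul_inv_cancel (by simp) (by finiteness), one_mul]

/-- The block of side `2 ^ i` around `x` is a maximal one with `|f|`-average above `t`. -/
def IsTop (f : (Fin n → ℤ) → ℂ) (t : ℝ≥0∞) (i : ℕ) (x : Fin n → ℤ) : Prop :=
  t < absAvg f i x ∧ ∀ i' > i, absAvg f i' x ≤ t

lemma IsTop.unique {f : (Fin n → ℤ) → ℂ} {t : ℝ≥0∞} {i i' : ℕ} {x : Fin n → ℤ}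
    (h : IsTop f t i x) (h' : IsTop f t i' x) : i = i' := by
  rcases lt_trichotomy i i' with hl | he | hl
  · exact absurd h'.1 (h.2 i' hl).not_gt
  · exact he
  · exact absurd h.1 (h'.2 i hl).not_gt

lemma isTop_congr {f : (Fin n → ℤ) → ℂ} {t : ℝ≥0∞} {i : ℕ} {x x' : Fin n → ℤ}
    (h : cell i x = cell i x') : IsTop f t i x ↔ IsTop f t i x' := by
  unfold IsTop
  rw [absAvg_congr f h]
  exact and_congr_right fun _ => forall₂_congr fun i' hi' => by
    rw [absAvg_congr f (cell_eq_of_le (le_of_lt hi') h)]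

lemma tsum_enorm_ne_top {f : (Fin n → ℤ) → ℂ} (hf : f.support.Finite) : ∑' x, ‖f x‖ₑ ≠ ∞ := by
  rw [tsum_eq_sum (s := hf.toFinset) fun x hx => by simpa using hx]
  exact (ENNReal.sum_lt_top.2 fun x _ => enorm_lt_top).ne

/-- The averages are at most the total mass divided by `2 ^ (n i)`, which tends to zero because `n ≥
1`. Hence maximal blocks exist and have bounded size. -/
lemma exists_absAvg_le (hn : 1 ≤ n) {f : (Fin n → ℤ) → ℂ} (hf : f.support.Finite) {t : ℝ≥0∞}
    (ht : t ≠ 0) : ∃ N : ℕ, ∀ i ≥ N, ∀ x, absAvg f i x ≤ t := by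
  rcases eq_or_ne t ∞ with rfl | ht'
  · exact ⟨0, fun _ _ _ => le_top⟩
  have hS := tsum_enorm_ne_top hf
  set S := ∑' x, ‖f x‖ₑ
  obtain ⟨N, hN⟩ := exists_nat_gt (S / t).toReal
  refine ⟨N, fun i hi x => ?_⟩
  have h1 : S ≤ t * 2 ^ (n * i) := by
    have hfin : S / t ≠ ∞ := ENNReal.div_ne_top hS ht
    have h2 : S / t ≤ 2 ^ (n * i) := by
      calc S / t = ENNReal.ofReal (S / t).toReal := (ENNReal.ofReal_toReal hfin).symm
        _ ≤ ENNReal.ofReal N := ENNReal.ofReal_le_ofReal hN.le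
        _ = N := ENNReal.ofReal_natCast N
        _ ≤ ((2 ^ (n * i) : ℕ) : ℝ≥0∞) := by
            gcongr
            exact (Nat.lt_two_pow_self).le.trans
              (Nat.pow_le_pow_right (by norm_num) (hi.le.trans (Nat.le_mul_of_pos_left i hn)))
        _ = _ := by push_cast; rfl
    rw [mul_comm]
    exact (ENNReal.div_le_iff ht ht').1 h2
  rw [absAvg]
  calc _ ≤ ((2 : ℝ≥0∞) ^ (n * i))⁻¹ * (t * 2 ^ (n * i)) := by
        gcongr
        exact (ENNReal.sum_le_tsum _).trans h1
    _ = t := by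
        rw [mul_comm, mul_assoc, ENNReal.mul_inv_cancel (by simp) (by finiteness), mul_one]

lemma exists_isTop {f : (Fin n → ℤ) → ℂ} {t : ℝ≥0∞} {N : ℕ}
    (hN : ∀ i ≥ N, ∀ x, absAvg f i x ≤ t) {i : ℕ} {x : Fin n → ℤ} (h : t < absAvg f i x) :
    ∃ i' < N, IsTop f t i' x := by
  classical
  have hlt : ∀ j, t < absAvg f j x → j < N := fun j hj => by
    by_contra hc; exact absurd hj (hN j (not_lt.1 hc) x).not_gt
  have hP := Nat.findGreatest_spec (P := fun j => t < absAvg f j x) (hlt i h).le h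
  refine ⟨_, hlt _ hP, hP, fun i' hi' => ?_⟩
  by_contra hc
  rw [not_le] at hc
  exact absurd (Nat.le_findGreatest (P := fun j => t < absAvg f j x) (hlt i' hc).le hc)
    (not_le.2 hi')

open Classical in
/-- The part of the bad function which lives on the maximal blocks of side `2 ^ i`. -/
def bad (f : (Fin n → ℤ) → ℂ) (t : ℝ≥0∞) (i : ℕ) (x : Fin n → ℤ) : ℂ :=
  if IsTop f t i x then f x - avg i f x else 0

open Classical in
/-- The number of points in the maximal blocks of side `2 ^ i`. -/
def topCard (f : (Fin n → ℤ) → ℂ) (t : ℝ≥0∞) (i : ℕ) : ℝ≥0∞ :=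
  ∑' x, if IsTop f t i x then 1 else 0

open Classical in
/-- The `ℓ¹` norm of `f` on the maximal blocks of side `2 ^ i`. -/
def topMass (f : (Fin n → ℤ) → ℂ) (t : ℝ≥0∞) (i : ℕ) : ℝ≥0∞ :=
  ∑' x, (if IsTop f t i x then 1 else 0) * ‖f x‖ₑ

open Classical in
lemma topMass_eq (f : (Fin n → ℤ) → ℂ) (t : ℝ≥0∞) (i : ℕ) :
    topMass f t i = ∑' x, (if IsTop f t i x then 1 else 0) * absAvg f i x :=
  (tsum_mul_absAvg f i fun x x' h => by simp only [isTop_congr h]).symm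

lemma mul_topCard_le (f : (Fin n → ℤ) → ℂ) (t : ℝ≥0∞) (i : ℕ) :
    t * topCard f t i ≤ topMass f t i := by
  classical
  rw [topMass_eq, topCard, ← ENNReal.tsum_mul_left]
  refine ENNReal.tsum_le_tsum fun x => ?_
  by_cases h : IsTop f t i x
  · simpa [h] using h.1.le
  · simp [h]

/-- By maximality the average over the parent block is at most `t`; passing to the child costs `2 ^
n`. -/
lemma topMass_le (f : (Fin n → ℤ) → ℂ) (t : ℝ≥0∞) (i : ℕ) :
    topMass f t i ≤ 2 ^ n * t * topCard f t i := by
  classical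
  rw [topMass_eq, topCard, ← ENNReal.tsum_mul_left]
  refine ENNReal.tsum_le_tsum fun x => ?_
  by_cases h : IsTop f t i x
  · simpa [h] using (absAvg_le_absAvg_succ f i x).trans (by gcongr; exact h.2 _ (Nat.lt_succ_self i))
  · simp [h]

lemma finite_support_bad {f : (Fin n → ℤ) → ℂ} (hf : f.support.Finite) (t : ℝ≥0∞) (i : ℕ) :
    (bad f t i).support.Finite := by
  refine (hf.union (finite_support_avg hf i)).subset fun x hx => ?_
  by_contra hc
  simp only [Set.mem_union, Function.mem_support, not_or, not_not] at hc
  simp [bad, hc.1, hc.2] at hx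

lemma tsum_enorm_bad_le (f : (Fin n → ℤ) → ℂ) (t : ℝ≥0∞) (i : ℕ) :
    ∑' x, ‖bad f t i x‖ₑ ≤ 2 * topMass f t i := by
  classical
  rw [two_mul]
  nth_rw 2 [topMass_eq]
  rw [topMass, ← ENNReal.tsum_add]
  refine ENNReal.tsum_le_tsum fun x => ?_
  by_cases h : IsTop f t i x
  · simp only [bad, h, if_true, one_mul]
    exact enorm_sub_le.trans (by gcongr; exact enorm_avg_le f i x)
  · simp [bad, h]

lemma avg_bad (f : (Fin n → ℤ) → ℂ) (t : ℝ≥0∞) (i : ℕ) : avg i (bad f t i) = 0 := by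
  funext x
  rw [avg, Pi.zero_apply, mul_eq_zero]
  right
  by_cases h : IsTop f t i x
  · have h1 : ∀ y ∈ block i (cell i x), bad f t i y = 1 * f y - 1 * avg i f y := fun y hy => by
      rw [bad, if_pos ((isTop_congr (mem_block.1 hy)).2 h), one_mul, one_mul]
    rw [Finset.sum_congr rfl h1, Finset.sum_sub_distrib,
      sum_block_mul_avg i (h := fun _ => 1) (fun _ _ _ => rfl), sub_self]
  · refine Finset.sum_eq_zero fun y hy => ?_
    rw [bad, if_neg fun hy' => h ((isTop_congr (mem_block.1 hy)).1 hy')]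

section

variable {w : (Fin n → ℤ) → ℝ≥0∞} {δ : ℝ} {K : ℕ → (Fin n → ℤ) → (Fin n → ℤ) → ℂ}

/-- The kernel is constant in `y` on blocks over which the bad piece has mean zero. A bad piece
therefore meets only kernels of scales finer than its own block. -/
lemma kernelOp_bad (hK : IsKernel w K) {f : (Fin n → ℤ) → ℂ} (hf : f.support.Finite) (t : ℝ≥0∞)
    {i i' : ℕ} (hi : i' ≤ i) (x : Fin n → ℤ) : kernelOp K i (bad f t i') x = 0 := by
  rw [kernelOp, tsum_mul_avg (finite_support_bad hf t i') (i := i')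
    fun y y' h => hK.right_const i x y y' (cell_eq_of_le hi h), avg_bad]
  simp

/-- Off the dilated maximal blocks. -/
def IsFar (f : (Fin n → ℤ) → ℂ) (t : ℝ≥0∞) (x : Fin n → ℤ) : Prop :=
  ∀ i y, IsTop f t i y → ¬ ‖cell i y - cell i x‖ ≤ 1

open Classical in
-- Cancellation plays no role here. Seen from a far point, every point of a maximal block lies in a
-- non-adjacent block, and the tail of the weight gives the decay.
lemma tsum_far_kernelOp_bad_le (hK : IsKernel w K) (hw : ∀ m, w (-m) = w m) (hδ : 0 < δ)
    (hδ1 : δ ≤ 1) (f : (Fin n → ℤ) → ℂ) (t : ℝ≥0∞) {i i' : ℕ} (hi : i < i') :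
    ∑' x, (if IsFar f t x then ‖kernelOp K i (bad f t i') x‖ₑ else 0) ≤
      2 * moment w δ * rate δ ^ (i' - i) * (2 * topMass f t i') := by
  calc _ ≤ ∑' x, ∑' y, ‖bad f t i' y‖ₑ *
        (if ‖cell i' y - cell i' x‖ ≤ 1 then 0 else majorant w i y x) := by
        refine ENNReal.tsum_le_tsum fun x => ?_
        split_ifs with hx
        · refine enorm_tsum_le_tsum_enorm.trans (ENNReal.tsum_le_tsum fun y => ?_)
          by_cases hy : IsTop f t i' y
          · rw [if_neg (hx i' y hy), enorm_mul, mul_comm, majorant_comm hw]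
            gcongr
            exact hK.enorm_le i x y
          · simp [bad, hy]
        · exact zero_le
    _ = ∑' y, ‖bad f t i' y‖ₑ *
        ∑' x, (if ‖cell i' y - cell i' x‖ ≤ 1 then 0 else majorant w i y x) := by
        rw [ENNReal.tsum_comm]; simp only [ENNReal.tsum_mul_left]
    _ ≤ ∑' y, ‖bad f t i' y‖ₑ * (2 * moment w δ * rate δ ^ (i' - i)) := by
        gcongr with y
        exact tsum_majorant_far_le w hδ hδ1 hi y
    _ ≤ _ := by
        rw [ENNReal.tsum_mul_right, mul_comm]
        gcongr
        exact tsum_enorm_bad_le f t i'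

end

lemma tsum_near_le (i : ℕ) (y : Fin n → ℤ) :
    ∑' x : Fin n → ℤ, (if ‖cell i y - cell i x‖ ≤ 1 then (1 : ℝ≥0∞) else 0) ≤
      3 ^ n * 2 ^ (n * i) := by
  rw [tsum_block i]
  set k := cell i y
  have h1 : ∀ l : Fin n → ℤ, ∑ x ∈ block i l, (if ‖k - cell i x‖ ≤ 1 then (1 : ℝ≥0∞) else 0) =
      if ‖k - l‖ ≤ 1 then 2 ^ (n * i) else 0 := by
    intro l
    rw [Finset.sum_congr rfl fun x hx => by rw [mem_block.1 hx], Finset.sum_const, card_block]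
    split_ifs <;> simp
  simp only [h1]
  rw [tsum_eq_sum (s := Fintype.piFinset fun a => Finset.Icc (k a - 1) (k a + 1))]
  · calc _ ≤ ∑ _l ∈ Fintype.piFinset fun a => Finset.Icc (k a - 1) (k a + 1),
          (2 : ℝ≥0∞) ^ (n * i) := Finset.sum_le_sum fun l _ => by split_ifs <;> simp
      _ = _ := by
        rw [Finset.sum_const, Fintype.card_piFinset, nsmul_eq_mul]
        congr 1
        simp only [Int.card_Icc]
        have : ∀ a, (k a + 1 + 1 - (k a - 1)).toNat = 3 := fun a => by omega
        simp [this]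
  · intro l hl
    rw [if_neg]
    intro hc
    apply hl
    rw [Fintype.mem_piFinset]
    intro a
    have := (norm_le_pi_norm (k - l) a).trans hc
    rw [Pi.sub_apply, Int.norm_eq_abs] at this
    have h2 : |k a - l a| ≤ 1 := by exact_mod_cast this
    rw [abs_le] at h2
    rw [Finset.mem_Icc]
    omega

open Classical in
-- Every near point is charged to a maximal block. The factor `2 ^ (-n i)` averages over the points
-- of that block, so it is counted once, with at most `3 ^ n` blocks in its neighbourhood.
lemma tsum_not_far_le {f : (Fin n → ℤ) → ℂ} {t : ℝ≥0∞} {N : ℕ}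
    (hN : ∀ i ≥ N, ∀ x, absAvg f i x ≤ t) :
    ∑' x, (if IsFar f t x then (0 : ℝ≥0∞) else 1) ≤
      3 ^ n * ∑ i ∈ Finset.range N, topCard f t i := by
  calc _ ≤ ∑' x, ∑ i ∈ Finset.range N, ∑' y, (if IsTop f t i y then (1 : ℝ≥0∞) else 0) *
        (((2 : ℝ≥0∞) ^ (n * i))⁻¹ * if ‖cell i y - cell i x‖ ≤ 1 then (1 : ℝ≥0∞) else 0) := by
        refine ENNReal.tsum_le_tsum fun x => ?_
        split_ifs with hx
        · exact zero_le
        simp only [IsFar, not_forall, not_not] at hx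
        obtain ⟨i, y, hy, hxy⟩ := hx
        have hi : i ∈ Finset.range N := by
          rw [Finset.mem_range]
          by_contra hc
          exact absurd hy.1 (hN i (not_lt.1 hc) y).not_gt
        refine le_trans ?_ (Finset.single_le_sum (f := fun i => ∑' y,
          (if IsTop f t i y then (1 : ℝ≥0∞) else 0) *
          (((2 : ℝ≥0∞) ^ (n * i))⁻¹ * if ‖cell i y - cell i x‖ ≤ 1 then (1 : ℝ≥0∞) else 0))
          (fun _ _ => zero_le) hi)
        refine le_trans ?_ (ENNReal.sum_le_tsum (block i (cell i y)))
        have h1 : ∀ z ∈ block i (cell i y), (if IsTop f t i z then (1 : ℝ≥0∞) else 0) *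
            (((2 : ℝ≥0∞) ^ (n * i))⁻¹ * if ‖cell i z - cell i x‖ ≤ 1 then (1 : ℝ≥0∞) else 0) =
            ((2 : ℝ≥0∞) ^ (n * i))⁻¹ := fun z hz => by
          rw [if_pos ((isTop_congr (mem_block.1 hz)).2 hy), mem_block.1 hz, if_pos hxy, one_mul,
            mul_one]
        rw [Finset.sum_congr rfl h1, Finset.sum_const, card_block, nsmul_eq_mul]
        push_cast
        rw [ENNReal.mul_inv_cancel (by simp) (by finiteness)]
    _ = ∑ i ∈ Finset.range N, ∑' y, (if IsTop f t i y then (1 : ℝ≥0∞) else 0) *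
        (((2 : ℝ≥0∞) ^ (n * i))⁻¹ *
          ∑' x, if ‖cell i y - cell i x‖ ≤ 1 then (1 : ℝ≥0∞) else 0) := by
        rw [Summable.tsum_finsetSum fun _ _ => ENNReal.summable]
        refine Finset.sum_congr rfl fun i _ => ?_
        rw [ENNReal.tsum_comm]
        simp only [ENNReal.tsum_mul_left]
    _ ≤ ∑ i ∈ Finset.range N, ∑' y, (if IsTop f t i y then (1 : ℝ≥0∞) else 0) * 3 ^ n := by
        gcongr with i _ y
        calc _ ≤ ((2 : ℝ≥0∞) ^ (n * i))⁻¹ * (3 ^ n * 2 ^ (n * i)) := by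
              gcongr; exact tsum_near_le i y
          _ = 3 ^ n := by
              rw [mul_comm, mul_assoc, ENNReal.mul_inv_cancel (by simp) (by finiteness), mul_one]
    _ = _ := by
        simp only [ENNReal.tsum_mul_right, topCard, ← Finset.sum_mul]
        rw [mul_comm]

/-! ### The weak type estimate -/

lemma sum_range_ite_geometric_le (ρ : ℝ≥0∞) (L i' : ℕ) :
    ∑ i ∈ Finset.range L, (if i < i' then ρ ^ (i' - i) else 0) ≤ (1 - ρ)⁻¹ := by
  rw [← Finset.sum_filter, ← ENNReal.tsum_geometric]
  calc _ ≤ ∑ i ∈ Finset.range (i' + 1), ρ ^ (i' - i) :=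
        Finset.sum_le_sum_of_subset fun i hi => by
          simp only [Finset.mem_filter, Finset.mem_range] at hi ⊢; omega
    _ = ∑ r ∈ Finset.range (i' + 1), ρ ^ r := by
        rw [← Finset.sum_range_reflect (fun r => ρ ^ r)]
        exact Finset.sum_congr rfl fun i _ => by rw [Nat.add_sub_cancel]
    _ ≤ _ := ENNReal.sum_le_tsum _

open Classical in
lemma sum_isTop_le_one (f : (Fin n → ℤ) → ℂ) (t : ℝ≥0∞) (N : ℕ) (x : Fin n → ℤ) :
    ∑ i ∈ Finset.range N, (if IsTop f t i x then (1 : ℝ≥0∞) else 0) ≤ 1 := by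
  by_cases h : ∃ i, IsTop f t i x
  · obtain ⟨i, hi⟩ := h
    have : ∀ j, (if IsTop f t j x then (1 : ℝ≥0∞) else 0) = if i = j then 1 else 0 := fun j => by
      by_cases hj : IsTop f t j x
      · simp [hj, hi.unique hj]
      · rw [if_neg hj, if_neg]; rintro rfl; exact hj hi
    simp only [this, Finset.sum_ite_eq]
    split_ifs <;> simp
  · simp only [not_exists] at h
    simp [h]

/-- The maximal blocks are disjoint. Values of modulus at most `t / 2` contribute at most half of
the lower bound `t * topCard`, which leaves room for absorption in `mul_sum_topCard_le`. -/
lemma sum_topMass_le (f : (Fin n → ℤ) → ℂ) (t : ℝ≥0∞) (N : ℕ) :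
    ∑ i ∈ Finset.range N, topMass f t i ≤
      ∑' x, (if t / 2 < ‖f x‖ₑ then ‖f x‖ₑ else 0) +
        t / 2 * ∑ i ∈ Finset.range N, topCard f t i := by
  classical
  simp only [topMass, topCard]
  rw [← Summable.tsum_finsetSum fun _ _ => ENNReal.summable,
    ← Summable.tsum_finsetSum fun _ _ => ENNReal.summable, ← ENNReal.tsum_mul_left,
    ← ENNReal.tsum_add]
  refine ENNReal.tsum_le_tsum fun x => ?_
  rw [← Finset.sum_mul]
  split_ifs with h
  · refine le_add_right ?_
    calc _ ≤ 1 * ‖f x‖ₑ := by gcongr; exact sum_isTop_le_one f t N x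
      _ = _ := one_mul _
  · rw [not_lt] at h
    rw [zero_add, mul_comm]
    gcongr

lemma sum_topMass_ne_top {f : (Fin n → ℤ) → ℂ} (hf : f.support.Finite) (t : ℝ≥0∞) (N : ℕ) :
    ∑ i ∈ Finset.range N, topMass f t i ≠ ∞ := by
  classical
  refine ne_top_of_le_ne_top (tsum_enorm_ne_top hf) ?_
  simp only [topMass]
  rw [← Summable.tsum_finsetSum fun _ _ => ENNReal.summable]
  refine ENNReal.tsum_le_tsum fun x => ?_
  rw [← Finset.sum_mul]
  calc _ ≤ 1 * ‖f x‖ₑ := by gcongr; exact sum_isTop_le_one f t N x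
    _ = _ := one_mul _

/-- Only the part of `f` above `t / 2` remains on the right. With the whole `ℓ¹` norm there, the
later integral over the levels `t` would diverge. -/
lemma mul_sum_topCard_le {f : (Fin n → ℤ) → ℂ} (hf : f.support.Finite) (t : ℝ≥0∞) (N : ℕ) :
    t * ∑ i ∈ Finset.range N, topCard f t i ≤
      2 * ∑' x, (if t / 2 < ‖f x‖ₑ then ‖f x‖ₑ else 0) := by
  set ω := ∑ i ∈ Finset.range N, topCard f t i
  have h1 : t * ω ≤ ∑ i ∈ Finset.range N, topMass f t i := by
    rw [Finset.mul_sum]; exact Finset.sum_le_sum fun i _ => mul_topCard_le f t i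
  -- Finiteness is what permits cancelling the absorbed half in `ℝ≥0∞`.
  have hfin : t / 2 * ω ≠ ∞ := by
    refine ne_top_of_le_ne_top (sum_topMass_ne_top hf t N) (le_trans ?_ h1)
    gcongr; exact ENNReal.half_le_self
  have h2 : t / 2 * ω + t / 2 * ω ≤
      ∑' x, (if t / 2 < ‖f x‖ₑ then ‖f x‖ₑ else 0) + t / 2 * ω := by
    rw [← add_mul, ENNReal.add_halves]
    exact h1.trans (sum_topMass_le f t N)
  have h3 := (ENNReal.add_le_add_iff_right hfin).1 h2
  calc t * ω = 2 * (t / 2 * ω) := by rw [two_mul, ← add_mul, ENNReal.add_halves]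
    _ ≤ _ := by gcongr

/-- The good function of the Calderón–Zygmund decomposition. -/
def good (f : (Fin n → ℤ) → ℂ) (t : ℝ≥0∞) (N : ℕ) (x : Fin n → ℤ) : ℂ :=
  f x - ∑ i ∈ Finset.range N, bad f t i x

lemma finite_support_sum_bad {f : (Fin n → ℤ) → ℂ} (hf : f.support.Finite) (t : ℝ≥0∞) (N : ℕ) :
    (fun x => ∑ i ∈ Finset.range N, bad f t i x).support.Finite := by
  refine ((Finset.range N).finite_toSet.biUnion fun i _ => finite_support_bad hf t i).subset
    fun x hx => ?_
  obtain ⟨i, hi, h⟩ := Finset.exists_ne_zero_of_sum_ne_zero hx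
  simp only [Set.mem_iUnion]
  exact ⟨i, hi, h⟩

lemma finite_support_good {f : (Fin n → ℤ) → ℂ} (hf : f.support.Finite) (t : ℝ≥0∞) (N : ℕ) :
    (good f t N).support.Finite :=
  (hf.union (finite_support_sum_bad hf t N)).subset (Function.support_sub _ _)

/-- Off the maximal blocks the good function is `f`, of modulus at most `t`; on a maximal block it
is the average of `f`, at most `2 ^ n * t` by maximality. -/
lemma sqNorm_good_le {f : (Fin n → ℤ) → ℂ} {t : ℝ≥0∞} {N : ℕ}
    (hN : ∀ i ≥ N, ∀ x, absAvg f i x ≤ t) :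
    sqNorm (good f t N) ≤ ∑' x, (if ‖f x‖ₑ ≤ t then ‖f x‖ₑ ^ 2 else 0) +
      (2 ^ n * t) ^ 2 * ∑ i ∈ Finset.range N, topCard f t i := by
  classical
  simp only [topCard, sqNorm]
  rw [← Summable.tsum_finsetSum fun _ _ => ENNReal.summable, ← ENNReal.tsum_mul_left,
    ← ENNReal.tsum_add]
  refine ENNReal.tsum_le_tsum fun x => ?_
  by_cases h : ∃ i, t < absAvg f i x
  · obtain ⟨_, h⟩ := h
    obtain ⟨i, hi, htop⟩ := exists_isTop hN h
    have h1 : good f t N x = avg i f x := by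
      rw [good, Finset.sum_eq_single_of_mem i (Finset.mem_range.2 hi)]
      · rw [bad, if_pos htop, sub_sub_cancel]
      · intro j _ hj
        rw [bad, if_neg fun h => hj (h.unique htop)]
    refine le_add_left ?_
    rw [h1]
    calc ‖avg i f x‖ₑ ^ 2 ≤ (2 ^ n * t) ^ 2 * 1 := by
          rw [mul_one]
          gcongr
          refine (enorm_avg_le f i x).trans ((absAvg_le_absAvg_succ f i x).trans ?_)
          gcongr
          exact htop.2 _ (Nat.lt_succ_self i)
      _ ≤ _ := by
          gcongr
          refine le_trans ?_ (Finset.single_le_sum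
            (f := fun i => if IsTop f t i x then (1 : ℝ≥0∞) else 0) (fun _ _ => zero_le)
            (Finset.mem_range.2 hi))
          simp [htop]
  · simp only [not_exists, not_lt] at h
    have h1 : good f t N x = f x := by
      rw [good, Finset.sum_eq_zero fun i _ => ?_, sub_zero]
      rw [bad, if_neg fun h' => absurd h'.1 (h i).not_gt]
    have h2 : ‖f x‖ₑ ≤ t := absAvg_zero f x ▸ h 0
    rw [h1, if_pos h2]
    exact le_self_add

section

variable {w : (Fin n → ℤ) → ℝ≥0∞} {δ : ℝ} {K : ℕ → (Fin n → ℤ) → (Fin n → ℤ) → ℂ}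

/-- The sum of the operators at the scales below `L`. -/
def totalOp (K : ℕ → (Fin n → ℤ) → (Fin n → ℤ) → ℂ) (L : ℕ) (f : (Fin n → ℤ) → ℂ)
    (x : Fin n → ℤ) : ℂ := ∑ i ∈ Finset.range L, kernelOp K i f x

lemma kernelOp_add {f g : (Fin n → ℤ) → ℂ} (hf : f.support.Finite) (hg : g.support.Finite) (i : ℕ)
    (x : Fin n → ℤ) : kernelOp K i (fun y => f y + g y) x = kernelOp K i f x + kernelOp K i g x := by
  simp only [kernelOp, mul_add]
  exact Summable.tsum_add (summable_mul_of_finite hf _) (summable_mul_of_finite hg _)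

lemma kernelOp_sum {ι : Type*} (s : Finset ι) {u : ι → (Fin n → ℤ) → ℂ}
    (hu : ∀ a ∈ s, (u a).support.Finite) (i : ℕ) (x : Fin n → ℤ) :
    kernelOp K i (fun y => ∑ a ∈ s, u a y) x = ∑ a ∈ s, kernelOp K i (u a) x := by
  simp only [kernelOp, Finset.mul_sum]
  rw [← Summable.tsum_finsetSum fun a ha => summable_mul_of_finite (hu a ha) _]

open Classical in
lemma tsum_far_totalOp_bad_le (hK : IsKernel w K) (hw : ∀ m, w (-m) = w m) (hδ : 0 < δ)
    (hδ1 : δ ≤ 1) {f : (Fin n → ℤ) → ℂ} (hf : f.support.Finite) (t : ℝ≥0∞) (L N : ℕ) :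
    ∑' x, (if IsFar f t x then
        ‖totalOp K L (fun x => ∑ i ∈ Finset.range N, bad f t i x) x‖ₑ else 0) ≤
      4 * moment w δ * (1 - rate δ)⁻¹ * ∑ i ∈ Finset.range N, topMass f t i := by
  calc _ ≤ ∑' x, ∑ i' ∈ Finset.range N, ∑ i ∈ Finset.range L,
        (if IsFar f t x then ‖kernelOp K i (bad f t i') x‖ₑ else 0) := by
        refine ENNReal.tsum_le_tsum fun x => ?_
        split_ifs
        · rw [totalOp, Finset.sum_comm]
          refine (enorm_sum_le _ _).trans (Finset.sum_le_sum fun i _ => ?_)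
          rw [kernelOp_sum _ fun a _ => finite_support_bad hf t a]
          exact enorm_sum_le _ _
        · exact zero_le
    _ = ∑ i' ∈ Finset.range N, ∑ i ∈ Finset.range L,
        ∑' x, (if IsFar f t x then ‖kernelOp K i (bad f t i') x‖ₑ else 0) := by
        rw [Summable.tsum_finsetSum fun _ _ => ENNReal.summable]
        exact Finset.sum_congr rfl fun i' _ => Summable.tsum_finsetSum fun _ _ => ENNReal.summable
    _ ≤ ∑ i' ∈ Finset.range N, ∑ i ∈ Finset.range L,
        4 * moment w δ * topMass f t i' * (if i < i' then rate δ ^ (i' - i) else 0) := by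
        refine Finset.sum_le_sum fun i' _ => Finset.sum_le_sum fun i _ => ?_
        split_ifs with hi
        · refine (tsum_far_kernelOp_bad_le hK hw hδ hδ1 f t hi).trans (le_of_eq ?_)
          ring
        · rw [not_lt] at hi
          simp [kernelOp_bad hK hf t hi]
    _ ≤ ∑ i' ∈ Finset.range N, 4 * moment w δ * topMass f t i' * (1 - rate δ)⁻¹ := by
        refine Finset.sum_le_sum fun i' _ => ?_
        rw [← Finset.mul_sum]
        gcongr
        exact sum_range_ite_geometric_le _ _ _
    _ = _ := by rw [Finset.mul_sum]; exact Finset.sum_congr rfl fun _ _ => by ring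

/-- The constant in the weak type estimate. -/
def weakConst (w : (Fin n → ℤ) → ℝ≥0∞) (δ : ℝ) (B : ℝ≥0∞) : ℝ≥0∞ :=
  2 * 3 ^ n + 16 * moment w δ * (1 - rate δ)⁻¹ * 2 ^ n + 8 * B * 4 ^ n + 4 * B

lemma weakConst_ne_top (hδ : 0 < δ) (hm : moment w δ ≠ ∞) {B : ℝ≥0∞} (hB : B ≠ ∞) :
    weakConst w δ B ≠ ∞ := by
  have : (1 - rate δ)⁻¹ ≠ ∞ := by
    rw [ENNReal.inv_ne_top, ne_eq, tsub_eq_zero_iff_le, not_le]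
    exact rate_lt_one hδ
  unfold weakConst
  finiteness

/-- The level set is covered by the neighbourhoods of the maximal blocks, the far points where the
image of the bad function is at least `t / 2` (Chebyshev in `ℓ¹`), and the points where the image of
the good one is (Chebyshev in `ℓ²`). The high and the low part of `f` stay separate on the right, so
integration over `t` yields the strong type without an interpolation theorem. -/
theorem tsum_lt_totalOp_le (hn : 1 ≤ n) (hK : IsKernel w K) (hw : ∀ m, w (-m) = w m) (hδ : 0 < δ)
    (hδ1 : δ ≤ 1) {L : ℕ} {B : ℝ≥0∞}
    (hB : ∀ f : (Fin n → ℤ) → ℂ, f.support.Finite → sqNorm (totalOp K L f) ≤ B * sqNorm f)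
    {f : (Fin n → ℤ) → ℂ} (hf : f.support.Finite) {t : ℝ≥0∞} (ht : t ≠ 0) (ht' : t ≠ ∞) :
    ∑' x, (if t < ‖totalOp K L f x‖ₑ then (1 : ℝ≥0∞) else 0) ≤ weakConst w δ B *
      (t⁻¹ * ∑' x, (if t / 2 < ‖f x‖ₑ then ‖f x‖ₑ else 0) +
        t⁻¹ ^ 2 * ∑' x, (if ‖f x‖ₑ ≤ t then ‖f x‖ₑ ^ 2 else 0)) := by
  classical
  obtain ⟨N, hN⟩ := exists_absAvg_le hn hf ht
  set b : (Fin n → ℤ) → ℂ := fun x => ∑ i ∈ Finset.range N, bad f t i x with hb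
  set P := ∑' x, (if t / 2 < ‖f x‖ₑ then ‖f x‖ₑ else 0)
  set Q := ∑' x, (if ‖f x‖ₑ ≤ t then ‖f x‖ₑ ^ 2 else 0)
  set ω := ∑ i ∈ Finset.range N, topCard f t i
  set M := ∑ i ∈ Finset.range N, topMass f t i
  have hti : t⁻¹ * t = 1 := ENNReal.inv_mul_cancel ht ht'
  have hω : ω ≤ 2 * (t⁻¹ * P) := by
    calc ω = t⁻¹ * (t * ω) := by rw [← mul_assoc, hti, one_mul]
      _ ≤ t⁻¹ * (2 * P) := mul_le_mul_right (mul_sum_topCard_le hf t N) _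
      _ = _ := by ring
  have hM : M ≤ 2 ^ n * (2 * P) := by
    calc M ≤ ∑ i ∈ Finset.range N, 2 ^ n * t * topCard f t i :=
          Finset.sum_le_sum fun i _ => topMass_le f t i
      _ = 2 ^ n * (t * ω) := by rw [← Finset.mul_sum, mul_assoc]
      _ ≤ _ := mul_le_mul_right (mul_sum_topCard_le hf t N) _
  have hsplit : ∀ x, totalOp K L f x = totalOp K L (good f t N) x + totalOp K L b x := by
    intro x
    rw [totalOp, totalOp, totalOp, ← Finset.sum_add_distrib]
    refine Finset.sum_congr rfl fun i _ => ?_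
    rw [← kernelOp_add (finite_support_good hf t N) (finite_support_sum_bad hf t N)]
    simp only [good, sub_add_cancel]
  have hpt : ∀ x, (if t < ‖totalOp K L f x‖ₑ then (1 : ℝ≥0∞) else 0) ≤
      (if IsFar f t x then (0 : ℝ≥0∞) else 1) +
      2 * t⁻¹ * (if IsFar f t x then ‖totalOp K L b x‖ₑ else 0) +
      4 * t⁻¹ ^ 2 * ‖totalOp K L (good f t N) x‖ₑ ^ 2 := by
    intro x
    by_cases hfar : IsFar f t x
    swap
    · simp only [hfar, if_false]
      refine le_trans ?_ (le_self_add.trans le_self_add)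
      split_ifs <;> simp
    simp only [hfar, if_true, zero_add]
    split_ifs with hlt
    swap
    · exact zero_le
    have h1 : t < ‖totalOp K L (good f t N) x‖ₑ + ‖totalOp K L b x‖ₑ :=
      hlt.trans_le (by rw [hsplit]; exact enorm_add_le _ _)
    by_cases h2 : t / 2 ≤ ‖totalOp K L b x‖ₑ
    · refine le_add_right ?_
      calc (1 : ℝ≥0∞) = 2 * t⁻¹ * (t / 2) := by
            rw [ENNReal.div_eq_inv_mul, mul_assoc, mul_left_comm t⁻¹, hti, mul_one,
              ENNReal.mul_inv_cancel (by simp) (by simp)]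
        _ ≤ _ := by gcongr
    · refine le_add_left ?_
      have h3 : t / 2 ≤ ‖totalOp K L (good f t N) x‖ₑ := by
        by_contra h4
        rw [not_le] at h2 h4
        exact absurd h1 ((add_le_add h4.le h2.le).trans (ENNReal.add_halves t).le).not_gt
      calc (1 : ℝ≥0∞) = 4 * t⁻¹ ^ 2 * (t / 2) ^ 2 := by
            rw [ENNReal.div_eq_inv_mul, mul_pow, show (4 : ℝ≥0∞) * t⁻¹ ^ 2 * (2⁻¹ ^ 2 * t ^ 2) =
              (2 * 2⁻¹) ^ 2 * (t⁻¹ * t) ^ 2 by ring, hti,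
              ENNReal.mul_inv_cancel (by simp) (by simp)]
            simp
        _ ≤ _ := by gcongr
  calc _ ≤ ∑' x, ((if IsFar f t x then (0 : ℝ≥0∞) else 1) +
      2 * t⁻¹ * (if IsFar f t x then ‖totalOp K L b x‖ₑ else 0) +
      4 * t⁻¹ ^ 2 * ‖totalOp K L (good f t N) x‖ₑ ^ 2) := ENNReal.tsum_le_tsum hpt
    _ = ∑' x, (if IsFar f t x then (0 : ℝ≥0∞) else 1) +
      2 * t⁻¹ * ∑' x, (if IsFar f t x then ‖totalOp K L b x‖ₑ else 0) +
      4 * t⁻¹ ^ 2 * sqNorm (totalOp K L (good f t N)) := by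
        rw [ENNReal.tsum_add, ENNReal.tsum_add, ENNReal.tsum_mul_left, ENNReal.tsum_mul_left,
          sqNorm]
    _ ≤ 3 ^ n * ω + 2 * t⁻¹ * (4 * moment w δ * (1 - rate δ)⁻¹ * M) +
        4 * t⁻¹ ^ 2 * (B * (Q + (2 ^ n * t) ^ 2 * ω)) := by
        gcongr
        · exact tsum_not_far_le hN
        · exact tsum_far_totalOp_bad_le hK hw hδ hδ1 hf t L N
        · exact (hB _ (finite_support_good hf t N)).trans (by gcongr; exact sqNorm_good_le hN)
    _ = 3 ^ n * ω + 2 * t⁻¹ * (4 * moment w δ * (1 - rate δ)⁻¹ * M) +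
        4 * B * (t⁻¹ ^ 2 * Q) + 4 * B * ((2 ^ n) ^ 2 * (t⁻¹ * t) ^ 2) * ω := by ring
    _ = 3 ^ n * ω + 2 * t⁻¹ * (4 * moment w δ * (1 - rate δ)⁻¹ * M) +
        4 * B * (t⁻¹ ^ 2 * Q) + 4 * B * 4 ^ n * ω := by
        rw [hti, ← pow_mul, mul_comm n 2, pow_mul]; norm_num
    _ ≤ 3 ^ n * (2 * (t⁻¹ * P)) +
        2 * t⁻¹ * (4 * moment w δ * (1 - rate δ)⁻¹ * (2 ^ n * (2 * P))) +
        4 * B * (t⁻¹ ^ 2 * Q) + 4 * B * 4 ^ n * (2 * (t⁻¹ * P)) := by gcongr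
    _ = (2 * 3 ^ n + 16 * moment w δ * (1 - rate δ)⁻¹ * 2 ^ n + 8 * B * 4 ^ n) * (t⁻¹ * P) +
        4 * B * (t⁻¹ ^ 2 * Q) := by ring
    _ ≤ weakConst w δ B * (t⁻¹ * P) + weakConst w δ B * (t⁻¹ ^ 2 * Q) := by
        rw [weakConst]
        exact add_le_add (mul_le_mul_left le_self_add _) (mul_le_mul_left le_add_self _)
    _ = _ := by ring

end

/-! ### From weak type to strong type -/

lemma lintegral_rpow_mul_ite_lt {a q : ℝ} (ha : 0 ≤ a) (hq : 0 < q) :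
    ∫⁻ t in Set.Ioi (0 : ℝ), ENNReal.ofReal (t ^ (q - 1)) * (if t < a then 1 else 0) =
      ENNReal.ofReal (a ^ q / q) := by
  have h1 : ∀ t : ℝ, ENNReal.ofReal (t ^ (q - 1)) * (if t < a then 1 else 0) =
      (Set.Iio a).indicator (fun t => ENNReal.ofReal (t ^ (q - 1))) t := fun t => by
    by_cases h : t < a <;> simp [h]
  simp only [h1]
  rw [setLIntegral_indicator measurableSet_Iio, Set.inter_comm, Set.Ioi_inter_Iio,
    restrict_Ioo_eq_restrict_Ioc]
  have h_int : IntervalIntegrable (fun t : ℝ => t ^ (q - 1)) volume 0 a :=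
    intervalIntegral.intervalIntegrable_rpow' (by linarith)
  rw [← ofReal_integral_eq_lintegral_ofReal
    ((intervalIntegrable_iff_integrableOn_Ioc_of_le ha).1 h_int),
    ← intervalIntegral.integral_of_le ha, integral_rpow (Or.inl (by linarith))]
  · rw [sub_add_cancel, Real.zero_rpow hq.ne', sub_zero]
  · filter_upwards [ae_restrict_mem measurableSet_Ioc] with t ht
    exact Real.rpow_nonneg ht.1.le _

lemma lintegral_rpow_mul_ite_le {a r : ℝ} (ha : 0 < a) (hr : r < -1) :
    ∫⁻ t in Set.Ioi (0 : ℝ), ENNReal.ofReal (t ^ r) * (if a ≤ t then 1 else 0) =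
      ENNReal.ofReal (-a ^ (r + 1) / (r + 1)) := by
  have h1 : ∀ t : ℝ, ENNReal.ofReal (t ^ r) * (if a ≤ t then 1 else 0) =
      (Set.Ici a).indicator (fun t => ENNReal.ofReal (t ^ r)) t := fun t => by
    by_cases h : a ≤ t <;> simp [h]
  simp only [h1]
  rw [setLIntegral_indicator measurableSet_Ici,
    Set.inter_eq_left.2 (Set.Ici_subset_Ioi.2 ha), ← restrict_Ioi_eq_restrict_Ici,
    ← ofReal_integral_eq_lintegral_ofReal (integrableOn_Ioi_rpow_of_lt hr ha),
    integral_Ioi_rpow_of_lt hr ha]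
  filter_upwards [ae_restrict_mem measurableSet_Ioi] with t ht
  exact Real.rpow_nonneg (ha.trans ht).le _

lemma enorm_rpow_eq_lintegral (z : ℂ) {p : ℝ} (hp : 0 < p) :
    ‖z‖ₑ ^ p = ∫⁻ t in Set.Ioi (0 : ℝ), ENNReal.ofReal p * (ENNReal.ofReal (t ^ (p - 1)) *
      (if ENNReal.ofReal t < ‖z‖ₑ then 1 else 0)) := by
  have h1 : ∀ t : ℝ, (ENNReal.ofReal t < ‖z‖ₑ ↔ t < ‖z‖) ∨ z = 0 := fun t => by
    by_cases hz : z = 0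
    · exact Or.inr hz
    · left
      rw [← ofReal_norm, ENNReal.ofReal_lt_ofReal_iff (norm_pos_iff.2 hz)]
  rw [lintegral_const_mul' _ _ ENNReal.ofReal_ne_top]
  have h2 : ∫⁻ t in Set.Ioi (0 : ℝ), (ENNReal.ofReal (t ^ (p - 1)) *
      (if ENNReal.ofReal t < ‖z‖ₑ then 1 else 0)) = ENNReal.ofReal (‖z‖ ^ p / p) := by
    rw [← lintegral_rpow_mul_ite_lt (norm_nonneg z) hp]
    refine setLIntegral_congr_fun measurableSet_Ioi fun t ht => ?_
    have ht' : (0 : ℝ) < t := ht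
    rcases h1 t with h | h
    · simp only [h]
    · simp [h, ht'.le, not_lt.2]
  rw [h2, ← ENNReal.ofReal_mul hp.le, mul_div_cancel₀ _ hp.ne', ← ofReal_norm,
    ENNReal.ofReal_rpow_of_nonneg (norm_nonneg z) hp.le]

/-- The integrand is a multiple of `t ^ (p - 2)` below `2 ‖z‖`; integrability at zero is the
condition `p > 1`. -/
lemma lintegral_low_le (z : ℂ) {p : ℝ} (hp : 1 < p) :
    ∫⁻ t in Set.Ioi (0 : ℝ), ENNReal.ofReal (t ^ (p - 1)) * ((ENNReal.ofReal t)⁻¹ *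
      (if ENNReal.ofReal t / 2 < ‖z‖ₑ then ‖z‖ₑ else 0)) =
      ENNReal.ofReal (2 ^ (p - 1) / (p - 1)) * ‖z‖ₑ ^ p := by
  have h1 : ∀ t ∈ Set.Ioi (0 : ℝ), ENNReal.ofReal (t ^ (p - 1)) * ((ENNReal.ofReal t)⁻¹ *
      (if ENNReal.ofReal t / 2 < ‖z‖ₑ then ‖z‖ₑ else 0)) =
      ‖z‖ₑ * (ENNReal.ofReal (t ^ (p - 1 - 1)) * (if t < 2 * ‖z‖ then 1 else 0)) := by
    intro t ht
    have ht' : (0 : ℝ) < t := ht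
    have h2 : ENNReal.ofReal t / 2 < ‖z‖ₑ ↔ t < 2 * ‖z‖ := by
      rw [← ENNReal.ofReal_ofNat 2, ← ENNReal.ofReal_div_of_pos (by norm_num), ← ofReal_norm,
        ENNReal.ofReal_lt_ofReal_iff_of_nonneg (by positivity), div_lt_iff₀ (by norm_num), mul_comm]
    rw [← ENNReal.ofReal_inv_of_pos ht', ← mul_assoc, ← ENNReal.ofReal_mul (by positivity),
      Real.rpow_sub_one ht'.ne' (p - 1), ← div_eq_mul_inv]
    simp only [h2]
    split_ifs <;> simp [mul_comm]
  rw [setLIntegral_congr_fun measurableSet_Ioi h1, lintegral_const_mul' _ _ enorm_ne_top,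
    lintegral_rpow_mul_ite_lt (by positivity) (by linarith), ← ofReal_norm,
    ENNReal.ofReal_rpow_of_nonneg (norm_nonneg z) (by linarith),
    ← ENNReal.ofReal_mul (norm_nonneg z), ← ENNReal.ofReal_mul (by
      have : 0 < p - 1 := by linarith
      positivity)]
  congr 1
  rw [Real.mul_rpow (by norm_num) (norm_nonneg z)]
  rcases eq_or_ne ‖z‖ 0 with h | h
  · rw [h, Real.zero_rpow (by linarith), Real.zero_rpow (by linarith)]; simp
  · rw [Real.rpow_sub_one h]; field_simp

/-- The integrand is a multiple of `t ^ (p - 3)` above `‖z‖`; integrability at infinity is the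
condition `p < 2`. -/
lemma lintegral_high_le (z : ℂ) {p : ℝ} (hp : 1 < p) (hp2 : p < 2) :
    ∫⁻ t in Set.Ioi (0 : ℝ), ENNReal.ofReal (t ^ (p - 1)) * ((ENNReal.ofReal t)⁻¹ ^ 2 *
      (if ‖z‖ₑ ≤ ENNReal.ofReal t then ‖z‖ₑ ^ 2 else 0)) =
      ENNReal.ofReal (1 / (2 - p)) * ‖z‖ₑ ^ p := by
  rcases eq_or_ne z 0 with rfl | hz
  · simp [ENNReal.zero_rpow_of_pos (show 0 < p by linarith)]
  have hz' : 0 < ‖z‖ := norm_pos_iff.2 hz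
  have h1 : ∀ t ∈ Set.Ioi (0 : ℝ), ENNReal.ofReal (t ^ (p - 1)) * ((ENNReal.ofReal t)⁻¹ ^ 2 *
      (if ‖z‖ₑ ≤ ENNReal.ofReal t then ‖z‖ₑ ^ 2 else 0)) =
      ‖z‖ₑ ^ 2 * (ENNReal.ofReal (t ^ (p - 3)) * (if ‖z‖ ≤ t then 1 else 0)) := by
    intro t ht
    have ht' : (0 : ℝ) < t := ht
    have h2 : ‖z‖ₑ ≤ ENNReal.ofReal t ↔ ‖z‖ ≤ t := by
      rw [← ofReal_norm, ENNReal.ofReal_le_ofReal_iff ht'.le]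
    have h3 : t ^ (p - 3) = t ^ (p - 1) * t⁻¹ ^ 2 := by
      rw [show p - 3 = p - 1 - (2 : ℕ) by push_cast; ring, Real.rpow_sub_natCast ht'.ne', inv_pow,
        div_eq_mul_inv]
    rw [← ENNReal.ofReal_inv_of_pos ht', ← ENNReal.ofReal_pow (by positivity), ← mul_assoc,
      ← ENNReal.ofReal_mul (by positivity), ← h3]
    simp only [h2]
    split_ifs <;> simp [mul_comm]
  rw [setLIntegral_congr_fun measurableSet_Ioi h1, lintegral_const_mul' _ _ (by finiteness),
    lintegral_rpow_mul_ite_le hz' (by linarith), ← ofReal_norm,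
    ENNReal.ofReal_rpow_of_nonneg (norm_nonneg z) (by linarith), ← ENNReal.ofReal_pow hz'.le,
    ← ENNReal.ofReal_mul (by positivity), ← ENNReal.ofReal_mul (by
      have : 0 < 2 - p := by linarith
      positivity)]
  congr 1
  rw [show p - 3 + 1 = p - (2 : ℕ) by push_cast; ring, Real.rpow_sub_natCast hz'.ne']
  have h1 : 2 - p ≠ 0 := by linarith
  have h2 : p - (2 : ℕ) ≠ 0 := by push_cast; linarith
  push_cast at h2 ⊢
  field_simp
  ring

section

variable {w : (Fin n → ℤ) → ℝ≥0∞} {δ : ℝ} {K : ℕ → (Fin n → ℤ) → (Fin n → ℤ) → ℂ}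

/-- The constant in the strong type estimate for `1 < p < 2`. -/
def strongConst (w : (Fin n → ℤ) → ℝ≥0∞) (δ : ℝ) (B : ℝ≥0∞) (p : ℝ) : ℝ≥0∞ :=
  ENNReal.ofReal p * weakConst w δ B *
    (ENNReal.ofReal (2 ^ (p - 1) / (p - 1)) + ENNReal.ofReal (1 / (2 - p)))

/-- The layer cake formula for the `p`-th power, with the refined weak type estimate inserted at
each level and the integrals evaluated pointwise in `x`. -/
theorem tsum_totalOp_rpow_le (hn : 1 ≤ n) (hK : IsKernel w K) (hw : ∀ m, w (-m) = w m)
    (hδ : 0 < δ) (hδ1 : δ ≤ 1) {L : ℕ} {B : ℝ≥0∞}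
    (hB : ∀ f : (Fin n → ℤ) → ℂ, f.support.Finite → sqNorm (totalOp K L f) ≤ B * sqNorm f)
    {p : ℝ} (hp : 1 < p) (hp2 : p < 2) {f : (Fin n → ℤ) → ℂ} (hf : f.support.Finite) :
    ∑' x, ‖totalOp K L f x‖ₑ ^ p ≤ strongConst w δ B p * ∑' x, ‖f x‖ₑ ^ p := by
  set W := weakConst w δ B with hW
  have hm1 : ∀ z : ℂ, Measurable fun t : ℝ => if ENNReal.ofReal t < ‖z‖ₑ then (1 : ℝ≥0∞) else 0 :=
    fun z => Measurable.ite (measurableSet_lt ENNReal.measurable_ofReal measurable_const)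
      measurable_const measurable_const
  have hm2 : ∀ z : ℂ, Measurable fun t : ℝ =>
      if ENNReal.ofReal t / 2 < ‖z‖ₑ then ‖z‖ₑ else 0 :=
    fun z => Measurable.ite (measurableSet_lt (ENNReal.measurable_ofReal.div_const 2)
      measurable_const) measurable_const measurable_const
  have hm3 : ∀ z : ℂ, Measurable fun t : ℝ =>
      if ‖z‖ₑ ≤ ENNReal.ofReal t then ‖z‖ₑ ^ 2 else 0 :=
    fun z => Measurable.ite (measurableSet_le measurable_const ENNReal.measurable_ofReal)
      measurable_const measurable_const
  have hmp : Measurable fun t : ℝ => ENNReal.ofReal (t ^ (p - 1)) := by fun_prop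
  have hmi : Measurable fun t : ℝ => (ENNReal.ofReal t)⁻¹ := by fun_prop
  calc ∑' x, ‖totalOp K L f x‖ₑ ^ p
      = ∑' x, ∫⁻ t in Set.Ioi (0 : ℝ), ENNReal.ofReal p * (ENNReal.ofReal (t ^ (p - 1)) *
          (if ENNReal.ofReal t < ‖totalOp K L f x‖ₑ then 1 else 0)) :=
        tsum_congr fun x => enorm_rpow_eq_lintegral _ (by linarith)
    _ = ∫⁻ t in Set.Ioi (0 : ℝ), ENNReal.ofReal p * (ENNReal.ofReal (t ^ (p - 1)) *
          ∑' x, (if ENNReal.ofReal t < ‖totalOp K L f x‖ₑ then 1 else 0)) := by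
        have hmC : ∀ x, Measurable fun t : ℝ => ENNReal.ofReal p * (ENNReal.ofReal (t ^ (p - 1)) *
            (if ENNReal.ofReal t < ‖totalOp K L f x‖ₑ then 1 else 0)) :=
          fun x => (hmp.mul (hm1 _)).const_mul _
        rw [← lintegral_tsum fun x => (hmC x).aemeasurable]
        simp only [ENNReal.tsum_mul_left]
    _ ≤ ∫⁻ t in Set.Ioi (0 : ℝ), ENNReal.ofReal p * (ENNReal.ofReal (t ^ (p - 1)) * (W *
          ((ENNReal.ofReal t)⁻¹ * ∑' x, (if ENNReal.ofReal t / 2 < ‖f x‖ₑ then ‖f x‖ₑ else 0) +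
          (ENNReal.ofReal t)⁻¹ ^ 2 *
            ∑' x, (if ‖f x‖ₑ ≤ ENNReal.ofReal t then ‖f x‖ₑ ^ 2 else 0)))) := by
        refine setLIntegral_mono' measurableSet_Ioi fun t ht => ?_
        refine mul_le_mul_right (mul_le_mul_right ?_ _) _
        exact tsum_lt_totalOp_le hn hK hw hδ hδ1 hB hf
          (ENNReal.ofReal_pos.2 ht).ne' ENNReal.ofReal_ne_top
    _ = ∫⁻ t in Set.Ioi (0 : ℝ), ENNReal.ofReal p * W * ∑' x,
          (ENNReal.ofReal (t ^ (p - 1)) * ((ENNReal.ofReal t)⁻¹ *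
            (if ENNReal.ofReal t / 2 < ‖f x‖ₑ then ‖f x‖ₑ else 0)) +
          ENNReal.ofReal (t ^ (p - 1)) * ((ENNReal.ofReal t)⁻¹ ^ 2 *
            (if ‖f x‖ₑ ≤ ENNReal.ofReal t then ‖f x‖ₑ ^ 2 else 0))) := by
        refine lintegral_congr fun t => ?_
        rw [ENNReal.tsum_add]
        simp only [ENNReal.tsum_mul_left]
        ring
    _ = ENNReal.ofReal p * W * ∑' x,
          (ENNReal.ofReal (2 ^ (p - 1) / (p - 1)) * ‖f x‖ₑ ^ p +
            ENNReal.ofReal (1 / (2 - p)) * ‖f x‖ₑ ^ p) := by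
        have hmA : ∀ x, Measurable fun t : ℝ => ENNReal.ofReal (t ^ (p - 1)) *
            ((ENNReal.ofReal t)⁻¹ * (if ENNReal.ofReal t / 2 < ‖f x‖ₑ then ‖f x‖ₑ else 0)) :=
          fun x => hmp.mul (hmi.mul (hm2 _))
        have hmB : ∀ x, Measurable fun t : ℝ => ENNReal.ofReal (t ^ (p - 1)) *
            ((ENNReal.ofReal t)⁻¹ ^ 2 *
              (if ‖f x‖ₑ ≤ ENNReal.ofReal t then ‖f x‖ₑ ^ 2 else 0)) :=
          fun x => hmp.mul ((hmi.pow_const 2).mul (hm3 _))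
        have hmAB : ∀ x, Measurable fun t : ℝ => ENNReal.ofReal (t ^ (p - 1)) *
            ((ENNReal.ofReal t)⁻¹ * (if ENNReal.ofReal t / 2 < ‖f x‖ₑ then ‖f x‖ₑ else 0)) +
            ENNReal.ofReal (t ^ (p - 1)) * ((ENNReal.ofReal t)⁻¹ ^ 2 *
              (if ‖f x‖ₑ ≤ ENNReal.ofReal t then ‖f x‖ₑ ^ 2 else 0)) :=
          fun x => (hmA x).add (hmB x)
        rw [lintegral_const_mul _ (Measurable.tsum hmAB),
          lintegral_tsum fun x => (hmAB x).aemeasurable]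
        congr 1
        refine tsum_congr fun x => ?_
        rw [lintegral_add_left (hmA x), lintegral_low_le _ hp, lintegral_high_le _ hp hp2]
    _ = _ := by
        rw [strongConst, ENNReal.tsum_add, ENNReal.tsum_mul_left, ENNReal.tsum_mul_left]
        ring

/-- The quadratic bound for the forms with kernels `K`. -/
def HasL2Bound (A : ℝ≥0∞) (K : ℕ → (Fin n → ℤ) → (Fin n → ℤ) → ℂ) : Prop :=
  ∀ g f : (Fin n → ℤ) → ℂ, g.support.Finite → f.support.Finite → ∀ L,
    ∑ i ∈ Finset.range L, ‖kernelForm K i g f‖ₑ ≤ A * (sqNorm g + sqNorm f)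

/-! ### Duality, transposition and all exponents `1 < p < ∞` -/

lemma sum_kernelForm {g : (Fin n → ℤ) → ℂ} (hg : g.support.Finite) (f : (Fin n → ℤ) → ℂ) (L : ℕ) :
    ∑ i ∈ Finset.range L, kernelForm K i g f = ∑' x, totalOp K L f x * g x := by
  simp only [kernelForm, totalOp, Finset.sum_mul]
  rw [Summable.tsum_finsetSum fun i _ => summable_mul_of_finite hg _]

/-- The quadratic bound is tested on `t` times the conjugate of the image, cut off to a finite set.
The choice `t = 1 / (2 A)` lets half of the left side absorb the term with `sqNorm g`; the cutoff
makes that term finite. -/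
lemma HasL2Bound.sqNorm_totalOp_le {A : ℝ≥0∞} (hA : A ≠ 0) (hA' : A ≠ ∞) (h : HasL2Bound A K)
    (L : ℕ) {f : (Fin n → ℤ) → ℂ} (hf : f.support.Finite) :
    sqNorm (totalOp K L f) ≤ 4 * A ^ 2 * sqNorm f := by
  classical
  rw [sqNorm, ENNReal.tsum_eq_iSup_sum]
  refine iSup_le fun X => ?_
  set N := ∑ x ∈ X, ‖totalOp K L f x‖ₑ ^ 2 with hN
  have hNfin : N ≠ ∞ := (ENNReal.sum_lt_top.2 fun x _ => by finiteness).ne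
  lift A to NNReal using hA'
  rw [ENNReal.coe_ne_zero] at hA
  set t : NNReal := (2 * A)⁻¹ with ht
  have ht0 : t ≠ 0 := by rw [ht]; positivity
  set g : (Fin n → ℤ) → ℂ := fun x =>
    if x ∈ X then (t : ℂ) * (starRingEnd ℂ) (totalOp K L f x) else 0 with hg
  have hgs : g.support.Finite := X.finite_toSet.subset fun x hx => by
    by_contra hc; exact hx (if_neg hc)
  have h1 : ‖∑ i ∈ Finset.range L, kernelForm K i g f‖ₑ = t * N := by
    rw [sum_kernelForm hgs, tsum_eq_sum (s := X) fun x hx => by simp [hg, hx]]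
    have : ∀ x ∈ X, totalOp K L f x * g x = ((t * ‖totalOp K L f x‖ ^ 2 : ℝ) : ℂ) := fun x hx => by
      simp only [hg, if_pos hx]
      rw [mul_left_comm, Complex.mul_conj, Complex.normSq_eq_norm_sq]
      push_cast; rfl
    rw [Finset.sum_congr rfl this, ← Complex.ofReal_sum, ← ofReal_norm, Complex.norm_real,
      Real.norm_of_nonneg (Finset.sum_nonneg fun x _ => by positivity), ← Finset.mul_sum,
      ENNReal.ofReal_mul (by positivity), ENNReal.ofReal_coe_nnreal,
      ENNReal.ofReal_sum_of_nonneg fun _ _ => by positivity]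
    congr 1
    exact Finset.sum_congr rfl fun x _ => by
      rw [ENNReal.ofReal_pow (norm_nonneg _), ofReal_norm]
  have h2 : sqNorm g = t ^ 2 * N := by
    rw [sqNorm, tsum_eq_sum (s := X) fun x hx => by simp [hg, hx], hN, Finset.mul_sum]
    refine Finset.sum_congr rfl fun x hx => ?_
    simp only [hg, if_pos hx, enorm_mul, mul_pow]
    congr 1
    · simp [enorm_eq_nnnorm]
    · simp [enorm_eq_nnnorm]
  have h3 : (t : ℝ≥0∞) * N ≤ A * (t ^ 2 * N + sqNorm f) := by
    rw [← h1, ← h2]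
    exact (enorm_sum_le _ _).trans (h g f hgs hf L)
  have hAt : (A : ℝ≥0∞) * t = 2⁻¹ := by
    have : A * t = 2⁻¹ := by rw [ht]; field_simp
    rw [← ENNReal.coe_mul, this]; simp
  have h4 : (t : ℝ≥0∞) * N / 2 + t * N / 2 ≤ t * N / 2 + A * sqNorm f := by
    rw [ENNReal.add_halves]
    refine h3.trans (le_of_eq ?_)
    rw [ENNReal.div_eq_inv_mul, ← hAt]; ring
  have h5 := (ENNReal.add_le_add_iff_left
    (ENNReal.div_ne_top (ENNReal.mul_ne_top ENNReal.coe_ne_top hNfin) (by simp))).1 h4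
  calc N = (2 * A) * (2 * (t * N / 2)) := by
        have : (2 * A : ℝ≥0∞) * t = 1 := by
          rw [mul_assoc, hAt]; exact ENNReal.mul_inv_cancel (by simp) (by simp)
        rw [ENNReal.mul_div_cancel (by simp) (by simp), ← mul_assoc, this, one_mul]
    _ ≤ (2 * A) * (2 * (A * sqNorm f)) := by gcongr
    _ = _ := by ring

lemma IsKernel.swap (hK : IsKernel w K) (hw : ∀ m, w (-m) = w m) :
    IsKernel w fun i x y => K i y x where
  enorm_le i x y := (hK.enorm_le i y x).trans (majorant_comm hw i y x).le
  left_const i x x' y h := hK.right_const i y x x' h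
  right_const i x y y' h := hK.left_const i y y' x h

lemma kernelForm_swap {g f : (Fin n → ℤ) → ℂ} (hg : g.support.Finite) (hf : f.support.Finite)
    (i : ℕ) : kernelForm (fun i x y => K i y x) i f g = kernelForm K i g f := by
  simp only [kernelForm, kernelOp]
  rw [tsum_eq_sum (s := hf.toFinset) fun x hx => by
      rw [show f x = 0 by simpa using hx, mul_zero],
    tsum_eq_sum (s := hg.toFinset) fun x hx => by
      rw [show g x = 0 by simpa using hx, mul_zero]]
  have h1 : ∀ x, ∑' y, K i y x * g y = ∑ y ∈ hg.toFinset, K i y x * g y := fun x =>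
    tsum_eq_sum fun y hy => by rw [show g y = 0 by simpa using hy, mul_zero]
  have h2 : ∀ x, ∑' y, K i x y * f y = ∑ y ∈ hf.toFinset, K i x y * f y := fun x =>
    tsum_eq_sum fun y hy => by rw [show f y = 0 by simpa using hy, mul_zero]
  simp only [h1, h2, Finset.sum_mul]
  rw [Finset.sum_comm]
  exact Finset.sum_congr rfl fun x _ => Finset.sum_congr rfl fun y _ => by ring

lemma HasL2Bound.swap {A : ℝ≥0∞} (h : HasL2Bound A K) : HasL2Bound A fun i x y => K i y x := by
  intro g f hg hf L
  rw [add_comm]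
  refine le_trans (le_of_eq ?_) (h f g hf hg L)
  exact Finset.sum_congr rfl fun i _ => by rw [kernelForm_swap hf hg]

lemma kernelForm_mul (σ : ℕ → ℂ) (i : ℕ) (g f : (Fin n → ℤ) → ℂ) :
    kernelForm (fun i x y => σ i * K i x y) i g f = σ i * kernelForm K i g f := by
  simp only [kernelForm, kernelOp, mul_assoc, tsum_mul_left]

lemma sum_mul_le_tsum_rpow {p q : ℝ} (hpq : p.HolderConjugate q) (a b : (Fin n → ℤ) → ℝ≥0∞)
    (s : Finset (Fin n → ℤ)) :
    ∑ x ∈ s, a x * b x ≤ (∑' x, a x ^ p) ^ (1 / p) * (∑' x, b x ^ q) ^ (1 / q) := by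
  refine (ENNReal.inner_le_Lp_mul_Lq s a b hpq).trans ?_
  have := hpq.pos
  have := hpq.symm.pos
  gcongr <;> exact ENNReal.sum_le_tsum s

/-- The constant depends on the kernels only through `w` and `A`, and both hypotheses survive
multiplication of each scale by a factor of modulus at most one. With conjugate phases as factors,
the sum of the moduli of the forms becomes a single pairing. -/
lemma exists_sum_enorm_kernelForm_le_of_le_two (hn : 1 ≤ n) (hw : ∀ m, w (-m) = w m)
    (hδ : 0 < δ) (hδ1 : δ ≤ 1) (hm : moment w δ ≠ ∞) {A : ℝ≥0∞} (hA : A ≠ 0) (hA' : A ≠ ∞)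
    {p q : ℝ} (hpq : p.HolderConjugate q) (hp2 : p ≤ 2) :
    ∃ C : ℝ≥0∞, C ≠ ∞ ∧ ∀ K : ℕ → (Fin n → ℤ) → (Fin n → ℤ) → ℂ, IsKernel w K → HasL2Bound A K →
      ∀ g f : (Fin n → ℤ) → ℂ, g.support.Finite → f.support.Finite → ∀ I : Finset ℕ,
        ∑ i ∈ I, ‖kernelForm K i g f‖ₑ ≤
          C * ((∑' x, ‖g x‖ₑ ^ q) ^ (1 / q) * (∑' x, ‖f x‖ₑ ^ p) ^ (1 / p)) := by
  have hstrong : ∃ C : ℝ≥0∞, C ≠ ∞ ∧ ∀ K : ℕ → (Fin n → ℤ) → (Fin n → ℤ) → ℂ, IsKernel w K →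
      HasL2Bound A K → ∀ f : (Fin n → ℤ) → ℂ, f.support.Finite → ∀ L,
      ∑' x, ‖totalOp K L f x‖ₑ ^ p ≤ C * ∑' x, ‖f x‖ₑ ^ p := by
    rcases hp2.eq_or_lt with rfl | hlt
    · refine ⟨4 * A ^ 2, by finiteness, fun K _ hL f hf L => ?_⟩
      simpa only [ENNReal.rpow_two, sqNorm] using hL.sqNorm_totalOp_le hA hA' L hf
    · refine ⟨strongConst w δ (4 * A ^ 2) p, ?_, fun K hK hL f hf L =>
        tsum_totalOp_rpow_le hn hK hw hδ hδ1 (fun f hf => hL.sqNorm_totalOp_le hA hA' L hf)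
          hpq.lt hlt hf⟩
      have := weakConst_ne_top (B := 4 * A ^ 2) hδ hm (by finiteness)
      unfold strongConst
      finiteness
  obtain ⟨C, hC, hCb⟩ := hstrong
  have hp0 := hpq.pos
  refine ⟨C ^ (1 / p), ENNReal.rpow_ne_top_of_nonneg (by positivity) hC,
    fun K hK hL g f hg hf I => ?_⟩
  classical
  set σ : ℕ → ℂ := fun i => if i ∈ I then
    (starRingEnd ℂ) (kernelForm K i g f) / ‖kernelForm K i g f‖ else 0 with hσ
  have hσ1 : ∀ i, ‖σ i‖ₑ ≤ 1 := fun i => by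
    rw [← ofReal_norm, ENNReal.ofReal_le_one]
    simp only [hσ]
    split_ifs
    · rw [norm_div, RCLike.norm_conj, Complex.norm_real, norm_norm]
      exact div_self_le_one _
    · simp
  set K' : ℕ → (Fin n → ℤ) → (Fin n → ℤ) → ℂ := fun i x y => σ i * K i x y with hK'
  have hK'K : IsKernel w K' :=
    { enorm_le := fun i x y => by
        rw [hK', enorm_mul]
        exact (mul_le_of_le_one_left zero_le (hσ1 i)).trans (hK.enorm_le i x y)
      left_const := fun i x x' y h => by simp only [hK', hK.left_const i x x' y h]
      right_const := fun i x y y' h => by simp only [hK', hK.right_const i x y y' h] }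
  have hK'L : HasL2Bound A K' := fun g f hg hf L => by
    refine le_trans (Finset.sum_le_sum fun i _ => ?_) (hL g f hg hf L)
    rw [hK', kernelForm_mul, enorm_mul]
    exact mul_le_of_le_one_left zero_le (hσ1 i)
  -- The factors vanish off `I`, so an initial segment of scales can replace `I`.
  set L := I.sup id + 1
  have hIL : I ⊆ Finset.range L := fun i hi =>
    Finset.mem_range.2 (Nat.lt_succ_of_le (Finset.le_sup (f := id) hi))
  have hsum : ∑ i ∈ Finset.range L, kernelForm K' i g f =
      ((∑ i ∈ I, ‖kernelForm K i g f‖ : ℝ) : ℂ) := by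
    rw [← Finset.sum_subset hIL]
    · push_cast
      refine Finset.sum_congr rfl fun i hi => ?_
      rw [hK', kernelForm_mul]
      simp only [hσ, if_pos hi]
      rw [div_mul_eq_mul_div, mul_comm, Complex.mul_conj, Complex.normSq_eq_norm_sq]
      rcases eq_or_ne (‖kernelForm K i g f‖ : ℂ) 0 with h | h
      · rw [h, div_zero]
      · push_cast; field_simp
    · intro i _ hi
      rw [hK', kernelForm_mul]
      simp [hσ, hi]
  have hnorm : ∑ i ∈ I, ‖kernelForm K i g f‖ₑ = ‖∑ i ∈ Finset.range L, kernelForm K' i g f‖ₑ := by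
    rw [hsum, ← ofReal_norm, Complex.norm_real,
      Real.norm_of_nonneg (Finset.sum_nonneg fun _ _ => norm_nonneg _),
      ENNReal.ofReal_sum_of_nonneg fun _ _ => norm_nonneg _]
    exact Finset.sum_congr rfl fun i _ => (ofReal_norm _).symm
  rw [hnorm, sum_kernelForm hg, tsum_eq_sum (s := hg.toFinset) fun x hx => by
      rw [show g x = 0 by simpa using hx, mul_zero]]
  calc _ ≤ ∑ x ∈ hg.toFinset, ‖totalOp K' L f x‖ₑ * ‖g x‖ₑ := by
        refine (enorm_sum_le _ _).trans (le_of_eq ?_)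
        simp only [enorm_mul]
    _ ≤ (∑' x, ‖totalOp K' L f x‖ₑ ^ p) ^ (1 / p) * (∑' x, ‖g x‖ₑ ^ q) ^ (1 / q) :=
        sum_mul_le_tsum_rpow hpq _ _ _
    _ ≤ (C * ∑' x, ‖f x‖ₑ ^ p) ^ (1 / p) * (∑' x, ‖g x‖ₑ ^ q) ^ (1 / q) := by
        gcongr; exact hCb K' hK'K hK'L f hf L
    _ = _ := by
        rw [ENNReal.mul_rpow_of_nonneg _ _ (by positivity)]; ring

/-- The `ℓᵖ` estimate for the bilinear forms of kernels which satisfy the cancellation conditions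
in one of the two orders of the variables. -/
theorem exists_sum_enorm_kernelForm_le (hn : 1 ≤ n) (hw : ∀ m, w (-m) = w m)
    (hδ : 0 < δ) (hδ1 : δ ≤ 1) (hm : moment w δ ≠ ∞) {p q : ℝ} (hpq : p.HolderConjugate q) :
    ∃ C : ℝ≥0∞, C ≠ ∞ ∧ ∀ K : ℕ → (Fin n → ℤ) → (Fin n → ℤ) → ℂ, IsKernel w K →
      (IsCancelling K ∨ IsCancelling fun i x y => K i y x) →
      ∀ g f : (Fin n → ℤ) → ℂ, g.support.Finite → f.support.Finite → ∀ I : Finset ℕ,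
        ∑ i ∈ I, ‖kernelForm K i g f‖ₑ ≤
          C * ((∑' x, ‖g x‖ₑ ^ q) ^ (1 / q) * (∑' x, ‖f x‖ₑ ^ p) ^ (1 / p)) := by
  -- The summand `1` makes `A` nonzero, as `t = 1 / (2 A)` requires.
  set A := l2Const w δ + 1 with hA
  have hA0 : A ≠ 0 := by rw [hA]; positivity
  have hA1 : A ≠ ∞ := ENNReal.add_ne_top.2 ⟨l2Const_ne_top hδ hm, by simp⟩
  have hL : ∀ K : ℕ → (Fin n → ℤ) → (Fin n → ℤ) → ℂ, IsKernel w K → IsCancelling K →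
      HasL2Bound A K := fun K hK hc g f hg hf L => by
    refine (Finset.sum_le_sum_of_subset (Finset.range_mono (Nat.le_succ L))).trans
      ((sum_enorm_kernelForm_le hK hc hw hδ hδ1 hm hg hf L).trans ?_)
    gcongr
    exact le_self_add
  have hL' : ∀ K : ℕ → (Fin n → ℤ) → (Fin n → ℤ) → ℂ, IsKernel w K →
      (IsCancelling K ∨ IsCancelling fun i x y => K i y x) → HasL2Bound A K := by
    rintro K hK (hc | hc)
    · exact hL K hK hc
    · exact (hL _ (hK.swap hw) hc).swap
  rcases le_total p 2 with hp2 | hp2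
  · obtain ⟨C, hC, h⟩ :=
      exists_sum_enorm_kernelForm_le_of_le_two hn hw hδ hδ1 hm hA0 hA1 hpq hp2
    exact ⟨C, hC, fun K hK hc => h K hK (hL' K hK hc)⟩
  -- For `p ≥ 2` the roles of `g` and `f` are exchanged. Domination and the quadratic bound are
  -- symmetric under transposition, although the cancellation is not.
  · have hq2 : q ≤ 2 := by
      have := hpq.inv_add_inv_eq_one
      have hp0 := hpq.pos
      have hq0 := hpq.symm.pos
      by_contra hc
      rw [not_le] at hc
      have h1 : p⁻¹ ≤ 2⁻¹ := inv_anti₀ (by norm_num) hp2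
      have h2 : q⁻¹ < 2⁻¹ := inv_strictAnti₀ (by norm_num) hc
      linarith
    obtain ⟨C, hC, h⟩ :=
      exists_sum_enorm_kernelForm_le_of_le_two hn hw hδ hδ1 hm hA0 hA1 hpq.symm hq2
    refine ⟨C, hC, fun K hK hc g f hg hf I => ?_⟩
    have := h _ (hK.swap hw) (hL' K hK hc).swap f g hf hg I
    simp only [kernelForm_swap hg hf] at this
    rwa [mul_comm (_ ^ (1 / q))]

end

/-! ### Dyadic cubes -/

/-- The index of the dyadic cube of side `2 ^ (-j)` which contains `x`. -/
def floorAt (j : ℤ) (x : Fin n → ℝ) : Fin n → ℤ := fun a => ⌊(2 : ℝ) ^ j * x a⌋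

lemma mem_dyadicCube {j : ℤ} {k : Fin n → ℤ} {x : Fin n → ℝ} :
    x ∈ dyadicCube j k ↔ floorAt j x = k := by
  simp only [dyadicCube, Set.mem_ofPred_eq, floorAt, funext_iff, Int.floor_eq_iff]

lemma dyadicCube_eq_pi (j : ℤ) (k : Fin n → ℤ) : dyadicCube j k =
    Set.univ.pi fun i => Set.Ico ((2 : ℝ) ^ (-j) * k i) ((2 : ℝ) ^ (-j) * (k i + 1)) := by
  have hp : (0 : ℝ) < 2 ^ j := by positivity
  ext x
  simp only [dyadicCube, Set.mem_ofPred_eq, Set.mem_pi, Set.mem_univ, true_imp_iff, Set.mem_Ico,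
    zpow_neg, inv_mul_le_iff₀ hp, lt_inv_mul_iff₀ hp]

lemma measurableSet_dyadicCube (j : ℤ) (k : Fin n → ℤ) : MeasurableSet (dyadicCube j k) := by
  rw [dyadicCube_eq_pi]
  exact MeasurableSet.univ_pi fun _ => measurableSet_Ico

lemma two_zpow_add (a b : ℤ) : (2 : ℝ≥0∞) ^ (a + b) = 2 ^ a * 2 ^ b :=
  ENNReal.zpow_add (by simp) (by simp) a b

lemma two_zpow_ne_zero (a : ℤ) : (2 : ℝ≥0∞) ^ a ≠ 0 := (ENNReal.zpow_pos (by simp) (by simp) a).ne'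

lemma ofReal_two_zpow (a : ℤ) : ENNReal.ofReal ((2 : ℝ) ^ a) = 2 ^ a := by
  have h : (2 : ℝ) ^ a = (((2 : NNReal) ^ a : NNReal) : ℝ) := by push_cast; rfl
  rw [h, ENNReal.ofReal_coe_nnreal, ENNReal.coe_zpow (by norm_num)]
  rfl

lemma volume_dyadicCube (j : ℤ) (k : Fin n → ℤ) :
    volume (dyadicCube j k) = 2 ^ (-(n * j) : ℤ) := by
  rw [dyadicCube_eq_pi, Real.volume_pi_Ico]
  have : ∀ i, ENNReal.ofReal ((2 : ℝ) ^ (-j) * (k i + 1) - 2 ^ (-j) * k i) = 2 ^ (-j) := fun i => by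
    rw [← mul_sub, add_sub_cancel_left, mul_one, ofReal_two_zpow]
  simp only [this, Finset.prod_const, Finset.card_univ, Fintype.card_fin]
  rw [← ofReal_two_zpow, ← ofReal_two_zpow, ← ENNReal.ofReal_pow (by positivity), ← zpow_natCast,
    ← zpow_mul]
  congr 2; ring

lemma iUnion_dyadicCube (j : ℤ) : ⋃ k : Fin n → ℤ, dyadicCube j k = Set.univ :=
  Set.eq_univ_of_forall fun x => Set.mem_iUnion.2 ⟨floorAt j x, mem_dyadicCube.2 rfl⟩

lemma pairwise_disjoint_dyadicCube (j : ℤ) :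
    Pairwise (Function.onFun Disjoint fun k : Fin n → ℤ => dyadicCube j k) := fun _ _ hkl =>
  Set.disjoint_left.2 fun _ hx hx' => hkl ((mem_dyadicCube.1 hx).symm.trans (mem_dyadicCube.1 hx'))

lemma lintegral_eq_tsum_dyadicCube (j : ℤ) (F : (Fin n → ℝ) → ℝ≥0∞) :
    ∫⁻ x, F x = ∑' k, ∫⁻ x in dyadicCube j k, F x := by
  rw [← lintegral_iUnion (fun k => measurableSet_dyadicCube j k) (pairwise_disjoint_dyadicCube j),
    iUnion_dyadicCube, Measure.restrict_univ]

/-- The integral of the modulus over a dyadic cube. -/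
def absInt (f : (Fin n → ℝ) → ℂ) (j : ℤ) (k : Fin n → ℤ) : ℝ≥0∞ :=
  ∫⁻ x in dyadicCube j k, ‖f x‖ₑ

lemma absInt_rpow_le {f : (Fin n → ℝ) → ℂ} (hf : AEStronglyMeasurable f volume) {p : ℝ}
    (hp : 1 < p) (j : ℤ) (k : Fin n → ℤ) :
    absInt f j k ^ p ≤ ((2 : ℝ≥0∞) ^ (-(n * j) : ℤ)) ^ (p - 1) *
      ∫⁻ x in dyadicCube j k, ‖f x‖ₑ ^ p := by
  have hp0 : 0 < p := by linarith
  have h := eLpNorm_le_eLpNorm_mul_rpow_measure_univ (μ := volume.restrict (dyadicCube j k))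
    (p := 1) (q := ENNReal.ofReal p) (by rw [ENNReal.one_le_ofReal]; exact hp.le) hf.restrict
  rw [eLpNorm_one_eq_lintegral_enorm, eLpNorm_eq_lintegral_rpow_enorm_toReal
    (by simpa using hp0) ENNReal.ofReal_ne_top, ENNReal.toReal_ofReal hp0.le,
    Measure.restrict_apply_univ, volume_dyadicCube] at h
  have h2 := ENNReal.rpow_le_rpow h hp0.le
  rw [ENNReal.mul_rpow_of_nonneg _ _ hp0.le, ← ENNReal.rpow_mul, ← ENNReal.rpow_mul,
    one_div_mul_cancel hp0.ne', ENNReal.rpow_one, mul_comm] at h2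
  refine h2.trans (le_of_eq ?_)
  congr 2
  simp only [ENNReal.toReal_one]
  field_simp

lemma tsum_absInt_rpow_le {f : (Fin n → ℝ) → ℂ} (hf : AEStronglyMeasurable f volume) {p : ℝ}
    (hp : 1 < p) (j : ℤ) :
    ∑' k, absInt f j k ^ p ≤ ((2 : ℝ≥0∞) ^ (-(n * j) : ℤ)) ^ (p - 1) * ∫⁻ x, ‖f x‖ₑ ^ p := by
  rw [lintegral_eq_tsum_dyadicCube j, ← ENNReal.tsum_mul_left]
  exact ENNReal.tsum_le_tsum fun k => absInt_rpow_le hf hp j k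

lemma tsum_absInt_rpow_rpow_le {f : (Fin n → ℝ) → ℂ} (hf : AEStronglyMeasurable f volume)
    {p q : ℝ} (hpq : p.HolderConjugate q) (j : ℤ) :
    (∑' k, absInt f j k ^ p) ^ (1 / p) ≤ ((2 : ℝ≥0∞) ^ (-(n * j) : ℤ)) ^ (1 / q) *
      eLpNorm f (ENNReal.ofReal p) volume := by
  have hp0 := hpq.pos
  have hq0 := hpq.symm.pos
  rw [eLpNorm_eq_lintegral_rpow_enorm_toReal (by simpa using hp0) ENNReal.ofReal_ne_top,
    ENNReal.toReal_ofReal hp0.le]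
  refine (ENNReal.rpow_le_rpow (tsum_absInt_rpow_le hf hpq.lt j) (by positivity)).trans
    (le_of_eq ?_)
  rw [ENNReal.mul_rpow_of_nonneg _ _ (by positivity), ← ENNReal.rpow_mul]
  congr 2
  have := hpq.inv_add_inv_eq_one
  have h2 : q⁻¹ = 1 - p⁻¹ := by linarith
  rw [one_div, one_div, h2]
  field_simp

lemma tsum_absInt (f : (Fin n → ℝ) → ℂ) (j : ℤ) : ∑' k, absInt f j k = eLpNorm f 1 volume := by
  rw [eLpNorm_one_eq_lintegral_enorm, lintegral_eq_tsum_dyadicCube j]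
  rfl

lemma absInt_le_top (f : (Fin n → ℝ) → ℂ) (j : ℤ) (k : Fin n → ℤ) :
    absInt f j k ≤ (2 : ℝ≥0∞) ^ (-(n * j) : ℤ) * eLpNorm f ∞ volume := by
  rw [eLpNorm_exponent_top, absInt]
  calc _ ≤ ∫⁻ _x in dyadicCube j k, eLpNormEssSup f volume :=
        lintegral_mono_ae (ae_restrict_of_ae (enorm_ae_le_eLpNormEssSup f volume))
    _ = _ := by
        rw [lintegral_const, Measure.restrict_apply_univ, volume_dyadicCube, mul_comm]

lemma tsum_mul_le_rpow {p q : ℝ} (hpq : p.HolderConjugate q) (a b : (Fin n → ℤ) → ℝ≥0∞) :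
    ∑' x, a x * b x ≤ (∑' x, a x ^ p) ^ (1 / p) * (∑' x, b x ^ q) ^ (1 / q) := by
  rw [ENNReal.tsum_eq_iSup_sum]
  exact iSup_le fun s => sum_mul_le_tsum_rpow hpq a b s

lemma tsum_translate (h : (Fin n → ℤ) → ℝ≥0∞) (m : Fin n → ℤ) : ∑' l, h (l + m) = ∑' l, h l :=
  (Equiv.addRight m).tsum_eq h

lemma toReal_holderConjugate {p q : ℝ≥0∞} (hpq : p.HolderConjugate q) (hp1 : 1 < p) (hp : p ≠ ∞) :
    p.toReal.HolderConjugate q.toReal ∧ q ≠ ∞ := by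
  have hqt : q ≠ ∞ := by
    rintro rfl
    exact hp1.ne' (hpq.symm.conj_eq.trans (by simp))
  refine ⟨?_, hqt⟩
  have h := hpq.inv_add_inv_eq_one
  rw [Real.holderConjugate_iff]
  refine ⟨by rw [← ENNReal.toReal_one]; exact (ENNReal.toReal_lt_toReal (by simp) hp).2 hp1, ?_⟩
  rw [← ENNReal.toReal_inv, ← ENNReal.toReal_inv, ← ENNReal.toReal_add, h, ENNReal.toReal_one]
  · simpa using hpq.ne_zero
  · simpa using hpq.symm.ne_zero

/-- Hölder's inequality for the integrals over the cubes of one generation. -/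
lemma tsum_absInt_mul_le {p q : ℝ≥0∞} (hpq : p.HolderConjugate q) {g f : (Fin n → ℝ) → ℂ}
    (hg : AEStronglyMeasurable g volume) (hf : AEStronglyMeasurable f volume) (j : ℤ)
    (m : Fin n → ℤ) :
    ∑' l, absInt g j (l + m) * absInt f j l ≤
      (2 : ℝ≥0∞) ^ (-(n * j) : ℤ) * (eLpNorm g q volume * eLpNorm f p volume) := by
  rcases eq_or_ne p 1 with rfl | hp1
  · have hq : q = ∞ := hpq.conj_eq.trans (by simp)
    subst hq
    calc _ ≤ ∑' l, ((2 : ℝ≥0∞) ^ (-(n * j) : ℤ) * eLpNorm g ∞ volume) * absInt f j l := by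
          gcongr; exact absInt_le_top g j _
      _ = _ := by rw [ENNReal.tsum_mul_left, tsum_absInt, mul_assoc]
  rcases eq_or_ne p ∞ with rfl | hpt
  · have hq : q = 1 := hpq.conj_eq.trans (by simp)
    subst hq
    calc _ ≤ ∑' l, absInt g j (l + m) * ((2 : ℝ≥0∞) ^ (-(n * j) : ℤ) * eLpNorm f ∞ volume) := by
          gcongr; exact absInt_le_top f j _
      _ = _ := by
          rw [ENNReal.tsum_mul_right, tsum_translate (fun l => absInt g j l) m,
            tsum_absInt]
          ring
  obtain ⟨hpr, hqt⟩ := toReal_holderConjugate hpq (lt_of_le_of_ne hpq.one_le hp1.symm) hpt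
  have e1 := tsum_absInt_rpow_rpow_le hf hpr j
  have e2 := tsum_absInt_rpow_rpow_le hg hpr.symm j
  rw [ENNReal.ofReal_toReal hpt] at e1
  rw [ENNReal.ofReal_toReal hqt] at e2
  have hp0 := hpr.pos
  have hq0 := hpr.symm.pos
  set V := (2 : ℝ≥0∞) ^ (-(n * j) : ℤ)
  calc _ ≤ (∑' l, absInt g j (l + m) ^ q.toReal) ^ (1 / q.toReal) *
        (∑' l, absInt f j l ^ p.toReal) ^ (1 / p.toReal) := tsum_mul_le_rpow hpr.symm _ _
    _ ≤ (V ^ (1 / p.toReal) * eLpNorm g q volume) * (V ^ (1 / q.toReal) * eLpNorm f p volume) := by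
        rw [tsum_translate (fun l => absInt g j l ^ q.toReal) m]
        gcongr
    _ = V ^ (1 / p.toReal + 1 / q.toReal) * (eLpNorm g q volume * eLpNorm f p volume) := by
        rw [ENNReal.rpow_add_of_nonneg _ _ (by positivity) (by positivity)]; ring
    _ = _ := by
        rw [one_div, one_div, hpr.inv_add_inv_eq_one, ENNReal.rpow_one]

/-! ### Haar functions -/

/-- The index set of all the Haar functions of one scale, the functions `φ` included. -/
abbrev HaarIndex (n : ℕ) : Type := (Fin n → Bool) × (Fin n → ℤ)

/-- The Haar functions of the scale `j`. -/
def haarAt (j : ℤ) (q : HaarIndex n) : (Fin n → ℝ) → ℂ := haar q.1 j q.2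

lemma norm_profile_le (b : Bool) (t : ℝ) : ‖profile b t‖ ≤ 1 := by
  cases b <;> simp only [profile] <;> split_ifs <;> simp

lemma profile_eq_zero (b : Bool) {t : ℝ} (ht : ¬ (0 ≤ t ∧ t < 1)) : profile b t = 0 := by
  cases b
  · simp only [profile, if_neg ht]
  · simp only [profile]
    rw [if_neg, if_neg]
    · rintro ⟨h1, h2⟩; exact ht ⟨by linarith, h2⟩
    · rintro ⟨h1, h2⟩; exact ht ⟨h1, by linarith⟩

lemma measurable_profile (b : Bool) : Measurable (profile b) := by
  cases b
  · exact Measurable.ite (measurableSet_Ico (a := (0 : ℝ)) (b := 1)) measurable_const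
      measurable_const
  · exact Measurable.ite (measurableSet_Ico (a := (0 : ℝ)) (b := 1 / 2)) measurable_const
      (Measurable.ite (measurableSet_Ico (a := (1 / 2 : ℝ)) (b := 1)) measurable_const
        measurable_const)

lemma measurable_haarAt (j : ℤ) (q : HaarIndex n) : Measurable (haarAt j q) := by
  refine measurable_const.mul (Finset.measurable_prod _ fun a _ => ?_)
  refine (measurable_profile _).comp ?_
  fun_prop

lemma haarAt_eq_zero {j : ℤ} {q : HaarIndex n} {x : Fin n → ℝ} (hx : x ∉ dyadicCube j q.2) :
    haarAt j q x = 0 := by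
  simp only [dyadicCube, Set.mem_ofPred_eq, not_forall] at hx
  obtain ⟨a, ha⟩ := hx
  have h : ¬ (0 ≤ (2 : ℝ) ^ j * x a - q.2 a ∧ (2 : ℝ) ^ j * x a - q.2 a < 1) := by
    rintro ⟨h1, h2⟩
    exact ha ⟨by linarith, by linarith⟩
  rw [haarAt, haar, Finset.prod_eq_zero (Finset.mem_univ a) (profile_eq_zero _ h), mul_zero]

/-- The normalizing factor `2 ^ (n j / 2)`. -/
def amp (n : ℕ) (j : ℤ) : ℝ := (2 : ℝ) ^ ((n : ℝ) * (j : ℝ) / 2)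

lemma amp_pos (n : ℕ) (j : ℤ) : 0 < amp n j := by unfold amp; positivity

lemma amp_mul_amp (n : ℕ) (j : ℤ) : amp n j * amp n j = (2 : ℝ) ^ (n * j : ℤ) := by
  rw [amp, ← Real.rpow_add (by norm_num), add_halves, ← Real.rpow_intCast]
  push_cast; rfl

lemma haarAt_apply (j : ℤ) (q : HaarIndex n) (x : Fin n → ℝ) :
    haarAt j q x = (amp n j : ℂ) * ∏ a, profile (q.1 a) ((2 : ℝ) ^ j * x a - (q.2 a : ℝ)) := rfl

lemma norm_haarAt_le (j : ℤ) (q : HaarIndex n) (x : Fin n → ℝ) : ‖haarAt j q x‖ ≤ amp n j := by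
  rw [haarAt_apply, norm_mul, Complex.norm_real, Real.norm_of_nonneg (amp_pos n j).le, norm_prod]
  exact mul_le_of_le_one_right (amp_pos n j).le
    (Finset.prod_le_one (fun _ _ => norm_nonneg _) fun a _ => norm_profile_le _ _)

lemma enorm_bracket_haarAt_le (f : (Fin n → ℝ) → ℂ) (j : ℤ) (q : HaarIndex n) :
    ‖bracket (haarAt j q) f‖ₑ ≤ ENNReal.ofReal (amp n j) * absInt f j q.2 := by
  calc ‖bracket (haarAt j q) f‖ₑ ≤ ∫⁻ x, ‖haarAt j q x * f x‖ₑ := enorm_integral_le_lintegral_enorm _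
    _ ≤ ∫⁻ x, (dyadicCube j q.2).indicator (fun x => ENNReal.ofReal (amp n j) * ‖f x‖ₑ) x := by
        refine lintegral_mono fun x => ?_
        by_cases hx : x ∈ dyadicCube j q.2
        · rw [Set.indicator_of_mem hx, enorm_mul, ← ofReal_norm]
          gcongr
          exact norm_haarAt_le j q x
        · simp [haarAt_eq_zero hx]
    _ = _ := by
        rw [lintegral_indicator (measurableSet_dyadicCube j q.2),
          lintegral_const_mul' _ _ ENNReal.ofReal_ne_top]
        rfl

lemma bracket_comm (g f : (Fin n → ℝ) → ℂ) : bracket g f = bracket f g := by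
  simp only [bracket, mul_comm]

/-! ### The forms at a fixed scale -/

/-- The size condition on the matrices of coefficients. -/
def IsDominated (w : (Fin n → ℤ) → ℝ≥0∞) (M : ℤ → HaarIndex n → HaarIndex n → ℂ) : Prop :=
  ∀ j q r, ‖M j q r‖ₑ ≤ w (q.2 - r.2)

/-- The summands of the form at the scale `j`. -/
def haarTerm (M : ℤ → HaarIndex n → HaarIndex n → ℂ) (j : ℤ) (g f : (Fin n → ℝ) → ℂ)
    (q : HaarIndex n × HaarIndex n) : ℂ :=
  bracket g (haarAt j q.1) * M j q.1 q.2 * bracket (haarAt j q.2) f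

/-- The form at the scale `j`. -/
def scaleForm (M : ℤ → HaarIndex n → HaarIndex n → ℂ) (j : ℤ) (g f : (Fin n → ℝ) → ℂ) : ℂ :=
  ∑' q, haarTerm M j g f q

section

variable {w : (Fin n → ℤ) → ℝ≥0∞} {M : ℤ → HaarIndex n → HaarIndex n → ℂ}

/-- The majorant of the summands. -/
def termBound (w : (Fin n → ℤ) → ℝ≥0∞) (j : ℤ) (g f : (Fin n → ℝ) → ℂ)
    (q : HaarIndex n × HaarIndex n) : ℝ≥0∞ :=
  (2 : ℝ≥0∞) ^ (n * j : ℤ) * (w (q.1.2 - q.2.2) * (absInt g j q.1.2 * absInt f j q.2.2))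

lemma enorm_haarTerm_le (hM : IsDominated w M) (j : ℤ) (g f : (Fin n → ℝ) → ℂ)
    (q : HaarIndex n × HaarIndex n) : ‖haarTerm M j g f q‖ₑ ≤ termBound w j g f q := by
  rw [haarTerm, enorm_mul, enorm_mul, bracket_comm g]
  calc _ ≤ (ENNReal.ofReal (amp n j) * absInt g j q.1.2) * w (q.1.2 - q.2.2) *
        (ENNReal.ofReal (amp n j) * absInt f j q.2.2) := by
        gcongr
        · exact enorm_bracket_haarAt_le g j q.1
        · exact hM j q.1 q.2
        · exact enorm_bracket_haarAt_le f j q.2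
    _ = (ENNReal.ofReal (amp n j) * ENNReal.ofReal (amp n j)) *
        (w (q.1.2 - q.2.2) * (absInt g j q.1.2 * absInt f j q.2.2)) := by ring
    _ = _ := by
        rw [← ENNReal.ofReal_mul (amp_pos n j).le, amp_mul_amp, ofReal_two_zpow, termBound]

/-- Substitution of `k = l + m`. The factor `4 ^ n` counts the pairs of types of Haar functions. -/
lemma tsum_termBound (w : (Fin n → ℤ) → ℝ≥0∞) (j : ℤ) (g f : (Fin n → ℝ) → ℂ) :
    ∑' q, termBound w j g f q = 4 ^ n * (2 : ℝ≥0∞) ^ (n * j : ℤ) *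
      ∑' m, w m * ∑' l, absInt g j (l + m) * absInt f j l := by
  have h1 : ∑' k : Fin n → ℤ, ∑' l : Fin n → ℤ,
      w (k - l) * (absInt g j k * absInt f j l) =
      ∑' m, w m * ∑' l, absInt g j (l + m) * absInt f j l := by
    simp only [← ENNReal.tsum_mul_left]
    rw [ENNReal.tsum_comm]
    conv_rhs => rw [ENNReal.tsum_comm]
    refine tsum_congr fun l => ?_
    rw [← tsum_translate _ l]
    refine tsum_congr fun m => ?_
    rw [add_sub_cancel_right, add_comm m l]
  have h2 : ∑' q : HaarIndex n × HaarIndex n, termBound w j g f q =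
      ∑' a : (Fin n → Bool) × (Fin n → Bool), ∑' k : Fin n → ℤ, ∑' l : Fin n → ℤ,
        (2 : ℝ≥0∞) ^ (n * j : ℤ) * (w (k - l) * (absInt g j k * absInt f j l)) := by
    rw [← (Equiv.prodProdProdComm (Fin n → Bool) (Fin n → Bool) (Fin n → ℤ) (Fin n → ℤ)).tsum_eq,
      ENNReal.tsum_prod']
    refine tsum_congr fun a => ?_
    rw [ENNReal.tsum_prod']
    rfl
  rw [h2]
  simp only [ENNReal.tsum_mul_left, h1, tsum_fintype, Finset.sum_const, Finset.card_univ]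
  simp only [Fintype.card_prod, Fintype.card_pi, Fintype.card_bool, Finset.prod_const,
    Finset.card_univ, Fintype.card_fin, nsmul_eq_mul]
  push_cast
  rw [← mul_pow, ← mul_assoc]
  norm_num

lemma tsum_termBound_le {p q : ℝ≥0∞} (hpq : p.HolderConjugate q) (w : (Fin n → ℤ) → ℝ≥0∞)
    {g f : (Fin n → ℝ) → ℂ}
    (hg : AEStronglyMeasurable g volume) (hf : AEStronglyMeasurable f volume) (j : ℤ) :
    ∑' r, termBound w j g f r ≤
      4 ^ n * (∑' m, w m) * (eLpNorm g q volume * eLpNorm f p volume) := by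
  rw [tsum_termBound]
  calc _ ≤ 4 ^ n * (2 : ℝ≥0∞) ^ (n * j : ℤ) * ∑' m, w m *
        ((2 : ℝ≥0∞) ^ (-(n * j) : ℤ) * (eLpNorm g q volume * eLpNorm f p volume)) := by
        gcongr with m
        exact tsum_absInt_mul_le hpq hg hf j m
    _ = 4 ^ n * ((2 : ℝ≥0∞) ^ (n * j : ℤ) * (2 : ℝ≥0∞) ^ (-(n * j) : ℤ)) * (∑' m, w m) *
        (eLpNorm g q volume * eLpNorm f p volume) := by
        rw [ENNReal.tsum_mul_right]; ring
    _ = _ := by rw [← two_zpow_add, add_neg_cancel, zpow_zero, mul_one]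

end

/-! ### Discretization of the Haar functions -/

/-- The profiles jump only at `0`, `1 / 2` and `1`, so they are constant on the half-open intervals
between consecutive multiples of `1 / 2`. -/
lemma profile_floor (b : Bool) (s : ℝ) : profile b s = profile b ((⌊2 * s⌋ : ℝ) / 2) := by
  have h0 : (0 ≤ s) ↔ (0 : ℝ) ≤ (⌊2 * s⌋ : ℝ) / 2 := by
    have : (0 ≤ ⌊2 * s⌋) ↔ (0 : ℝ) ≤ 2 * s := by rw [Int.le_floor]; simp
    constructor
    · intro h
      have h1 : (0 : ℝ) ≤ (⌊2 * s⌋ : ℝ) := by exact_mod_cast this.2 (by linarith)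
      linarith
    · intro h
      have h1 : (0 : ℝ) ≤ (⌊2 * s⌋ : ℝ) := by linarith
      have := this.1 (by exact_mod_cast h1)
      linarith
  have hlt : ∀ z : ℤ, (s < (z : ℝ) / 2) ↔ (⌊2 * s⌋ : ℝ) / 2 < (z : ℝ) / 2 := by
    intro z
    have : ⌊2 * s⌋ < z ↔ 2 * s < z := Int.floor_lt
    constructor
    · intro h
      have h1 : (⌊2 * s⌋ : ℝ) < z := by exact_mod_cast this.2 (by linarith)
      linarith
    · intro h
      have h1 : (⌊2 * s⌋ : ℝ) < z := by linarith
      have := this.1 (by exact_mod_cast h1)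
      linarith
  have h1 : s < 1 ↔ (⌊2 * s⌋ : ℝ) / 2 < 1 := by simpa using hlt 2
  have h2 : s < 1 / 2 ↔ (⌊2 * s⌋ : ℝ) / 2 < 1 / 2 := by simpa using hlt 1
  have h3 : 1 / 2 ≤ s ↔ 1 / 2 ≤ (⌊2 * s⌋ : ℝ) / 2 := by rw [← not_lt, h2, not_lt]
  cases b
  · simp only [profile]; exact if_congr (and_congr h0 h1) rfl rfl
  · simp only [profile]; exact if_congr (and_congr h0 h2) rfl (if_congr (and_congr h3 h1) rfl rfl)

/-- The value of a Haar function, up to normalization, on the subcube with index `c` of half the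
side. -/
def haarStep (ε : Fin n → Bool) (l c : Fin n → ℤ) : ℂ :=
  ∏ a, profile (ε a) (((c a - 2 * l a : ℤ) : ℝ) / 2)

lemma haarAt_eq_haarStep (j : ℤ) (q : HaarIndex n) (x : Fin n → ℝ) :
    haarAt j q x = amp n j * haarStep q.1 q.2 (floorAt (j + 1) x) := by
  rw [haarAt_apply, haarStep]
  congr 1
  refine Finset.prod_congr rfl fun a _ => ?_
  rw [profile_floor]
  congr 3
  rw [floorAt, ← Int.floor_sub_intCast]
  congr 1
  push_cast
  rw [zpow_add₀ (by norm_num)]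
  ring

lemma enorm_haarStep_le (ε : Fin n → Bool) (l c : Fin n → ℤ) : ‖haarStep ε l c‖ₑ ≤ 1 := by
  rw [← ofReal_norm, ENNReal.ofReal_le_one, haarStep, norm_prod]
  exact Finset.prod_le_one (fun _ _ => norm_nonneg _) fun a _ => norm_profile_le _ _

lemma haarStep_eq_zero {ε : Fin n → Bool} {l c : Fin n → ℤ} (h : cell 1 c ≠ l) :
    haarStep ε l c = 0 := by
  obtain ⟨a, ha⟩ := Function.ne_iff.1 h
  refine Finset.prod_eq_zero (Finset.mem_univ a) (profile_eq_zero _ ?_)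
  rintro ⟨h1, h2⟩
  apply ha
  have h1' : (0 : ℝ) ≤ ((c a - 2 * l a : ℤ) : ℝ) := by linarith
  have h2' : ((c a - 2 * l a : ℤ) : ℝ) < (2 : ℤ) := by push_cast at h2 ⊢; linarith
  have h1'' : 0 ≤ c a - 2 * l a := by exact_mod_cast h1'
  have h2'' : c a - 2 * l a < 2 := Int.cast_lt.1 h2'
  simp only [cell, pow_one]
  omega

lemma sum_haarStep (ε : Fin n → Bool) (l : Fin n → ℤ) :
    ∑ c ∈ block 1 l, haarStep ε l c = if ε = (fun _ => false) then (2 : ℂ) ^ n else 0 := by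
  have h1 : ∀ (b : Bool) (z : ℤ), ∑ c ∈ Finset.Ico (z * 2 ^ 1) (z * 2 ^ 1 + 2 ^ 1),
      profile b (((c - 2 * z : ℤ) : ℝ) / 2) = if b then 0 else 2 := by
    intro b z
    have : Finset.Ico (z * 2 ^ 1) (z * 2 ^ 1 + 2 ^ 1) = {2 * z, 2 * z + 1} := by
      ext c; simp only [Finset.mem_Ico, Finset.mem_insert, Finset.mem_singleton]; omega
    rw [this, Finset.sum_pair (by omega)]
    cases b <;> norm_num [profile]
  simp only [haarStep, block]
  rw [← Finset.prod_univ_sum (fun a => Finset.Ico (l a * 2 ^ 1) (l a * 2 ^ 1 + 2 ^ 1))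
    fun a c => profile (ε a) (((c - 2 * l a : ℤ) : ℝ) / 2)]
  simp only [h1]
  split_ifs with h
  · subst h; simp
  · obtain ⟨a, ha⟩ := Function.ne_iff.1 h
    exact Finset.prod_eq_zero (Finset.mem_univ a) (by simpa using ha)

lemma sum_block_comp_cell (i : ℕ) (k : Fin n → ℤ) (h : (Fin n → ℤ) → ℂ) :
    ∑ x ∈ block (i + 1) k, h (cell i x) = 2 ^ (n * i) * ∑ c ∈ block 1 k, h c := by
  classical
  rw [← Finset.sum_fiberwise_of_maps_to (t := block 1 k) (g := cell i)
    (fun x hx => by rw [mem_block, cell_cell]; exact mem_block.1 hx), Finset.mul_sum]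
  refine Finset.sum_congr rfl fun c hc => ?_
  have : (block (i + 1) k).filter (fun x => cell i x = c) = block i c := by
    ext x
    rw [Finset.mem_filter, mem_block, mem_block]
    refine ⟨fun hx => hx.2, fun hx => ⟨?_, hx⟩⟩
    rw [← cell_cell, hx]; exact mem_block.1 hc
  rw [this, Finset.sum_congr rfl fun x hx => by rw [mem_block.1 hx], Finset.sum_const, card_block,
    nsmul_eq_mul]
  push_cast; rfl

lemma floorAt_sub (N : ℤ) (i : ℕ) (x : Fin n → ℝ) : floorAt (N - i) x = cell i (floorAt N x) := by
  funext a
  simp only [floorAt, cell]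
  have h : (2 : ℝ) ^ (N - i) * x a = (2 ^ N * x a) / ((2 ^ i : ℕ) : ℝ) := by
    rw [zpow_sub₀ (by norm_num), zpow_natCast]; push_cast; ring
  rw [h, Int.floor_div_natCast]
  push_cast; rfl

/-! ### The discrete kernels -/

/-- The kernel on the cubes of side `2 ^ (-N)` of the form at the scale `N - 1 - i`. -/
def discKernel (M : ℤ → HaarIndex n → HaarIndex n → ℂ) (N : ℤ) (i : ℕ) (x y : Fin n → ℤ) : ℂ :=
  ((2 : ℂ) ^ (n * (i + 1)))⁻¹ * ∑ ε : Fin n → Bool, ∑ ε' : Fin n → Bool,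
    haarStep ε (cell (i + 1) x) (cell i x) *
      M (N - 1 - i) (ε, cell (i + 1) x) (ε', cell (i + 1) y) *
      haarStep ε' (cell (i + 1) y) (cell i y)

/-- The cancellation conditions on the matrices of coefficients. -/
structure IsCancellingMatrix (M : ℤ → HaarIndex n → HaarIndex n → ℂ) : Prop where
  left_eq_zero : ∀ j k r, M j (fun _ => false, k) r = 0
  tsum_eq_zero : ∀ j q, ∑' l, M j q (fun _ => false, l) = 0

section

variable {w : (Fin n → ℤ) → ℝ≥0∞} {M : ℤ → HaarIndex n → HaarIndex n → ℂ}

lemma isKernel_discKernel (hM : IsDominated w M) (N : ℤ) :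
    IsKernel (fun m => 4 ^ n * w m) (discKernel M N) where
  enorm_le i x y := by
    rw [discKernel, majorant, enorm_mul, enorm_inv (by simp)]
    have h2 : ‖(2 : ℂ) ^ (n * (i + 1))‖ₑ = 2 ^ (n * (i + 1)) := by
      rw [enorm_pow]; simp [enorm_eq_nnnorm]
    rw [h2]
    gcongr
    calc _ ≤ ∑ _ε : Fin n → Bool, ∑ _ε' : Fin n → Bool, w (cell (i + 1) x - cell (i + 1) y) := by
          refine (enorm_sum_le _ _).trans (Finset.sum_le_sum fun ε _ => ?_)
          refine (enorm_sum_le _ _).trans (Finset.sum_le_sum fun ε' _ => ?_)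
          rw [enorm_mul, enorm_mul]
          calc _ ≤ 1 * w (cell (i + 1) x - cell (i + 1) y) * 1 := by
                gcongr
                · exact enorm_haarStep_le _ _ _
                · exact hM _ _ _
                · exact enorm_haarStep_le _ _ _
            _ = _ := by rw [one_mul, mul_one]
      _ = _ := by
          simp only [Finset.sum_const, Finset.card_univ, Fintype.card_pi, Fintype.card_bool,
            Finset.prod_const, Fintype.card_fin, nsmul_eq_mul]
          push_cast
          rw [← mul_assoc, ← mul_pow]; norm_num
  left_const i x x' y h := by
    rw [discKernel, discKernel, h, cell_eq_of_le (Nat.le_succ i) h]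
  right_const i x y y' h := by
    rw [discKernel, discKernel, h, cell_eq_of_le (Nat.le_succ i) h]

lemma discKernel_swap (M : ℤ → HaarIndex n → HaarIndex n → ℂ) (N : ℤ) :
    (fun i x y => discKernel M N i y x) = discKernel (fun j q r => M j r q) N := by
  funext i x y
  rw [discKernel, discKernel, Finset.sum_comm]
  congr 1
  exact Finset.sum_congr rfl fun ε _ => Finset.sum_congr rfl fun ε' _ => by ring

lemma summable_of_tsum_enorm_ne_top {ι : Type*} {a : ι → ℂ} {b : ι → ℝ≥0∞}
    (h : ∀ x, ‖a x‖ₑ ≤ b x) (hb : ∑' x, b x ≠ ∞) : Summable a := by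
  refine Summable.of_norm ((ENNReal.summable_toReal (ne_top_of_le_ne_top hb
    (ENNReal.tsum_le_tsum h))).congr fun x => by simp)

/-- On the left a wavelet has mean zero over its cube, and the rows of `φ` are zero. On the right
the sum over a cube removes the wavelets and leaves the `φ`, whose coefficients have vanishing row
sums. -/
lemma isCancelling_discKernel (hM : IsDominated w M) (hw : ∑' m, w m ≠ ∞)
    (hc : IsCancellingMatrix M) (N : ℤ) : IsCancelling (discKernel M N) where
  sum_left i k y := by
    simp only [discKernel]
    rw [← Finset.mul_sum, mul_eq_zero]
    right
    rw [Finset.sum_comm]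
    refine Finset.sum_eq_zero fun ε _ => ?_
    rw [Finset.sum_comm]
    refine Finset.sum_eq_zero fun ε' _ => ?_
    by_cases hε : ε = fun _ => false
    · refine Finset.sum_eq_zero fun x _ => ?_
      rw [hε, hc.left_eq_zero, mul_zero, zero_mul]
    · rw [Finset.sum_congr rfl fun x hx => by rw [mem_block.1 hx], ← Finset.sum_mul,
        ← Finset.sum_mul, sum_block_comp_cell i k (haarStep ε k), sum_haarStep, if_neg hε]
      simp
  tsum_right i x := by
    have hsum : Summable fun y => discKernel M N i x y := by
      refine summable_of_tsum_enorm_ne_top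
        (fun y => (isKernel_discKernel hM N).enorm_le i x y) ?_
      rw [tsum_majorant, ENNReal.tsum_mul_left]
      finiteness
    rw [tsum_block_of_summable (i + 1) hsum]
    set j := N - 1 - (i : ℤ) with hj
    have h1 : ∀ l, ∑ y ∈ block (i + 1) l, discKernel M N i x y =
        ∑ ε : Fin n → Bool, haarStep ε (cell (i + 1) x) (cell i x) *
          M j (ε, cell (i + 1) x) (fun _ => false, l) := by
      intro l
      simp only [discKernel]
      rw [← Finset.mul_sum, Finset.sum_comm, Finset.mul_sum]
      refine Finset.sum_congr rfl fun ε _ => ?_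
      rw [Finset.sum_comm]
      have h2 : ∀ ε' : Fin n → Bool, ∑ y ∈ block (i + 1) l,
          haarStep ε (cell (i + 1) x) (cell i x) *
          M (N - 1 - i) (ε, cell (i + 1) x) (ε', cell (i + 1) y) *
          haarStep ε' (cell (i + 1) y) (cell i y) =
          haarStep ε (cell (i + 1) x) (cell i x) * M j (ε, cell (i + 1) x) (ε', l) *
            (2 ^ (n * i) * if ε' = (fun _ => false) then (2 : ℂ) ^ n else 0) := by
        intro ε'
        rw [Finset.sum_congr rfl fun y hy => by rw [mem_block.1 hy], ← Finset.mul_sum,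
          sum_block_comp_cell i l (haarStep ε' l), sum_haarStep]
      simp only [h2, mul_ite, mul_zero, Finset.sum_ite_eq', Finset.mem_univ, if_true]
      rw [mul_add, mul_one, pow_add]
      field_simp
    simp only [h1]
    have hsM : ∀ ε : Fin n → Bool,
        Summable fun l => M j (ε, cell (i + 1) x) (fun _ => false, l) := fun ε => by
      refine summable_of_tsum_enorm_ne_top (fun l => hM j _ _) ?_
      exact ((Equiv.subLeft (cell (i + 1) x)).tsum_eq w).trans_ne hw
    rw [Summable.tsum_finsetSum fun ε _ => (hsM ε).mul_left _]
    refine Finset.sum_eq_zero fun ε _ => ?_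
    rw [tsum_mul_left, hc.tsum_eq_zero, mul_zero]

end

/-- The integral over a dyadic cube. -/
def cellInt (f : (Fin n → ℝ) → ℂ) (N : ℤ) (y : Fin n → ℤ) : ℂ := ∫ x in dyadicCube N y, f x

lemma enorm_cellInt_le (f : (Fin n → ℝ) → ℂ) (N : ℤ) (y : Fin n → ℤ) :
    ‖cellInt f N y‖ₑ ≤ absInt f N y := enorm_integral_le_lintegral_enorm _

lemma bracket_haarAt_eq_tsum {f : (Fin n → ℝ) → ℂ} (hf : Integrable f) (N : ℤ) (i : ℕ)
    (q : HaarIndex n) :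
    bracket (haarAt (N - 1 - i) q) f =
      amp n (N - 1 - i) * ∑' y, haarStep q.1 q.2 (cell i y) * cellInt f N y := by
  set j := N - 1 - (i : ℤ) with hj
  have h_int : Integrable fun x => haarAt j q x * f x :=
    hf.bdd_mul (measurable_haarAt j q).aestronglyMeasurable
      (Filter.Eventually.of_forall fun x => norm_haarAt_le j q x)
  rw [bracket, ← setIntegral_univ, ← iUnion_dyadicCube N,
    integral_iUnion (fun y => measurableSet_dyadicCube N y) (pairwise_disjoint_dyadicCube N)
      h_int.integrableOn, ← tsum_mul_left]
  refine tsum_congr fun y => ?_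
  rw [setIntegral_congr_fun (g := fun x => amp n j * haarStep q.1 q.2 (cell i y) * f x)
    (measurableSet_dyadicCube N y), integral_const_mul, cellInt, mul_assoc]
  intro x hx
  simp only
  rw [haarAt_eq_haarStep, show j + 1 = N - i by rw [hj]; ring, floorAt_sub, mem_dyadicCube.1 hx]

/-- The form at a scale as a form on the lattice. -/
lemma scaleForm_eq_kernelForm (M : ℤ → HaarIndex n → HaarIndex n → ℂ) {g f : (Fin n → ℝ) → ℂ}
    (hg : Integrable g) (hf : Integrable f) {N : ℤ} (hgs : (cellInt g N).support.Finite)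
    (hfs : (cellInt f N).support.Finite) (i : ℕ) :
    scaleForm M (N - 1 - i) g f = (2 : ℂ) ^ (n * N : ℤ) *
      kernelForm (discKernel M N) i (cellInt g N) (cellInt f N) := by
  set j := N - 1 - (i : ℤ) with hj
  set G := cellInt g N with hG
  set F := cellInt f N with hF
  set X := hgs.toFinset with hX
  set Y := hfs.toFinset with hY
  have hX0 : ∀ x, x ∉ X → G x = 0 := fun x hx => by simpa [hX] using hx
  have hY0 : ∀ y, y ∉ Y → F y = 0 := fun y hy => by simpa [hY] using hy
  have hbg : ∀ q, bracket g (haarAt j q) = amp n j * ∑ x ∈ X, haarStep q.1 q.2 (cell i x) * G x := by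
    intro q
    rw [bracket_comm, bracket_haarAt_eq_tsum hg, tsum_eq_sum fun x hx => by rw [← hG, hX0 x hx, mul_zero]]
  have hbf : ∀ q, bracket (haarAt j q) f = amp n j * ∑ x ∈ Y, haarStep q.1 q.2 (cell i x) * F x := by
    intro q
    rw [bracket_haarAt_eq_tsum hf, tsum_eq_sum fun x hx => by rw [← hF, hY0 x hx, mul_zero]]
  have hterm : ∀ q, haarTerm M j g f q = ∑ x ∈ X, ∑ y ∈ Y, (amp n j * amp n j * G x * F y) *
      (haarStep q.1.1 q.1.2 (cell i x) * M j q.1 q.2 * haarStep q.2.1 q.2.2 (cell i y)) := by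
    intro q
    rw [haarTerm, hbg, hbf, Finset.mul_sum, Finset.mul_sum, Finset.sum_mul, Finset.sum_mul]
    refine Finset.sum_congr rfl fun x _ => ?_
    rw [Finset.mul_sum]
    exact Finset.sum_congr rfl fun y _ => by ring
  -- Given `x` and `y`, only the Haar functions on the cubes containing these cells contribute, so
  -- the double series is a finite sum.
  have hzero : ∀ x y (q : HaarIndex n × HaarIndex n),
      q ∉ (Finset.univ ×ˢ {cell (i + 1) x}) ×ˢ (Finset.univ ×ˢ {cell (i + 1) y}) →
      haarStep q.1.1 q.1.2 (cell i x) * M j q.1 q.2 * haarStep q.2.1 q.2.2 (cell i y) = 0 := by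
    intro x y q hq
    simp only [Finset.mem_product, Finset.mem_univ, true_and, Finset.mem_singleton, not_and_or]
      at hq
    rcases hq with hq | hq
    · rw [haarStep_eq_zero (by rw [cell_cell]; exact Ne.symm hq)]; simp
    · rw [haarStep_eq_zero (l := q.2.2) (by rw [cell_cell]; exact Ne.symm hq)]; simp
  have hinner : ∀ x y, ∑' q : HaarIndex n × HaarIndex n,
      (haarStep q.1.1 q.1.2 (cell i x) * M j q.1 q.2 * haarStep q.2.1 q.2.2 (cell i y)) =
      2 ^ (n * (i + 1)) * discKernel M N i x y := by
    intro x y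
    rw [tsum_eq_sum (hzero x y), Finset.sum_product, Finset.sum_product, discKernel,
      mul_inv_cancel_left₀ (by simp)]
    refine Finset.sum_congr rfl fun ε _ => ?_
    rw [Finset.sum_singleton, Finset.sum_product]
    refine Finset.sum_congr rfl fun ε' _ => ?_
    rw [Finset.sum_singleton]
  have hsm : ∀ x y, Summable fun q : HaarIndex n × HaarIndex n => (amp n j * amp n j * G x * F y) *
      (haarStep q.1.1 q.1.2 (cell i x) * M j q.1 q.2 * haarStep q.2.1 q.2.2 (cell i y)) :=
    fun x y => (summable_of_ne_finset_zero (hzero x y)).mul_left _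
  -- The two amplitudes give `2 ^ (n j)`, and `j + i + 1 = N`.
  have hamp : (amp n j : ℂ) * amp n j * 2 ^ (n * (i + 1)) = 2 ^ (n * N : ℤ) := by
    rw [← Complex.ofReal_mul, amp_mul_amp]
    push_cast
    rw [← zpow_natCast, ← zpow_add₀ (by norm_num)]
    congr 1
    rw [hj]; push_cast; ring
  rw [scaleForm, tsum_congr hterm, Summable.tsum_finsetSum fun x _ => summable_sum fun y _ => hsm x y,
    kernelForm, tsum_eq_sum fun x hx => by rw [hX0 x hx, mul_zero], Finset.mul_sum]
  refine Finset.sum_congr rfl fun x _ => ?_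
  rw [Summable.tsum_finsetSum fun y _ => hsm x y, kernelOp,
    tsum_eq_sum fun y hy => by rw [hY0 y hy, mul_zero], Finset.sum_mul, Finset.mul_sum]
  refine Finset.sum_congr rfl fun y _ => ?_
  rw [tsum_mul_left, hinner, ← hamp]
  ring

/-! ### Elementary properties of the forms -/

/-- The transposed matrices. -/
def swapMatrix (M : ℤ → HaarIndex n → HaarIndex n → ℂ) : ℤ → HaarIndex n → HaarIndex n → ℂ :=
  fun j q r => M j r q

/-- The matrices which are dominated by `w` and cancel on one of the two sides. -/
structure IsAdmissible (w : (Fin n → ℤ) → ℝ≥0∞) (M : ℤ → HaarIndex n → HaarIndex n → ℂ) :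
    Prop where
  dominated : IsDominated w M
  cancelling : IsCancellingMatrix M ∨ IsCancellingMatrix (swapMatrix M)

lemma isDominated_swapMatrix {w : (Fin n → ℤ) → ℝ≥0∞} {M : ℤ → HaarIndex n → HaarIndex n → ℂ}
    (hM : IsDominated w M) (hw : ∀ m, w (-m) = w m) :
    IsDominated w (swapMatrix M) := fun j q r => by
  rw [← hw, neg_sub]
  exact hM j r q

lemma IsAdmissible.swap {w : (Fin n → ℤ) → ℝ≥0∞} {M : ℤ → HaarIndex n → HaarIndex n → ℂ}
    (hM : IsAdmissible w M) (hw : ∀ m, w (-m) = w m) : IsAdmissible w (swapMatrix M) where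
  dominated := isDominated_swapMatrix hM.dominated hw
  cancelling := hM.cancelling.symm

lemma haarTerm_swapMatrix (M : ℤ → HaarIndex n → HaarIndex n → ℂ) (j : ℤ) (g f : (Fin n → ℝ) → ℂ)
    (q : HaarIndex n × HaarIndex n) : haarTerm (swapMatrix M) j g f q = haarTerm M j f g q.swap := by
  simp only [haarTerm, swapMatrix, Prod.fst_swap, Prod.snd_swap]
  rw [bracket_comm g, bracket_comm f]
  ring

lemma scaleForm_swapMatrix (M : ℤ → HaarIndex n → HaarIndex n → ℂ) (j : ℤ)
    (g f : (Fin n → ℝ) → ℂ) : scaleForm (swapMatrix M) j g f = scaleForm M j f g := by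
  simp only [scaleForm, haarTerm_swapMatrix]
  exact (Equiv.prodComm _ _).tsum_eq (haarTerm M j f g)

lemma bracket_congr {g g' f f' : (Fin n → ℝ) → ℂ} (hg : g =ᵐ[volume] g') (hf : f =ᵐ[volume] f') :
    bracket g f = bracket g' f' := by
  refine integral_congr_ae ?_
  filter_upwards [hg, hf] with x h1 h2
  rw [h1, h2]

lemma haarTerm_congr (M : ℤ → HaarIndex n → HaarIndex n → ℂ) (j : ℤ) {g g' f f' : (Fin n → ℝ) → ℂ}
    (hg : g =ᵐ[volume] g') (hf : f =ᵐ[volume] f') : haarTerm M j g f = haarTerm M j g' f' := by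
  funext q
  rw [haarTerm, haarTerm, bracket_congr hg (ae_eq_refl _), bracket_congr (ae_eq_refl _) hf]

lemma scaleForm_congr (M : ℤ → HaarIndex n → HaarIndex n → ℂ) (j : ℤ) {g g' f f' : (Fin n → ℝ) → ℂ}
    (hg : g =ᵐ[volume] g') (hf : f =ᵐ[volume] f') : scaleForm M j g f = scaleForm M j g' f' := by
  rw [scaleForm, scaleForm, haarTerm_congr M j hg hf]

lemma absInt_mono {f f' : (Fin n → ℝ) → ℂ} (h : ∀ᵐ x, ‖f x‖ₑ ≤ ‖f' x‖ₑ) (j : ℤ) (k : Fin n → ℤ) :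
    absInt f j k ≤ absInt f' j k := lintegral_mono_ae (ae_restrict_of_ae h)

lemma termBound_mono (w : (Fin n → ℤ) → ℝ≥0∞) (j : ℤ) {g g' f f' : (Fin n → ℝ) → ℂ}
    (hg : ∀ᵐ x, ‖g x‖ₑ ≤ ‖g' x‖ₑ) (hf : ∀ᵐ x, ‖f x‖ₑ ≤ ‖f' x‖ₑ)
    (q : HaarIndex n × HaarIndex n) : termBound w j g f q ≤ termBound w j g' f' q := by
  unfold termBound
  have h1 := absInt_mono hg j q.1.2
  have h2 := absInt_mono hf j q.2.2
  gcongr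

lemma enorm_scaleForm_le_tsum {w : (Fin n → ℤ) → ℝ≥0∞} {M : ℤ → HaarIndex n → HaarIndex n → ℂ}
    (hM : IsDominated w M) (j : ℤ) (g f : (Fin n → ℝ) → ℂ) :
    ‖scaleForm M j g f‖ₑ ≤ ∑' q, termBound w j g f q :=
  enorm_tsum_le_tsum_enorm.trans (ENNReal.tsum_le_tsum fun q => enorm_haarTerm_le hM j g f q)

section

variable {w : (Fin n → ℤ) → ℝ≥0∞} {M : ℤ → HaarIndex n → HaarIndex n → ℂ} {p q : ℝ≥0∞}
  {g f : (Fin n → ℝ) → ℂ}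

lemma tsum_termBound_ne_top (hpq : p.HolderConjugate q) (hw : ∑' m, w m ≠ ∞)
    (hg : MemLp g q volume) (hf : MemLp f p volume) (j : ℤ) : ∑' r, termBound w j g f r ≠ ∞ := by
  refine ne_top_of_le_ne_top ?_ (tsum_termBound_le hpq w hg.1 hf.1 j)
  have := hg.2.ne
  have := hf.2.ne
  finiteness

lemma summable_haarTerm (hpq : p.HolderConjugate q) (hM : IsDominated w M) (hw : ∑' m, w m ≠ ∞)
    (hg : MemLp g q volume) (hf : MemLp f p volume) (j : ℤ) : Summable (haarTerm M j g f) :=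
  summable_of_tsum_enorm_ne_top (enorm_haarTerm_le hM j g f)
    (tsum_termBound_ne_top hpq hw hg hf j)

lemma enorm_scaleForm_le (hpq : p.HolderConjugate q) (hM : IsDominated w M)
    (hg : MemLp g q volume) (hf : MemLp f p volume) (j : ℤ) :
    ‖scaleForm M j g f‖ₑ ≤ 4 ^ n * (∑' m, w m) * (eLpNorm g q volume * eLpNorm f p volume) :=
  (enorm_scaleForm_le_tsum hM j g f).trans (tsum_termBound_le hpq w hg.1 hf.1 j)

lemma integrable_haarAt_mul (hf : LocallyIntegrable f volume) (j : ℤ) (r : HaarIndex n) :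
    Integrable fun x => haarAt j r x * f x := by
  have h : Integrable ((dyadicCube j r.2).indicator f) :=
    (integrableOn_dyadicCube hf j r.2).integrable_indicator (measurableSet_dyadicCube j r.2)
  refine (h.bdd_mul (measurable_haarAt j r).aestronglyMeasurable
    (Filter.Eventually.of_forall fun x => norm_haarAt_le j r x)).congr
    (Filter.Eventually.of_forall fun x => ?_)
  by_cases hx : x ∈ dyadicCube j r.2
  · simp only [Set.indicator_of_mem hx]
  · simp only [haarAt_eq_zero hx, zero_mul]

/-! ### Truncation -/

/-- The restriction of a function to a ball. -/
def trunc (R : ℕ) (f : (Fin n → ℝ) → ℂ) : (Fin n → ℝ) → ℂ :=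
  (Metric.closedBall 0 (R : ℝ)).indicator f

lemma enorm_trunc_le (R : ℕ) (f : (Fin n → ℝ) → ℂ) (x : Fin n → ℝ) : ‖trunc R f x‖ₑ ≤ ‖f x‖ₑ :=
  enorm_indicator_le_enorm_self f x

lemma memLp_trunc (hf : MemLp f p volume) (R : ℕ) : MemLp (trunc R f) p volume :=
  hf.indicator Metric.isClosed_closedBall.measurableSet

lemma integrable_trunc (hf : LocallyIntegrable f volume) (R : ℕ) : Integrable (trunc R f) :=
  (hf.integrableOn_isCompact (isCompact_closedBall 0 (R : ℝ))).integrable_indicator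
    Metric.isClosed_closedBall.measurableSet

lemma finite_support_cellInt_trunc (f : (Fin n → ℝ) → ℂ) (R : ℕ) (N : ℤ) :
    (cellInt (trunc R f) N).support.Finite := by
  refine (Set.finite_Icc (fun _ : Fin n => ⌊(2 : ℝ) ^ N * (-R)⌋)
    (fun _ => ⌊(2 : ℝ) ^ N * R⌋)).subset fun y hy => ?_
  have : ∃ x ∈ dyadicCube N y, trunc R f x ≠ 0 := by
    by_contra! h
    exact hy (setIntegral_eq_zero_of_forall_eq_zero h)
  obtain ⟨x, hx, hxf⟩ := this
  have hxR : x ∈ Metric.closedBall (0 : Fin n → ℝ) (R : ℝ) := by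
    by_contra h
    exact hxf (Set.indicator_of_notMem h f)
  rw [mem_closedBall_zero_iff] at hxR
  have hp : (0 : ℝ) ≤ 2 ^ N := by positivity
  rw [← mem_dyadicCube.1 hx]
  have h a : -(R : ℝ) ≤ x a ∧ x a ≤ R := abs_le.1 ((norm_le_pi_norm x a).trans hxR)
  exact ⟨fun a => Int.floor_mono (mul_le_mul_of_nonneg_left (h a).1 hp),
    fun a => Int.floor_mono (mul_le_mul_of_nonneg_left (h a).2 hp)⟩

lemma dyadicCube_subset_closedBall (j : ℤ) (k : Fin n → ℤ) :
    ∃ R : ℕ, dyadicCube j k ⊆ Metric.closedBall 0 (R : ℝ) := by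
  have hp : (0 : ℝ) < 2 ^ j := by positivity
  obtain ⟨R, hR⟩ := exists_nat_ge ((‖k‖ + 1) / (2 : ℝ) ^ j)
  refine ⟨R, fun x hx => ?_⟩
  rw [mem_closedBall_zero_iff]
  refine le_trans ((pi_norm_le_iff_of_nonneg (by positivity)).2 fun a => ?_) hR
  have h1 := (hx a).1
  have h2 := (hx a).2
  have h3 : |(k a : ℝ)| ≤ ‖k‖ := by
    have := norm_le_pi_norm k a
    rwa [Int.norm_eq_abs] at this
  rw [le_div_iff₀ hp, Real.norm_eq_abs, ← abs_of_pos hp, ← abs_mul, abs_le]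
  rw [abs_le] at h3
  constructor <;> nlinarith

lemma eventually_bracket_trunc (f : (Fin n → ℝ) → ℂ) (j : ℤ) (r : HaarIndex n) :
    ∀ᶠ R in Filter.atTop, bracket (haarAt j r) (trunc R f) = bracket (haarAt j r) f := by
  obtain ⟨R₀, h₀⟩ := dyadicCube_subset_closedBall j r.2
  filter_upwards [Filter.eventually_ge_atTop R₀] with R hR
  refine integral_congr_ae (Filter.Eventually.of_forall fun x => ?_)
  by_cases hx : x ∈ dyadicCube j r.2
  · have : x ∈ Metric.closedBall (0 : Fin n → ℝ) (R : ℝ) :=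
      Metric.closedBall_subset_closedBall (by exact_mod_cast hR) (h₀ hx)
    simp only [trunc, Set.indicator_of_mem this]
  · simp only [haarAt_eq_zero hx, zero_mul]

/-- Each Haar function has bounded support, so every summand is eventually equal to its limit; the
bound for the untruncated functions dominates. -/
lemma tendsto_scaleForm_trunc (hpq : p.HolderConjugate q) (hM : IsDominated w M)
    (hw : ∑' m, w m ≠ ∞) (hg : MemLp g q volume) (hf : MemLp f p volume) (j : ℤ) :
    Filter.Tendsto (fun R => scaleForm M j (trunc R g) (trunc R f)) Filter.atTop
      (nhds (scaleForm M j g f)) := by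
  have ht := tsum_termBound_ne_top hpq hw hg hf j
  refine tendsto_tsum_of_dominated_convergence (ENNReal.summable_toReal ht) (fun r => ?_)
    (Filter.Eventually.of_forall fun R r => ?_)
  · refine tendsto_const_nhds.congr' ?_
    filter_upwards [eventually_bracket_trunc g j r.1, eventually_bracket_trunc f j r.2]
      with R h1 h2
    rw [haarTerm, haarTerm, h2, bracket_comm g, bracket_comm (trunc R g), h1]
  · rw [← toReal_enorm]
    refine ENNReal.toReal_mono (ENNReal.ne_top_of_tsum_ne_top ht r) ?_
    exact (enorm_haarTerm_le hM j _ _ r).trans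
      (termBound_mono w j (Filter.Eventually.of_forall (enorm_trunc_le R g))
        (Filter.Eventually.of_forall (enorm_trunc_le R f)) r)

end

/-! ### The estimate in `L^p` -/

section

variable {w : (Fin n → ℤ) → ℝ≥0∞} {δ : ℝ}

lemma moment_const_mul (w : (Fin n → ℤ) → ℝ≥0∞) (δ : ℝ) (c : ℝ≥0∞) :
    moment (fun m => c * w m) δ = c * moment w δ := by
  simp only [moment, mul_assoc, ENNReal.tsum_mul_left]

/-- Truncated functions have finitely many nonzero cell integrals on any mesh, so the lattice
estimate applies. Passing to cell integrals costs volume factors with exponents `1 / p` and `1 / q`,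
which together cancel `2 ^ (n N)`. The bound is thus independent of the mesh and of the truncation.
-/
theorem exists_sum_enorm_scaleForm_le (hn : 1 ≤ n) (hw : ∀ m, w (-m) = w m) (hδ : 0 < δ)
    (hδ1 : δ ≤ 1) (hm : moment w δ ≠ ∞) {p q : ℝ≥0∞} (hpq : p.HolderConjugate q) (hp1 : 1 < p)
    (hp : p ≠ ∞) :
    ∃ C : ℝ≥0∞, C ≠ ∞ ∧ ∀ M, IsAdmissible w M → ∀ g f : (Fin n → ℝ) → ℂ,
      MemLp g q volume → MemLp f p volume → ∀ J : Finset ℤ,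
        ∑ j ∈ J, ‖scaleForm M j g f‖ₑ ≤ C * (eLpNorm g q volume * eLpNorm f p volume) := by
  obtain ⟨hpr, hqt⟩ := toReal_holderConjugate hpq hp1 hp
  have hws : ∑' m, w m ≠ ∞ := ne_top_of_le_ne_top hm (tsum_weight_le_moment w hδ)
  obtain ⟨C, hC, h⟩ := exists_sum_enorm_kernelForm_le (w := fun m => 4 ^ n * w m) hn
    (fun m => by rw [hw]) hδ hδ1 (by rw [moment_const_mul]; finiteness) hpr
  refine ⟨C, hC, fun M hM g f hg hf J => ?_⟩
  have key : ∀ R : ℕ, ∑ j ∈ J, ‖scaleForm M j (trunc R g) (trunc R f)‖ₑ ≤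
      C * (eLpNorm g q volume * eLpNorm f p volume) := by
    intro R
    -- The mesh is so fine that every scale in `J` has the form `N - 1 - i` with a natural number
    -- `i`.
    obtain ⟨N₀, hN₀⟩ := J.exists_le
    set N := N₀ + 1 with hN
    have hG := finite_support_cellInt_trunc g R N
    have hF := finite_support_cellInt_trunc f R N
    have hgi := integrable_trunc (hg.locallyIntegrable hpq.symm.one_le) R
    have hfi := integrable_trunc (hf.locallyIntegrable hp1.le) R
    have hcanc : IsCancelling (discKernel M N) ∨ IsCancelling fun i x y => discKernel M N i y x := by
      rcases hM.cancelling with hc | hc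
      · exact Or.inl (isCancelling_discKernel hM.dominated hws hc N)
      · right
        rw [discKernel_swap]
        exact isCancelling_discKernel (isDominated_swapMatrix hM.dominated hw) hws hc N
    have e1 : ∑ j ∈ J, ‖scaleForm M j (trunc R g) (trunc R f)‖ₑ =
        (2 : ℝ≥0∞) ^ (n * N : ℤ) * ∑ i ∈ J.image (fun j => (N - 1 - j).toNat),
          ‖kernelForm (discKernel M N) i (cellInt (trunc R g) N) (cellInt (trunc R f) N)‖ₑ := by
      rw [Finset.sum_image, Finset.mul_sum]
      · refine Finset.sum_congr rfl fun j hj => ?_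
        have hjN : N - 1 - ((N - 1 - j).toNat : ℤ) = j := by
          have := hN₀ j hj
          omega
        have h2 : ‖(2 : ℂ) ^ (n * N : ℤ)‖ₑ = (2 : ℝ≥0∞) ^ (n * N : ℤ) := by
          rw [← ofReal_norm, norm_zpow, ← ofReal_two_zpow]; simp
        conv_lhs => rw [← hjN]
        rw [scaleForm_eq_kernelForm M hgi hfi hG hF, enorm_mul, h2]
      · intro a ha b hb hab
        have h1 := hN₀ a ha
        have h2 := hN₀ b hb
        simp only at hab
        omega
    rw [e1]
    set V := (2 : ℝ≥0∞) ^ (-(n * N) : ℤ) with hV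
    have hp0 := hpr.pos
    have hq0 := hpr.symm.pos
    have hbound : ∀ {r s : ℝ} {u : ℝ≥0∞} {φ : (Fin n → ℝ) → ℂ}, r.HolderConjugate s →
        MemLp φ u volume → u = ENNReal.ofReal r →
        (∑' x, ‖cellInt (trunc R φ) N x‖ₑ ^ r) ^ (1 / r) ≤ V ^ (1 / s) * eLpNorm φ u volume := by
      intro r s u φ hrs hφ hu
      have hr0 := hrs.pos
      calc _ ≤ (∑' x, absInt (trunc R φ) N x ^ r) ^ (1 / r) := by
            refine ENNReal.rpow_le_rpow (ENNReal.tsum_le_tsum fun x => ?_) (by positivity)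
            exact ENNReal.rpow_le_rpow (enorm_cellInt_le _ _ _) hr0.le
        _ ≤ V ^ (1 / s) * eLpNorm (trunc R φ) u volume := by
            rw [hu]
            exact tsum_absInt_rpow_rpow_le (memLp_trunc hφ R).1 hrs N
        _ ≤ _ := mul_le_mul_right (eLpNorm_indicator_le _) _
    have eg := hbound hpr.symm hg (ENNReal.ofReal_toReal hqt).symm
    have ef := hbound hpr hf (ENNReal.ofReal_toReal hp).symm
    calc _ ≤ (2 : ℝ≥0∞) ^ (n * N : ℤ) * (C * ((V ^ (1 / p.toReal) * eLpNorm g q volume) *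
          (V ^ (1 / q.toReal) * eLpNorm f p volume))) := by
          refine mul_le_mul_right ((h _ (isKernel_discKernel hM.dominated N) hcanc _ _ hG hF _).trans
            ?_) _
          exact mul_le_mul_right (mul_le_mul' eg ef) _
      _ = (2 : ℝ≥0∞) ^ (n * N : ℤ) * V ^ (1 / p.toReal + 1 / q.toReal) *
          (C * (eLpNorm g q volume * eLpNorm f p volume)) := by
          rw [ENNReal.rpow_add_of_nonneg _ _ (by positivity) (by positivity)]; ring
      _ = _ := by
          rw [one_div, one_div, hpr.inv_add_inv_eq_one, ENNReal.rpow_one, hV, ← two_zpow_add,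
            add_neg_cancel, zpow_zero, one_mul]
  refine le_of_tendsto' (tendsto_finsetSum J fun j _ =>
    (tendsto_scaleForm_trunc hpq hM.dominated hws hg hf j).enorm) key

end

/-! ### Linearity -/

lemma bracket_add_left {g g' : (Fin n → ℝ) → ℂ} (hg : LocallyIntegrable g volume)
    (hg' : LocallyIntegrable g' volume) (j : ℤ) (r : HaarIndex n) :
    bracket (g + g') (haarAt j r) = bracket g (haarAt j r) + bracket g' (haarAt j r) := by
  rw [bracket_comm, bracket_comm g, bracket_comm g']
  simp only [bracket]
  rw [← integral_add (integrable_haarAt_mul hg j r) (integrable_haarAt_mul hg' j r)]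
  exact integral_congr_ae (Filter.Eventually.of_forall fun x => mul_add _ _ _)

lemma bracket_smul_left (c : ℂ) (g f : (Fin n → ℝ) → ℂ) :
    bracket (c • g) f = c * bracket g f := by
  simp only [bracket]
  rw [← integral_const_mul]
  exact integral_congr_ae (Filter.Eventually.of_forall fun x => mul_assoc _ _ _)

lemma haarTerm_add_left (M : ℤ → HaarIndex n → HaarIndex n → ℂ) (j : ℤ)
    {g g' : (Fin n → ℝ) → ℂ} (hg : LocallyIntegrable g volume)
    (hg' : LocallyIntegrable g' volume) (f : (Fin n → ℝ) → ℂ) :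
    haarTerm M j (g + g') f = haarTerm M j g f + haarTerm M j g' f := by
  funext r
  simp only [haarTerm, Pi.add_apply, bracket_add_left hg hg']
  ring

lemma haarTerm_smul_left (M : ℤ → HaarIndex n → HaarIndex n → ℂ) (j : ℤ) (c : ℂ)
    (g f : (Fin n → ℝ) → ℂ) : haarTerm M j (c • g) f = c • haarTerm M j g f := by
  funext r
  simp only [haarTerm, Pi.smul_apply, bracket_smul_left, smul_eq_mul]
  ring

lemma scaleForm_smul_left (M : ℤ → HaarIndex n → HaarIndex n → ℂ) (j : ℤ) (c : ℂ)
    (g f : (Fin n → ℝ) → ℂ) : scaleForm M j (c • g) f = c * scaleForm M j g f := by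
  rw [scaleForm, haarTerm_smul_left, scaleForm, ← tsum_mul_left]
  rfl

section

variable {w : (Fin n → ℤ) → ℝ≥0∞} {M : ℤ → HaarIndex n → HaarIndex n → ℂ} {p q : ℝ≥0∞}
  {g g' f : (Fin n → ℝ) → ℂ}

lemma scaleForm_add_left (hpq : p.HolderConjugate q) (hM : IsDominated w M) (hw : ∑' m, w m ≠ ∞)
    (hg : MemLp g q volume) (hg' : MemLp g' q volume) (hf : MemLp f p volume) (j : ℤ) :
    scaleForm M j (g + g') f = scaleForm M j g f + scaleForm M j g' f := by
  rw [scaleForm, haarTerm_add_left M j (hg.locallyIntegrable hpq.symm.one_le)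
    (hg'.locallyIntegrable hpq.symm.one_le)]
  exact (summable_haarTerm hpq hM hw hg hf j).tsum_add (summable_haarTerm hpq hM hw hg' hf j)

end

/-! ### Square integrable atoms -/

/-- The square integrable functions of mean zero which are supported in `Q_{i,k}`. -/
structure IsSquareAtom (i : ℤ) (k : Fin n → ℤ) (f : (Fin n → ℝ) → ℂ) : Prop where
  memLp : MemLp f 2 volume
  eq_zero : ∀ᵐ x, x ∉ dyadicCube i k → f x = 0
  integral_eq_zero : ∫ x, f x = 0

lemma eLpNorm_eq_restrict {f : (Fin n → ℝ) → ℂ} {i : ℤ} {k : Fin n → ℤ}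
    (h : ∀ᵐ x, x ∉ dyadicCube i k → f x = 0) (p : ℝ≥0∞) :
    eLpNorm f p volume = eLpNorm f p (volume.restrict (dyadicCube i k)) := by
  rw [← eLpNorm_indicator_eq_eLpNorm_restrict (measurableSet_dyadicCube i k)]
  refine eLpNorm_congr_ae ?_
  filter_upwards [h] with x hx
  by_cases hxQ : x ∈ dyadicCube i k
  · rw [Set.indicator_of_mem hxQ]
  · rw [Set.indicator_of_notMem hxQ, hx hxQ]

lemma eLpNorm_one_le_of_support {f : (Fin n → ℝ) → ℂ} {i : ℤ} {k : Fin n → ℤ}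
    (hf : AEStronglyMeasurable f volume) (h : ∀ᵐ x, x ∉ dyadicCube i k → f x = 0) :
    eLpNorm f 1 volume ≤ volume (dyadicCube i k) ^ (1 / 2 : ℝ) * eLpNorm f 2 volume := by
  rw [eLpNorm_eq_restrict h, eLpNorm_eq_restrict h 2, mul_comm]
  refine (eLpNorm_le_eLpNorm_mul_rpow_measure_univ (p := 1) (q := 2) (by norm_num)
    hf.restrict).trans (le_of_eq ?_)
  rw [Measure.restrict_apply_univ]
  norm_num

namespace IsSquareAtom

variable {i : ℤ} {k : Fin n → ℤ} {f : (Fin n → ℝ) → ℂ}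

lemma eLpNorm_one_le (hf : IsSquareAtom i k f) :
    eLpNorm f 1 volume ≤ volume (dyadicCube i k) ^ (1 / 2 : ℝ) * eLpNorm f 2 volume :=
  eLpNorm_one_le_of_support hf.memLp.1 hf.eq_zero

lemma memLp_one (hf : IsSquareAtom i k f) : MemLp f 1 volume := by
  refine ⟨hf.memLp.1, hf.eLpNorm_one_le.trans_lt ?_⟩
  have h1 := hf.memLp.2.ne
  have h2 := volume_dyadicCube_ne_top i k
  finiteness

/-- A Haar function of scale `j` is constant on the cubes of side `2 ^ (-(j + 1))`. For `j < i` one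
of these contains the cube of the atom, which has mean zero. -/
lemma bracket_haarAt_eq_zero (hf : IsSquareAtom i k f) {j : ℤ} (hj : j < i) (r : HaarIndex n) :
    bracket (haarAt j r) f = 0 := by
  obtain ⟨d, hd⟩ : ∃ d : ℕ, j + 1 = i - d := ⟨(i - j - 1).toNat, by omega⟩
  have : ∀ᵐ x, haarAt j r x * f x = (amp n j * haarStep r.1 r.2 (cell d k)) * f x := by
    filter_upwards [hf.eq_zero] with x hx
    by_cases hxQ : x ∈ dyadicCube i k
    · rw [haarAt_eq_haarStep, hd, floorAt_sub, mem_dyadicCube.1 hxQ]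
    · rw [hx hxQ]; simp
  rw [bracket, integral_congr_ae this, integral_const_mul, hf.integral_eq_zero, mul_zero]

lemma scaleForm_eq_zero (hf : IsSquareAtom i k f) (M : ℤ → HaarIndex n → HaarIndex n → ℂ) {j : ℤ}
    (hj : j < i) (g : (Fin n → ℝ) → ℂ) : scaleForm M j g f = 0 := by
  simp only [scaleForm, haarTerm, hf.bracket_haarAt_eq_zero hj, mul_zero, tsum_zero]

end IsSquareAtom

/-! ### The neighbours of a cube -/

/-- The union of a dyadic cube and its neighbours. -/
def star (i : ℤ) (k : Fin n → ℤ) : Set (Fin n → ℝ) :=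
  ⋃ l ∈ Finset.Icc (k - 1) (k + 1), dyadicCube i l

lemma mem_star {i : ℤ} {k : Fin n → ℤ} {x : Fin n → ℝ} :
    x ∈ star i k ↔ floorAt i x ∈ Finset.Icc (k - 1) (k + 1) := by
  simp only [star, Set.mem_iUnion, mem_dyadicCube, exists_prop]
  exact ⟨fun ⟨l, hl, h⟩ => h ▸ hl, fun h => ⟨_, h, rfl⟩⟩

lemma measurableSet_star (i : ℤ) (k : Fin n → ℤ) : MeasurableSet (star i k) :=
  Finset.measurableSet_biUnion _ fun l _ => measurableSet_dyadicCube i l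

lemma volume_star_le (i : ℤ) (k l : Fin n → ℤ) :
    volume (star i k) ≤ 3 ^ n * volume (dyadicCube i l) := by
  refine (measure_biUnion_finset_le _ _).trans (le_of_eq ?_)
  rw [Finset.sum_congr rfl fun a _ => (volume_dyadicCube i a).trans (volume_dyadicCube i l).symm,
    Finset.sum_const, Pi.card_Icc, nsmul_eq_mul]
  have : ∀ a : Fin n, (Finset.Icc ((k - 1) a) ((k + 1) a)).card = 3 := fun a => by
    rw [Int.card_Icc]
    simp only [Pi.sub_apply, Pi.add_apply, Pi.one_apply]
    omega
  simp only [this, Finset.prod_const, Finset.card_univ, Fintype.card_fin]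
  push_cast; rfl

lemma two_pow_le_norm_sub {r : ℕ} {k l k₀ : Fin n → ℤ}
    (hk : cell r k ∉ Finset.Icc (k₀ - 1) (k₀ + 1)) (hl : cell r l = k₀) :
    (2 : ℝ) ^ r ≤ ‖k - l‖ := by
  have : ∃ a, cell r k a < k₀ a - 1 ∨ k₀ a + 1 < cell r k a := by
    by_contra! h
    exact hk (Finset.mem_Icc.2 ⟨fun a => (h a).1, fun a => (h a).2⟩)
  obtain ⟨a, ha⟩ := this
  refine le_trans ?_ (norm_le_pi_norm (k - l) a)
  rw [Pi.sub_apply, Int.norm_eq_abs]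
  have hp : (0 : ℤ) < 2 ^ r := by positivity
  have key : (2 : ℤ) ^ r ≤ |k a - l a| := by
    have h1 := Int.emod_add_mul_ediv (k a) (2 ^ r)
    have h2 := Int.emod_add_mul_ediv (l a) (2 ^ r)
    have h3 := Int.emod_nonneg (k a) hp.ne'
    have h4 := Int.emod_lt_of_pos (k a) hp
    have h5 := Int.emod_nonneg (l a) hp.ne'
    have h6 := Int.emod_lt_of_pos (l a) hp
    rw [← hl] at ha
    simp only [cell] at ha
    rw [le_abs]
    rcases ha with ha | ha
    · right; nlinarith
    · left; nlinarith
  exact_mod_cast key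

section

variable {w : (Fin n → ℤ) → ℝ≥0∞} {δ : ℝ} {M : ℤ → HaarIndex n → HaarIndex n → ℂ}

lemma tsum_weight_far_le (w : (Fin n → ℤ) → ℝ≥0∞) (hδ : 0 < δ) (r : ℕ) :
    ∑' m : Fin n → ℤ, (if (2 : ℝ) ^ r ≤ ‖m‖ then w m else 0) ≤ moment w δ * rate δ ^ r := by
  rw [moment, ← ENNReal.tsum_mul_right]
  refine ENNReal.tsum_le_tsum fun m => ?_
  split_ifs with h
  · rw [mul_assoc, rate_pow, ← ENNReal.ofReal_mul (by positivity)]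
    refine le_mul_of_one_le_right' ?_
    rw [ENNReal.one_le_ofReal, Real.rpow_neg (by positivity), ← div_eq_mul_inv,
      one_le_div (by positivity)]
    exact Real.rpow_le_rpow (by positivity) (by linarith) hδ.le
  · exact zero_le

lemma absInt_eq_zero {g : (Fin n → ℝ) → ℂ} {j : ℤ} {k : Fin n → ℤ}
    (h : ∀ᵐ x, x ∈ dyadicCube j k → g x = 0) : absInt g j k = 0 := by
  rw [absInt, lintegral_congr_ae (g := fun _ => 0), lintegral_zero]
  filter_upwards [(ae_restrict_iff' (measurableSet_dyadicCube j k)).2 h] with x hx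
  rw [hx, enorm_zero]

/-- A term can be nonzero only if its left cube lies outside the neighbourhood and its right cube
inside `Q_{i,k₀}`. Their indices then differ by at least `2 ^ r`, and the weight may be replaced by
its tail. -/
lemma IsSquareAtom.enorm_scaleForm_far_le (hM : IsDominated w M) (hδ : 0 < δ) {i : ℤ}
    {k₀ : Fin n → ℤ} {f g : (Fin n → ℝ) → ℂ} (hf : IsSquareAtom i k₀ f) (hg : MemLp g ∞ volume)
    (hg0 : ∀ᵐ x, x ∈ star i k₀ → g x = 0) (r : ℕ) :
    ‖scaleForm M (i + r) g f‖ₑ ≤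
      4 ^ n * moment w δ * (eLpNorm g ∞ volume * eLpNorm f 1 volume) * rate δ ^ r := by
  have hcell : ∀ x : Fin n → ℝ, floorAt i x = cell r (floorAt (i + r) x) := fun x => by
    rw [← floorAt_sub, add_sub_cancel_right]
  set w' : (Fin n → ℤ) → ℝ≥0∞ := fun m => if (2 : ℝ) ^ r ≤ ‖m‖ then w m else 0 with hw'
  have hle : ∀ q, termBound w (i + r) g f q ≤ termBound w' (i + r) g f q := by
    intro q
    unfold termBound
    by_cases hgq : cell r q.1.2 ∈ Finset.Icc (k₀ - 1) (k₀ + 1)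
    · rw [absInt_eq_zero (g := g), zero_mul, mul_zero, mul_zero]
      · exact zero_le
      filter_upwards [hg0] with x hx hxQ
      refine hx (mem_star.2 ?_)
      rwa [hcell, mem_dyadicCube.1 hxQ]
    by_cases hfq : cell r q.2.2 = k₀
    · have hN := two_pow_le_norm_sub hgq hfq
      simp only [hw', if_pos hN, le_refl]
    · rw [absInt_eq_zero (g := f), mul_zero, mul_zero, mul_zero]
      · exact zero_le
      filter_upwards [hf.eq_zero] with x hx hxQ
      refine hx fun h => hfq ?_
      rw [← mem_dyadicCube.1 h, hcell, mem_dyadicCube.1 hxQ]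
  calc _ ≤ ∑' q, termBound w' (i + r) g f q :=
        (enorm_scaleForm_le_tsum hM _ g f).trans (ENNReal.tsum_le_tsum hle)
    _ ≤ 4 ^ n * (∑' m, w' m) * (eLpNorm g ∞ volume * eLpNorm f 1 volume) :=
        tsum_termBound_le (inferInstance : ENNReal.HolderConjugate 1 ∞) w' hg.1 hf.memLp.1 _
    _ ≤ 4 ^ n * (moment w δ * rate δ ^ r) * (eLpNorm g ∞ volume * eLpNorm f 1 volume) := by
        gcongr
        exact tsum_weight_far_le w hδ r
    _ = _ := by ring

/-- Coarser scales vanish by the mean zero of the atom; the scales `i + r` form a geometric series.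
-/
lemma IsSquareAtom.sum_enorm_scaleForm_far_le (hM : IsDominated w M) (hδ : 0 < δ) {i : ℤ}
    {k₀ : Fin n → ℤ} {f g : (Fin n → ℝ) → ℂ} (hf : IsSquareAtom i k₀ f) (hg : MemLp g ∞ volume)
    (hg0 : ∀ᵐ x, x ∈ star i k₀ → g x = 0) :
    ∑' j, ‖scaleForm M j g f‖ₑ ≤
      4 ^ n * moment w δ * (eLpNorm g ∞ volume * eLpNorm f 1 volume) * (1 - rate δ)⁻¹ := by
  rw [← (Equiv.addLeft i).tsum_eq]
  rw [← Nat.cast_injective.tsum_eq (g := fun d : ℕ => (d : ℤ))]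
  · rw [← ENNReal.tsum_geometric, ← ENNReal.tsum_mul_left]
    exact ENNReal.tsum_le_tsum fun r => hf.enorm_scaleForm_far_le hM hδ hg hg0 r
  · intro d hd
    by_contra h
    have hd0 : d < 0 := by
      by_contra! h0
      exact h ⟨d.toNat, by simp [h0]⟩
    refine hd ?_
    simp only [Equiv.coe_addLeft]
    rw [hf.scaleForm_eq_zero M (by omega), enorm_zero]

lemma eLpNorm_two_indicator_star_le {g : (Fin n → ℝ) → ℂ} (hg : AEStronglyMeasurable g volume) (i : ℤ) (k : Fin n → ℤ) :
    eLpNorm ((star i k).indicator g) 2 volume ≤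
      3 ^ n * volume (dyadicCube i k) ^ (1 / 2 : ℝ) * eLpNorm g ∞ volume := by
  rw [eLpNorm_indicator_eq_eLpNorm_restrict (measurableSet_star i k)]
  refine (eLpNorm_le_eLpNorm_mul_rpow_measure_univ (p := 2) (q := ∞) le_top hg.restrict).trans ?_
  rw [Measure.restrict_apply_univ, mul_comm]
  refine mul_le_mul' ?_ (eLpNorm_mono_measure _ Measure.restrict_le_self)
  calc _ ≤ (3 ^ n * volume (dyadicCube i k)) ^ (1 / 2 : ℝ) := by
        norm_num
        exact ENNReal.rpow_le_rpow (volume_star_le i k k) (by norm_num)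
    _ ≤ _ := by
        rw [ENNReal.mul_rpow_of_nonneg _ _ (by norm_num)]
        refine mul_le_mul_left ?_ _
        conv_rhs => rw [← ENNReal.rpow_one (3 ^ n)]
        exact ENNReal.rpow_le_rpow_of_exponent_le (one_le_pow₀ (by norm_num)) (by norm_num)

/-- The forms on `L^∞` and square integrable atoms. -/
theorem exists_sum_enorm_scaleForm_atom_le (hn : 1 ≤ n) (hw : ∀ m, w (-m) = w m) (hδ : 0 < δ)
    (hδ1 : δ ≤ 1) (hm : moment w δ ≠ ∞) :
    ∃ K : ℝ≥0∞, K ≠ ∞ ∧ ∀ M, IsAdmissible w M → ∀ (i : ℤ) (k : Fin n → ℤ) (g f : (Fin n → ℝ) → ℂ),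
      MemLp g ∞ volume → IsSquareAtom i k f → ∀ J : Finset ℤ,
        ∑ j ∈ J, ‖scaleForm M j g f‖ₑ ≤ K * (eLpNorm g ∞ volume *
          (volume (dyadicCube i k) ^ (1 / 2 : ℝ) * eLpNorm f 2 volume)) := by
  have hws : ∑' m, w m ≠ ∞ := ne_top_of_le_ne_top hm (tsum_weight_le_moment w hδ)
  obtain ⟨C, hC, h⟩ := exists_sum_enorm_scaleForm_le hn hw hδ hδ1 hm
    (inferInstance : ENNReal.HolderConjugate 2 2) (by norm_num) (by norm_num)
  have hr : (1 - rate δ)⁻¹ ≠ ∞ := by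
    rw [ENNReal.inv_ne_top, ne_eq, tsub_eq_zero_iff_le, not_le]
    exact rate_lt_one hδ
  refine ⟨C * 3 ^ n + 4 ^ n * moment w δ * (1 - rate δ)⁻¹, by finiteness, ?_⟩
  intro M hM i k g f hg hf J
  set S := star i k with hS
  have hSm : MeasurableSet S := measurableSet_star i k
  have hgS : MemLp (S.indicator g) ∞ volume := hg.indicator hSm
  have hgS' : MemLp (Sᶜ.indicator g) ∞ volume := hg.indicator hSm.compl
  have e2 := eLpNorm_two_indicator_star_le hg.1 i k
  have hgS2 : MemLp (S.indicator g) 2 volume := by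
    refine ⟨hgS.1, e2.trans_lt ?_⟩
    have h1 := hg.2.ne
    have h2 := volume_dyadicCube_ne_top i k
    finiteness
  -- The near part of `g` is square integrable with norm controlled by `|Q| ^ (1 / 2) ‖g‖_∞`, so the
  -- `L²` bound applies; the far part is left to the tail estimate.
  have hsplit : ∀ j, scaleForm M j g f =
      scaleForm M j (S.indicator g) f + scaleForm M j (Sᶜ.indicator g) f := fun j => by
    rw [← scaleForm_add_left (inferInstance : ENNReal.HolderConjugate 1 ∞) hM.dominated hws hgS hgS'
      hf.memLp_one, Set.indicator_self_add_compl]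
  set A := eLpNorm g ∞ volume * (volume (dyadicCube i k) ^ (1 / 2 : ℝ) * eLpNorm f 2 volume) with hA
  calc _ ≤ ∑ j ∈ J, ‖scaleForm M j (S.indicator g) f‖ₑ +
        ∑ j ∈ J, ‖scaleForm M j (Sᶜ.indicator g) f‖ₑ := by
        rw [← Finset.sum_add_distrib]
        refine Finset.sum_le_sum fun j _ => ?_
        rw [hsplit]
        exact enorm_add_le _ _
    _ ≤ C * 3 ^ n * A + 4 ^ n * moment w δ * (1 - rate δ)⁻¹ * A := by
        refine add_le_add ((h M hM _ f hgS2 hf.memLp J).trans ?_) ((ENNReal.sum_le_tsum J).trans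
          ((hf.sum_enorm_scaleForm_far_le hM.dominated hδ hgS' ?_).trans ?_))
        · calc _ ≤ C * ((3 ^ n * volume (dyadicCube i k) ^ (1 / 2 : ℝ) * eLpNorm g ∞ volume) *
                eLpNorm f 2 volume) := by gcongr
            _ = _ := by rw [hA]; ring
        · refine Filter.Eventually.of_forall fun x hx => ?_
          exact Set.indicator_of_notMem (by simpa using hx) g
        · calc _ ≤ 4 ^ n * moment w δ * A * (1 - rate δ)⁻¹ := by
                refine mul_le_mul_left (mul_le_mul_right (mul_le_mul' ?_ hf.eLpNorm_one_le) _) _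
                exact eLpNorm_indicator_le _
            _ = _ := by ring
    _ = _ := by ring

end

/-! ### Duality -/

/-- The bounded measurable functions of bounded support. -/
structure IsTest (g : (Fin n → ℝ) → ℂ) : Prop where
  measurable : Measurable g
  exists_bound : ∃ m : ℕ, (∀ x, ‖g x‖ ≤ m) ∧ ∀ x, x ∉ Metric.closedBall 0 (m : ℝ) → g x = 0

lemma memLp_indicator_of_bound {s : Set (Fin n → ℝ)} (hs : MeasurableSet s) (hs' : volume s ≠ ∞)
    {g : (Fin n → ℝ) → ℂ} (hg : AEStronglyMeasurable g volume) {c : ℝ} (hc : ∀ᵐ x, ‖g x‖ ≤ c)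
    (p : ℝ≥0∞) : MemLp (s.indicator g) p volume := by
  rw [memLp_indicator_iff_restrict hs]
  have : IsFiniteMeasure (volume.restrict s) := ⟨by rw [Measure.restrict_apply_univ]; exact hs'.lt_top⟩
  exact MemLp.of_bound hg.restrict c (ae_restrict_of_ae hc)

lemma IsTest.memLp {g : (Fin n → ℝ) → ℂ} (hg : IsTest g) (p : ℝ≥0∞) : MemLp g p volume := by
  obtain ⟨m, hm, hm'⟩ := hg.exists_bound
  have h : (Metric.closedBall 0 (m : ℝ)).indicator g = g :=
    Set.indicator_eq_self.2 fun x hx => by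
      by_contra hx'
      exact hx (hm' x hx')
  rw [← h]
  exact memLp_indicator_of_bound Metric.isClosed_closedBall.measurableSet
    measure_closedBall_lt_top.ne hg.measurable.aestronglyMeasurable
    (Filter.Eventually.of_forall hm) p

/-- The conjugate sign. -/
def conjSign (z : ℂ) : ℂ := (‖z‖ : ℂ)⁻¹ * (starRingEnd ℂ) z

lemma conjSign_mul (z : ℂ) : conjSign z * z = ‖z‖ := by
  rw [conjSign, mul_assoc, Complex.conj_mul']
  by_cases h : (‖z‖ : ℂ) = 0
  · simp [h]
  · field_simp

lemma norm_conjSign_le (z : ℂ) : ‖conjSign z‖ ≤ 1 := by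
  rw [conjSign, norm_mul, norm_inv, Complex.norm_real, norm_norm, RCLike.norm_conj]
  exact inv_mul_le_one

lemma measurable_conjSign : Measurable conjSign := by
  unfold conjSign
  have : Measurable fun z : ℂ => (starRingEnd ℂ) z := Complex.continuous_conj.measurable
  fun_prop

lemma le_of_le_mul_rpow {a K : ℝ≥0∞} {t : ℝ} (ht : 0 < t) (ha : a ≠ ∞)
    (h : a ≤ K * a ^ (1 - 1 / t)) : a ≤ K ^ t := by
  rcases eq_or_ne a 0 with rfl | h0
  · exact zero_le
  rw [← ENNReal.rpow_inv_le_iff ht, ← one_div]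
  have e : a = a ^ (1 / t) * a ^ (1 - 1 / t) := by
    rw [← ENNReal.rpow_add _ _ h0 ha]; simp
  conv_lhs at h => rw [e]
  have h1 : a ^ (1 - 1 / t) ≠ 0 := by simp [ENNReal.rpow_eq_zero_iff, h0, ha]
  have h2 : a ^ (1 - 1 / t) ≠ ∞ := by simp [ENNReal.rpow_eq_top_iff, h0, ha]
  calc a ^ (1 / t) = a ^ (1 / t) * a ^ (1 - 1 / t) / a ^ (1 - 1 / t) :=
        (ENNReal.mul_div_cancel_right h1 h2).symm
    _ ≤ K * a ^ (1 - 1 / t) / a ^ (1 - 1 / t) := ENNReal.div_le_div_right h _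
    _ = K := ENNReal.mul_div_cancel_right h1 h2

/-- The converse of Hölder's inequality. -/
theorem eLpNorm_le_of_forall_isTest {p q : ℝ≥0∞} (hpq : p.HolderConjugate q) (hp : p ≠ ∞)
    {F : (Fin n → ℝ) → ℂ} (hF : AEStronglyMeasurable F volume) {K : ℝ≥0∞}
    (h : ∀ g, IsTest g → ‖bracket g F‖ₑ ≤ K * eLpNorm g q volume) : eLpNorm F p volume ≤ K := by
  wlog hFm : Measurable F generalizing F
  · rw [eLpNorm_congr_ae hF.ae_eq_mk]
    refine this hF.stronglyMeasurable_mk.aestronglyMeasurable (fun g hg => ?_)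
      hF.stronglyMeasurable_mk.measurable
    rw [← bracket_congr (ae_eq_refl g) hF.ae_eq_mk]
    exact h g hg
  have hp1 : 1 ≤ p := hpq.one_le
  set t := p.toReal with ht
  have ht1 : 1 ≤ t := by
    rw [ht, ← ENNReal.toReal_one]; exact ENNReal.toReal_mono hp hp1
  have ht0 : 0 < t := by linarith
  rw [eLpNorm_eq_lintegral_rpow_enorm_toReal (by rintro rfl; simp at hp1) hp,
    one_div, ENNReal.rpow_inv_le_iff ht0]
  -- On these sets both `x` and `F x` are bounded, so all integrals are finite. They exhaust the
  -- space, and monotone convergence gives the claim.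
  set A : ℕ → Set (Fin n → ℝ) := fun m => Metric.closedBall 0 (m : ℝ) ∩ {x | ‖F x‖ ≤ m} with hA
  have hAm : ∀ m, MeasurableSet (A m) := fun m =>
    Metric.isClosed_closedBall.measurableSet.inter (measurableSet_le hFm.norm measurable_const)
  have hAf : ∀ m, volume (A m) ≠ ∞ := fun m =>
    ((measure_mono Set.inter_subset_left).trans_lt measure_closedBall_lt_top).ne
  have hmono : Monotone A := by
    intro a b hab x hx
    have hab' : (a : ℝ) ≤ b := by exact_mod_cast hab
    exact ⟨Metric.closedBall_subset_closedBall hab' hx.1, le_trans hx.2 hab'⟩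
  have hU : ⋃ m, A m = Set.univ := by
    refine Set.eq_univ_of_forall fun x => ?_
    obtain ⟨m, hm⟩ := exists_nat_ge (max ‖x‖ ‖F x‖)
    exact Set.mem_iUnion.2 ⟨m, mem_closedBall_zero_iff.2 ((le_max_left _ _).trans hm),
      (le_max_right _ _).trans hm⟩
  rw [← setLIntegral_univ, ← hU, setLIntegral_iUnion_of_directed _ hmono.directed_le]
  refine iSup_le fun m => ?_
  set I := ∫⁻ x in A m, ‖F x‖ₑ ^ t with hI
  have hpow : ∀ (x : Fin n → ℝ) {s : ℝ}, 0 ≤ s → ‖F x‖ₑ ^ s = ENNReal.ofReal (‖F x‖ ^ s) := by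
    intro x s hs
    rw [← ofReal_norm, ENNReal.ofReal_rpow_of_nonneg (norm_nonneg _) hs]
  set φ : (Fin n → ℝ) → ℝ := (A m).indicator fun x => ‖F x‖ ^ t with hφ
  have hφ0 : ∀ x, 0 ≤ φ x := Set.indicator_nonneg fun x _ => by positivity
  have hφm : Measurable φ := (hFm.norm.pow_const t).indicator (hAm m)
  have hIφ : I = ∫⁻ x, ENNReal.ofReal (φ x) := by
    rw [hI, ← lintegral_indicator (hAm m)]
    refine lintegral_congr fun x => ?_
    by_cases hx : x ∈ A m
    · rw [hφ, Set.indicator_of_mem hx, Set.indicator_of_mem hx, hpow x ht0.le]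
    · rw [hφ, Set.indicator_of_notMem hx, Set.indicator_of_notMem hx, ENNReal.ofReal_zero]
  have hIt : I ≠ ∞ := by
    refine ne_top_of_le_ne_top ?_ (setLIntegral_mono (g := fun _ => (m : ℝ≥0∞) ^ t)
      measurable_const fun x hx => ?_)
    · rw [setLIntegral_const]
      have := hAf m
      finiteness
    · refine ENNReal.rpow_le_rpow ?_ ht0.le
      rw [← ofReal_norm]
      exact ENNReal.ofReal_le_of_le_toReal (by simpa using hx.2)
  -- The extremal function of Hölder's inequality: paired with `F` it gives the integral `I` of `‖F‖
  -- ^ t`, and its `L^q` norm is at most `I ^ (1 - 1 / t)`. Division by a power of `I` needs the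
  -- finiteness of `I`.
  set G : (Fin n → ℝ) → ℂ := (A m).indicator fun x => conjSign (F x) * ((‖F x‖ ^ (t - 1) : ℝ) : ℂ)
    with hG
  have hGnorm : ∀ x ∈ A m, ‖G x‖ ≤ ‖F x‖ ^ (t - 1) := by
    intro x hx
    rw [hG, Set.indicator_of_mem hx, norm_mul, Complex.norm_real,
      Real.norm_of_nonneg (by positivity)]
    exact mul_le_of_le_one_left (by positivity) (norm_conjSign_le _)
  have hGtest : IsTest G := by
    refine ⟨Measurable.indicator ((measurable_conjSign.comp hFm).mul
      (Complex.measurable_ofReal.comp (hFm.norm.pow_const _))) (hAm m), ?_⟩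
    obtain ⟨N, hN⟩ := exists_nat_ge (max (m : ℝ) ((m : ℝ) ^ (t - 1)))
    refine ⟨N, fun x => ?_, fun x hx => ?_⟩
    · by_cases hx : x ∈ A m
      · refine (hGnorm x hx).trans (le_trans ?_ ((le_max_right _ _).trans hN))
        exact Real.rpow_le_rpow (norm_nonneg _) hx.2 (by linarith)
      · rw [hG, Set.indicator_of_notMem hx]; simp
    · refine Set.indicator_of_notMem (fun hx' => hx ?_) _
      exact Metric.closedBall_subset_closedBall ((le_max_left _ _).trans hN) hx'.1
  have hbr : ‖bracket G F‖ₑ = I := by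
    have h1 : ∀ x, G x * F x = (φ x : ℂ) := by
      intro x
      by_cases hx : x ∈ A m
      · rw [hG, hφ, Set.indicator_of_mem hx, Set.indicator_of_mem hx, mul_right_comm, conjSign_mul,
          ← Complex.ofReal_mul]
        congr 1
        rcases eq_or_ne ‖F x‖ 0 with h0 | h0
        · rw [h0, zero_mul, Real.zero_rpow ht0.ne']
        · conv_lhs => rw [← Real.rpow_one ‖F x‖, ← Real.rpow_mul (norm_nonneg _), one_mul]
          rw [← Real.rpow_add (lt_of_le_of_ne (norm_nonneg _) h0.symm)]
          congr 1; ring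
      · rw [hG, hφ, Set.indicator_of_notMem hx, Set.indicator_of_notMem hx]; simp
    have h_int : Integrable φ := by
      refine ⟨hφm.aestronglyMeasurable, ?_⟩
      rw [hasFiniteIntegral_iff_ofReal (Filter.Eventually.of_forall hφ0), ← hIφ]
      exact hIt.lt_top
    rw [bracket, integral_congr_ae (Filter.Eventually.of_forall h1), integral_complex_ofReal,
      ← ofReal_norm, Complex.norm_real, Real.norm_of_nonneg (integral_nonneg hφ0),
      ofReal_integral_eq_lintegral_ofReal h_int (Filter.Eventually.of_forall hφ0), hIφ]
  have hGq : eLpNorm G q volume ≤ I ^ (1 - 1 / t) := by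
    rcases eq_or_lt_of_le hp1 with h1 | h1
    · have hq : q = ∞ := hpq.conj_eq.trans (by simp [← h1])
      have ht' : t = 1 := by rw [ht, ← h1]; simp
      rw [hq, ht', eLpNorm_exponent_top]
      simp only [div_one, sub_self, ENNReal.rpow_zero]
      refine eLpNormEssSup_le_of_ae_enorm_bound (Filter.Eventually.of_forall fun x => ?_)
      rw [← ofReal_norm, ENNReal.ofReal_le_one]
      by_cases hx : x ∈ A m
      · refine (hGnorm x hx).trans ?_
        rw [ht', sub_self, Real.rpow_zero]
      · rw [hG, Set.indicator_of_notMem hx]; simp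
    · obtain ⟨hpr, hqt⟩ := toReal_holderConjugate hpq h1 hp
      have hs0 := hpr.symm.pos
      have hs : 1 / q.toReal = 1 - 1 / t := by
        have := hpr.inv_add_inv_eq_one
        rw [one_div, one_div]; linarith
      rw [eLpNorm_eq_lintegral_rpow_enorm_toReal hpq.symm.ne_zero hqt, hs]
      refine ENNReal.rpow_le_rpow ?_ (by rw [← hs]; positivity)
      rw [hI, ← lintegral_indicator (hAm m)]
      refine lintegral_mono fun x => ?_
      by_cases hx : x ∈ A m
      · rw [Set.indicator_of_mem hx]
        calc _ ≤ (‖F x‖ₑ ^ (t - 1)) ^ q.toReal := by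
              refine ENNReal.rpow_le_rpow ?_ hs0.le
              rw [hpow x (by linarith), ← ofReal_norm]
              exact ENNReal.ofReal_le_ofReal (hGnorm x hx)
          _ = _ := by
              rw [← ENNReal.rpow_mul]
              congr 1
              exact hpr.sub_one_mul_conj
      · rw [hG, Set.indicator_of_notMem hx, enorm_zero, ENNReal.zero_rpow_of_pos hs0]
        exact zero_le
  refine le_of_le_mul_rpow ht0 hIt ?_
  calc I = ‖bracket G F‖ₑ := hbr.symm
    _ ≤ K * eLpNorm G q volume := h G hGtest
    _ ≤ _ := mul_le_mul_right hGq _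

/-- The pairing of `L^p` and `L^q`. -/
def pairing (n : ℕ) (p q : ℝ≥0∞) [Fact (1 ≤ p)] [Fact (1 ≤ q)] [p.HolderConjugate q] :
    Lp ℂ p (volume : Measure (Fin n → ℝ)) →L[ℂ] Lp ℂ q (volume : Measure (Fin n → ℝ)) →L[ℂ] ℂ :=
  (ContinuousLinearMap.mul ℂ ℂ).lpPairing volume p q

lemma pairing_apply {p q : ℝ≥0∞} [Fact (1 ≤ p)] [Fact (1 ≤ q)] [p.HolderConjugate q]
    (F : Lp ℂ p (volume : Measure (Fin n → ℝ))) (g : Lp ℂ q (volume : Measure (Fin n → ℝ))) :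
    pairing n p q F g = bracket g F := by
  rw [pairing, ContinuousLinearMap.lpPairing_eq_integral, bracket_comm]
  rfl

lemma norm_le_norm_pairing {p q : ℝ≥0∞} [Fact (1 ≤ p)] [Fact (1 ≤ q)] [hpq : p.HolderConjugate q]
    (hp : p ≠ ∞) (F : Lp ℂ p (volume : Measure (Fin n → ℝ))) : ‖F‖ ≤ ‖pairing n p q F‖ := by
  have h : eLpNorm F p volume ≤ ENNReal.ofReal ‖pairing n p q F‖ := by
    refine eLpNorm_le_of_forall_isTest hpq hp (Lp.aestronglyMeasurable F) fun g hg => ?_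
    have h1 := (pairing n p q F).le_opNorm ((hg.memLp q).toLp g)
    rw [pairing_apply, bracket_congr (MemLp.coeFn_toLp (hg.memLp q)) (ae_eq_refl _),
      Lp.norm_toLp] at h1
    rw [← ofReal_norm, ← ENNReal.ofReal_toReal (hg.memLp q).2.ne, ← ENNReal.ofReal_mul (by positivity)]
    exact ENNReal.ofReal_le_ofReal h1
  rw [Lp.norm_def]
  exact ENNReal.toReal_le_of_le_ofReal (norm_nonneg _) h

/-- The representation of functionals on `L²`. -/
lemma exists_pairing_two_eq (ℓ : Lp ℂ 2 (volume : Measure (Fin n → ℝ)) →L[ℂ] ℂ) :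
    ∃ F, pairing n 2 2 F = ℓ := by
  set G := (InnerProductSpace.toDual ℂ _).symm ℓ with hG
  -- The bracket is bilinear and the inner product sesquilinear, hence the conjugate of the Riesz
  -- vector.
  have hm : MemLp (fun x => (starRingEnd ℂ) (G x)) 2 volume :=
    (memLp_congr_norm (Complex.continuous_conj.comp_aestronglyMeasurable (Lp.aestronglyMeasurable G))
      (Lp.aestronglyMeasurable G) (Filter.Eventually.of_forall fun x => RCLike.norm_conj _)).2
      (Lp.memLp G)
  refine ⟨hm.toLp _, ?_⟩
  ext g
  rw [pairing_apply, bracket_congr (ae_eq_refl _) (MemLp.coeFn_toLp hm),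
    ← InnerProductSpace.toDual_symm_apply, L2.inner_def]
  exact integral_congr_ae (Filter.Eventually.of_forall fun x => by simp [hG])

/-- A linear relation defined everywhere has a linear selection, because surjective linear maps over
a field split. This also covers values that are not unique, as in `BMO_d`, where functions of
seminorm zero are not divided out. -/
lemma exists_linearMap_mem {V W : Type*} [AddCommGroup V] [Module ℂ V] [AddCommGroup W]
    [Module ℂ W] (R : Submodule ℂ (V × W)) (h : ∀ v, ∃ u, (v, u) ∈ R) :
    ∃ S : V →ₗ[ℂ] W, ∀ v, (v, S v) ∈ R := by
  obtain ⟨σ, hσ⟩ := LinearMap.exists_rightInverse_of_surjective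
    ((LinearMap.fst ℂ V W).comp R.subtype) (LinearMap.range_eq_top.2 fun v => by
      obtain ⟨u, hu⟩ := h v
      exact ⟨⟨(v, u), hu⟩, rfl⟩)
  refine ⟨(LinearMap.snd ℂ V W).comp (R.subtype.comp σ), fun v => ?_⟩
  have h1 : (σ v).1.1 = v := LinearMap.congr_fun hσ v
  convert (σ v).2 using 1
  exact Prod.ext h1.symm rfl

/-! ### The forms -/

/-- The form with the matrices `M` has the value `z` at `g`, `f`. -/
def HaarForm (M : ℤ → HaarIndex n → HaarIndex n → ℂ) (g f : (Fin n → ℝ) → ℂ) (z : ℂ) : Prop :=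
  SeriesHasSum haarAt M haarAt g f z

/-- The sum of the forms over all scales. -/
def formValue (M : ℤ → HaarIndex n → HaarIndex n → ℂ) (g f : (Fin n → ℝ) → ℂ) : ℂ :=
  ∑' j, scaleForm M j g f

section

variable {M : ℤ → HaarIndex n → HaarIndex n → ℂ} {g g' f f' : (Fin n → ℝ) → ℂ} {z z' : ℂ}

lemma haarForm_iff : HaarForm M g f z ↔
    (∀ j, Summable (haarTerm M j g f)) ∧ HasSum (fun j => scaleForm M j g f) z := Iff.rfl

lemma HaarForm.unique (h : HaarForm M g f z) (h' : HaarForm M g f z') : z = z' :=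
  HasSum.unique h.2 h'.2

lemma HaarForm.congr (h : HaarForm M g f z) (hg : g =ᵐ[volume] g') (hf : f =ᵐ[volume] f') :
    HaarForm M g' f' z := by
  rw [haarForm_iff] at h ⊢
  simp only [scaleForm, haarTerm_congr M _ hg hf] at h ⊢
  exact h

lemma HaarForm.swap (h : HaarForm M g f z) : HaarForm (swapMatrix M) f g z := by
  rw [haarForm_iff] at h ⊢
  simp only [scaleForm_swapMatrix]
  refine ⟨fun j => ?_, h.2⟩
  have : haarTerm (swapMatrix M) j f g = haarTerm M j g f ∘ Prod.swap :=
    funext fun q => haarTerm_swapMatrix M j f g q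
  rw [this]
  exact (Equiv.prodComm _ _).summable_iff.2 (h.1 j)

lemma HaarForm.add_left (h : HaarForm M g f z) (h' : HaarForm M g' f z')
    (hg : LocallyIntegrable g volume) (hg' : LocallyIntegrable g' volume) :
    HaarForm M (g + g') f (z + z') := by
  rw [haarForm_iff] at h h' ⊢
  simp only [scaleForm, haarTerm_add_left M _ hg hg']
  refine ⟨fun j => (h.1 j).add (h'.1 j), (h.2.add h'.2).congr_fun fun j => ?_⟩
  exact (h.1 j).tsum_add (h'.1 j)

lemma HaarForm.smul_left (h : HaarForm M g f z) (c : ℂ) : HaarForm M (c • g) f (c * z) := by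
  rw [haarForm_iff] at h ⊢
  simp only [scaleForm_smul_left, haarTerm_smul_left]
  exact ⟨fun j => (h.1 j).const_smul c, h.2.mul_left c⟩

lemma haarForm_zero_left (M : ℤ → HaarIndex n → HaarIndex n → ℂ) (f : (Fin n → ℝ) → ℂ) :
    HaarForm M 0 f 0 := by
  have h : ∀ j, haarTerm M j 0 f = 0 := fun j => by
    funext q
    simp [haarTerm, bracket]
  rw [haarForm_iff]
  simp only [scaleForm, h]
  exact ⟨fun _ => summable_zero, by simp⟩

lemma haarForm_zero_right (M : ℤ → HaarIndex n → HaarIndex n → ℂ) (g : (Fin n → ℝ) → ℂ) :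
    HaarForm M g 0 0 := (haarForm_zero_left (swapMatrix M) g).swap

lemma HaarForm.add_right (h : HaarForm M g f z) (h' : HaarForm M g f' z')
    (hf : LocallyIntegrable f volume) (hf' : LocallyIntegrable f' volume) :
    HaarForm M g (f + f') (z + z') := (h.swap.add_left h'.swap hf hf').swap

lemma HaarForm.smul_right (h : HaarForm M g f z) (c : ℂ) : HaarForm M g (c • f) (c * z) :=
  (h.swap.smul_left c).swap

lemma haarForm_of_sum_le (hs : ∀ j, Summable (haarTerm M j g f)) {K : ℝ≥0∞} (hK : K ≠ ∞)
    (h : ∀ J : Finset ℤ, ∑ j ∈ J, ‖scaleForm M j g f‖ₑ ≤ K) :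
    HaarForm M g f (formValue M g f) ∧ ‖formValue M g f‖ₑ ≤ K := by
  have hle : ∑' j, ‖scaleForm M j g f‖ₑ ≤ K := by
    rw [ENNReal.tsum_eq_iSup_sum]; exact iSup_le h
  refine ⟨⟨hs, (summable_of_tsum_enorm_ne_top (fun _ => le_rfl)
    (ne_top_of_le_ne_top hK hle)).hasSum⟩, enorm_tsum_le_tsum_enorm.trans hle⟩

end

/-! ### From bounded forms to operators on `L^p` -/

lemma eLpNorm_coe_eq_ofReal_norm {p : ℝ≥0∞} (f : Lp ℂ p (volume : Measure (Fin n → ℝ))) :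
    eLpNorm f p volume = ENNReal.ofReal ‖f‖ := by
  rw [Lp.norm_def, ENNReal.ofReal_toReal (Lp.eLpNorm_ne_top f)]

lemma norm_le_of_enorm_le {z : ℂ} {C : ℝ≥0∞} (hC : C ≠ ∞) {t : ℝ} (ht : 0 ≤ t)
    (h : ‖z‖ₑ ≤ C * ENNReal.ofReal t) : ‖z‖ ≤ C.toReal * t := by
  rw [← toReal_enorm, ← ENNReal.toReal_ofReal ht, ← ENNReal.toReal_mul]
  exact ENNReal.toReal_mono (by finiteness) h

/-- Boundedness of the forms on `L^q × L^p`. -/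
structure HasLpBound (M : ℤ → HaarIndex n → HaarIndex n → ℂ) (p q C : ℝ≥0∞) : Prop where
  ne_top : C ≠ ∞
  summable : ∀ g f : (Fin n → ℝ) → ℂ, MemLp g q volume → MemLp f p volume → ∀ j,
    Summable (haarTerm M j g f)
  sum_le : ∀ g f : (Fin n → ℝ) → ℂ, MemLp g q volume → MemLp f p volume → ∀ J : Finset ℤ,
    ∑ j ∈ J, ‖scaleForm M j g f‖ₑ ≤ C * (eLpNorm g q volume * eLpNorm f p volume)

section

variable {M : ℤ → HaarIndex n → HaarIndex n → ℂ} {p q C : ℝ≥0∞}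

lemma HasLpBound.haarForm (h : HasLpBound M p q C) {g f : (Fin n → ℝ) → ℂ} (hg : MemLp g q volume)
    (hf : MemLp f p volume) : HaarForm M g f (formValue M g f) ∧
      ‖formValue M g f‖ₑ ≤ C * (eLpNorm g q volume * eLpNorm f p volume) := by
  refine haarForm_of_sum_le (h.summable g f hg hf) ?_ (h.sum_le g f hg hf)
  have := h.ne_top
  have := hg.2.ne
  have := hf.2.ne
  finiteness

/-- The value of the form is unique, so bilinearity on classes follows from that of the series,
after a change of representatives. -/
lemma HasLpBound.exists_clm [Fact (1 ≤ p)] [Fact (1 ≤ q)] (h : HasLpBound M p q C) :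
    ∃ Φ : Lp ℂ p (volume : Measure (Fin n → ℝ)) →L[ℂ]
        Lp ℂ q (volume : Measure (Fin n → ℝ)) →L[ℂ] ℂ,
      ∀ (f : Lp ℂ p (volume : Measure (Fin n → ℝ))) (g : Lp ℂ q (volume : Measure (Fin n → ℝ))),
        HaarForm M g f (Φ f g) := by
  have hloc : ∀ {r : ℝ≥0∞} [Fact (1 ≤ r)] (f : Lp ℂ r (volume : Measure (Fin n → ℝ))),
      LocallyIntegrable f volume := fun f => (Lp.memLp f).locallyIntegrable Fact.out
  have hv : ∀ (f : Lp ℂ p (volume : Measure (Fin n → ℝ)))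
      (g : Lp ℂ q (volume : Measure (Fin n → ℝ))), HaarForm M g f (formValue M g f) :=
    fun f g => (h.haarForm (Lp.memLp g) (Lp.memLp f)).1
  refine ⟨LinearMap.mkContinuous₂ (LinearMap.mk₂ ℂ (fun f g => formValue M g f)
    (fun f f' g => ?_) (fun c f g => ?_) (fun f g g' => ?_) (fun c f g => ?_)) C.toReal
    (fun f g => ?_), fun f g => hv f g⟩
  · exact (hv (f + f') g).unique (((hv f g).add_right (hv f' g) (hloc f) (hloc f')).congr
      (ae_eq_refl _) (Lp.coeFn_add f f').symm)
  · exact (hv (c • f) g).unique (((hv f g).smul_right c).congr (ae_eq_refl _)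
      (Lp.coeFn_smul c f).symm)
  · exact (hv f (g + g')).unique (((hv f g).add_left (hv f g') (hloc g) (hloc g')).congr
      (Lp.coeFn_add g g').symm (ae_eq_refl _))
  · exact (hv f (c • g)).unique (((hv f g).smul_left c).congr (Lp.coeFn_smul c g).symm
      (ae_eq_refl _))
  · rw [LinearMap.mk₂_apply, mul_assoc]
    refine norm_le_of_enorm_le h.ne_top (by positivity) ?_
    refine (h.haarForm (Lp.memLp g) (Lp.memLp f)).2.trans (le_of_eq ?_)
    rw [eLpNorm_coe_eq_ofReal_norm, eLpNorm_coe_eq_ofReal_norm, ← ENNReal.ofReal_mul (norm_nonneg _), mul_comm ‖f‖]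

/-- The operator on `L²`. -/
lemma HasLpBound.exists_memLp_two (h : HasLpBound M 2 2 C) {f : (Fin n → ℝ) → ℂ}
    (hf : MemLp f 2 volume) : ∃ F : (Fin n → ℝ) → ℂ, MemLp F 2 volume ∧
      ∀ g, MemLp g 2 volume → HaarForm M g f (bracket g F) := by
  obtain ⟨Φ, hΦ⟩ := h.exists_clm
  obtain ⟨F, hF⟩ := exists_pairing_two_eq (Φ (hf.toLp f))
  refine ⟨F, Lp.memLp F, fun g hg => ?_⟩
  have := hΦ (hf.toLp f) (hg.toLp g)
  rw [← hF, pairing_apply, bracket_congr (MemLp.coeFn_toLp hg) (ae_eq_refl _)] at this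
  exact this.congr (MemLp.coeFn_toLp hg) (MemLp.coeFn_toLp hf)

/-- The operator on `L^p`, for functions which are also square integrable. -/
lemma HasLpBound.exists_pairing_eq [Fact (1 ≤ p)] [Fact (1 ≤ q)] [hpq : p.HolderConjugate q]
    (hp : p ≠ ∞) (hq : q ≠ ∞) (h : HasLpBound M p q C) {C₂ : ℝ≥0∞} (h2 : HasLpBound M 2 2 C₂)
    {Φ : Lp ℂ p (volume : Measure (Fin n → ℝ)) →L[ℂ]
        Lp ℂ q (volume : Measure (Fin n → ℝ)) →L[ℂ] ℂ}
    (hΦ : ∀ (f : Lp ℂ p (volume : Measure (Fin n → ℝ))) (g : Lp ℂ q (volume : Measure (Fin n → ℝ))),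
      HaarForm M g f (Φ f g)) (f : Lp ℂ p (volume : Measure (Fin n → ℝ)))
    (hf2 : MemLp f 2 volume) : ∃ F, pairing n p q F = Φ f := by
  obtain ⟨F₂, hF₂, hF⟩ := h2.exists_memLp_two hf2
  -- On test functions the `L²` and the `L^p` form agree, so the converse of Hölder's inequality
  -- places the `L²` image in `L^p`.
  have hF₂p : MemLp F₂ p volume := by
    refine ⟨hF₂.1, (eLpNorm_le_of_forall_isTest (K := C * eLpNorm f p volume) hpq hp hF₂.1
      fun g hg => ?_).trans_lt ?_⟩
    · rw [(hF g (hg.memLp 2)).unique (h.haarForm (hg.memLp q) (Lp.memLp f)).1]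
      refine (h.haarForm (hg.memLp q) (Lp.memLp f)).2.trans (le_of_eq ?_)
      ring
    · have := h.ne_top
      have := Lp.eLpNorm_ne_top f
      finiteness
  refine ⟨hF₂p.toLp F₂, ?_⟩
  ext g
  -- Indicators of sets of finite measure lie in `L²` and in `L^q`; density extends the identity to
  -- all of `L^q`.
  refine Lp.induction hq (fun g => pairing n p q (hF₂p.toLp F₂) g = Φ f g) ?_ ?_ ?_ g
  · intro c s hs hμs
    rw [Lp.simpleFunc.coe_indicatorConst]
    have hae : (indicatorConstLp q hs hμs.ne c : (Fin n → ℝ) → ℂ) =ᵐ[volume] s.indicator fun _ => c :=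
      indicatorConstLp_coeFn
    have h1 := hF (s.indicator fun _ => c) (memLp_indicator_const 2 hs c (Or.inr hμs.ne))
    rw [pairing_apply, bracket_congr hae (MemLp.coeFn_toLp hF₂p)]
    exact h1.unique ((hΦ f _).congr hae (ae_eq_refl _))
  · intro u v hu hv _ h1 h2
    rw [map_add, map_add, h1, h2]
  · exact isClosed_eq (ContinuousLinearMap.continuous _) (ContinuousLinearMap.continuous _)

/-- No description of the dual of `L^q` is needed. The pairing is bounded below, so its range is
closed among the functionals on `L^q`; it contains the images of indicators, which are reached
through `L²`, hence all images by density. -/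
theorem HasLpBound.boundedOnLp [Fact (1 ≤ p)] [Fact (1 ≤ p.conjExponent)] (hp : p ≠ ∞)
    (hq : p.conjExponent ≠ ∞) (h : HasLpBound M p p.conjExponent C) {C₂ : ℝ≥0∞}
    (h2 : HasLpBound M 2 2 C₂) : BoundedOnLp (HaarForm M) p := by
  obtain ⟨Φ, hΦ⟩ := h.exists_clm
  set Ψ := pairing n p p.conjExponent with hΨ
  have hanti : AntilipschitzWith 1 Ψ := AddMonoidHomClass.antilipschitz_of_bound Ψ fun F => by
    simpa using norm_le_norm_pairing hp F
  have hclosed : IsClosed (Set.range Ψ) := hanti.isClosed_range Ψ.uniformContinuous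
  have hex : ∀ f, ∃ F, Ψ F = Φ f := by
    intro f
    refine Lp.induction hp (fun f => Φ f ∈ Set.range Ψ) ?_ ?_ ?_ f
    · intro c s hs hμs
      refine h.exists_pairing_eq hp hq h2 hΦ _ ?_
      rw [Lp.simpleFunc.coe_indicatorConst]
      exact (memLp_congr_ae indicatorConstLp_coeFn).2
        (memLp_indicator_const 2 hs c (Or.inr hμs.ne))
    · rintro u v hu hv _ ⟨F, hF⟩ ⟨G, hG⟩
      exact ⟨F + G, by rw [map_add, map_add, hF, hG]⟩
    · exact hclosed.preimage Φ.continuous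
  obtain ⟨S, hS⟩ := exists_linearMap_mem
    (LinearMap.eqLocus (Φ.toLinearMap.comp (LinearMap.fst ℂ _ _))
      (Ψ.toLinearMap.comp (LinearMap.snd ℂ _ _)))
    (fun f => by obtain ⟨F, hF⟩ := hex f; exact ⟨F, hF.symm⟩)
  replace hS : ∀ f, Φ f = Ψ (S f) := hS
  refine ⟨S.mkContinuous ‖Φ‖ fun f => ?_, fun g f => ?_⟩
  · refine (norm_le_norm_pairing (q := p.conjExponent) hp (S f)).trans ?_
    rw [← hΨ, ← hS]
    exact Φ.le_opNorm f
  · rw [LinearMap.mkContinuous_apply, ← pairing_apply, ← hΨ, ← hS]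
    exact hΦ f g

end

/-! ### The Hardy space -/

section

variable {w : (Fin n → ℤ) → ℝ≥0∞} {δ : ℝ} {M : ℤ → HaarIndex n → HaarIndex n → ℂ} {C K : ℝ≥0∞}

/-- Boundedness of the forms on `L^∞` and square integrable atoms. -/
def HasAtomBound (M : ℤ → HaarIndex n → HaarIndex n → ℂ) (K : ℝ≥0∞) : Prop :=
  ∀ (i : ℤ) (k : Fin n → ℤ) (g f : (Fin n → ℝ) → ℂ), MemLp g ∞ volume → IsSquareAtom i k f →
    ∀ J : Finset ℤ, ∑ j ∈ J, ‖scaleForm M j g f‖ₑ ≤ K * (eLpNorm g ∞ volume *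
      (volume (dyadicCube i k) ^ (1 / 2 : ℝ) * eLpNorm f 2 volume))

lemma HasAtomBound.haarForm (hK : K ≠ ∞) (h : HasAtomBound M K) (hM : IsDominated w M)
    (hw : ∑' m, w m ≠ ∞) {i : ℤ} {k : Fin n → ℤ} {g f : (Fin n → ℝ) → ℂ} (hg : MemLp g ∞ volume)
    (hf : IsSquareAtom i k f) : HaarForm M g f (formValue M g f) ∧
      ‖formValue M g f‖ₑ ≤ K * (eLpNorm g ∞ volume *
        (volume (dyadicCube i k) ^ (1 / 2 : ℝ) * eLpNorm f 2 volume)) := by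
  refine haarForm_of_sum_le (summable_haarTerm (inferInstance : ENNReal.HolderConjugate 1 ∞) hM hw hg
    hf.memLp_one) ?_ (h i k g f hg hf)
  have := hg.2.ne
  have := hf.memLp.2.ne
  have := volume_dyadicCube_ne_top i k
  finiteness

lemma star_subset_closedBall (i : ℤ) (k : Fin n → ℤ) :
    ∃ R : ℕ, star i k ⊆ Metric.closedBall 0 (R : ℝ) := by
  choose R hR using fun l : Fin n → ℤ => dyadicCube_subset_closedBall i l
  refine ⟨(Finset.Icc (k - 1) (k + 1)).sup R, Set.iUnion₂_subset fun l hl => (hR l).trans ?_⟩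
  refine Metric.closedBall_subset_closedBall ?_
  exact_mod_cast Finset.le_sup (f := R) hl

lemma tendsto_scaleForm_trunc_left (hM : IsDominated w M) (hw : ∑' m, w m ≠ ∞) {i : ℤ}
    {k : Fin n → ℤ} {g f : (Fin n → ℝ) → ℂ} (hg : MemLp g ∞ volume) (hf : IsSquareAtom i k f)
    (j : ℤ) : Filter.Tendsto (fun R => scaleForm M j (trunc R g) f) Filter.atTop
      (nhds (scaleForm M j g f)) := by
  refine (tendsto_scaleForm_trunc (inferInstance : ENNReal.HolderConjugate 1 ∞) hM hw hg
    hf.memLp_one j).congr' ?_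
  obtain ⟨R₀, h₀⟩ := dyadicCube_subset_closedBall i k
  filter_upwards [Filter.eventually_ge_atTop R₀] with R hR
  refine scaleForm_congr M j (ae_eq_refl _) ?_
  filter_upwards [hf.eq_zero] with x hx
  by_cases hxQ : x ∈ dyadicCube i k
  · exact Set.indicator_of_mem
      (Metric.closedBall_subset_closedBall (by exact_mod_cast hR) (h₀ hxQ)) f
  · rw [trunc, hx hxQ]
    exact Set.indicator_apply_eq_zero.2 fun _ => hx hxQ

/-- Continuity of the form under truncation of the bounded function. -/
lemma tendsto_formValue_trunc (hδ : 0 < δ) (hm : moment w δ ≠ ∞) (hK : K ≠ ∞)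
    (h : HasAtomBound M K) (hM : IsDominated w M) {i : ℤ} {k : Fin n → ℤ}
    {g f : (Fin n → ℝ) → ℂ} (hg : MemLp g ∞ volume) (hf : IsSquareAtom i k f) :
    Filter.Tendsto (fun R => formValue M (trunc R g) f) Filter.atTop (nhds (formValue M g f)) := by
  have hw : ∑' m, w m ≠ ∞ := ne_top_of_le_ne_top hm (tsum_weight_le_moment w hδ)
  have hr : (1 - rate δ)⁻¹ ≠ ∞ := by
    rw [ENNReal.inv_ne_top, ne_eq, tsub_eq_zero_iff_le, not_le]
    exact rate_lt_one hδ
  set D := 4 ^ n * moment w δ * (eLpNorm g ∞ volume * eLpNorm f 1 volume) with hD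
  have hDt : D ≠ ∞ := by
    have := hg.2.ne
    have := hf.memLp_one.2.ne
    finiteness
  -- Once the ball contains the neighbourhood of the atom's cube, the removed part of `g` vanishes
  -- there. The far estimate then dominates all scales, uniformly in `R`.
  set B : ℤ → ℝ≥0∞ := fun j => if j < i then 0 else D * rate δ ^ (j - i).toNat with hB
  have hBsum : ∑' j, B j ≠ ∞ := by
    rw [← (Equiv.addLeft i).tsum_eq, ← Nat.cast_injective.tsum_eq (g := fun d : ℕ => (d : ℤ))]
    · have : ∀ d : ℕ, B ((Equiv.addLeft i) (d : ℤ)) = D * rate δ ^ d := fun d => by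
        simp only [hB, Equiv.coe_addLeft]
        rw [if_neg (by omega), add_sub_cancel_left, Int.toNat_natCast]
      rw [tsum_congr this, ENNReal.tsum_mul_left, ENNReal.tsum_geometric]
      finiteness
    · intro d hd
      by_contra hd'
      have hd0 : d < 0 := by
        by_contra! h0
        exact hd' ⟨d.toNat, by simp [h0]⟩
      refine hd ?_
      simp only [hB, Equiv.coe_addLeft]
      rw [if_pos (by omega)]
  have htr : ∀ R : ℕ, MemLp (trunc R g) ∞ volume := fun R => memLp_trunc hg R
  set d : ℕ → (Fin n → ℝ) → ℂ := fun R => (Metric.closedBall 0 (R : ℝ))ᶜ.indicator g with hd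
  have hdm : ∀ R, MemLp (d R) ∞ volume := fun R =>
    hg.indicator Metric.isClosed_closedBall.measurableSet.compl
  have hsplit : ∀ R j, scaleForm M j g f = scaleForm M j (trunc R g) f + scaleForm M j (d R) f := by
    intro R j
    rw [← scaleForm_add_left (inferInstance : ENNReal.HolderConjugate 1 ∞) hM hw (htr R) (hdm R)
      hf.memLp_one, trunc, hd, Set.indicator_self_add_compl]
  have hval : ∀ R, formValue M g f = formValue M (trunc R g) f + formValue M (d R) f := by
    intro R
    have h1 := (h.haarForm hK hM hw (htr R) hf).1.2
    have h2 := (h.haarForm hK hM hw (hdm R) hf).1.2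
    refine ((h.haarForm hK hM hw hg hf).1.2).unique ((h1.add h2).congr_fun fun j => ?_)
    exact hsplit R j
  have hlim : Filter.Tendsto (fun R => formValue M (d R) f) Filter.atTop (nhds 0) := by
    have h0 : (0 : ℂ) = ∑' _ : ℤ, (0 : ℂ) := by simp
    rw [h0]
    refine tendsto_tsum_of_dominated_convergence (ENNReal.summable_toReal hBsum) (fun j => ?_) ?_
    · have := (tendsto_scaleForm_trunc_left hM hw hg hf j).const_sub (scaleForm M j g f)
      rw [sub_self] at this
      exact this.congr fun R => by rw [hsplit R j]; ring
    · obtain ⟨R₀, h₀⟩ := star_subset_closedBall i k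
      filter_upwards [Filter.eventually_ge_atTop R₀] with R hR j
      rw [← toReal_enorm]
      refine ENNReal.toReal_mono (ENNReal.ne_top_of_tsum_ne_top hBsum j) ?_
      simp only [hB]
      split_ifs with hj
      · rw [hf.scaleForm_eq_zero M hj, enorm_zero]
      · obtain ⟨r, rfl⟩ : ∃ r : ℕ, j = i + r := ⟨(j - i).toNat, by omega⟩
        rw [add_sub_cancel_left, Int.toNat_natCast]
        refine (hf.enorm_scaleForm_far_le hM hδ (hdm R) (Filter.Eventually.of_forall
          fun x hx => ?_) r).trans ?_
        · refine Set.indicator_of_notMem (Set.notMem_compl_iff.2 ?_) g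
          exact Metric.closedBall_subset_closedBall (by exact_mod_cast hR) (h₀ hx)
        · refine mul_le_mul_left (mul_le_mul_right (mul_le_mul_left ?_ _) _) _
          exact eLpNorm_indicator_le _
  have := hlim.const_sub (formValue M g f)
  rw [sub_zero] at this
  exact this.congr fun R => by rw [hval R]; ring

/-- The operator on square integrable atoms. -/
lemma exists_memLp_one_of_isSquareAtom (hδ : 0 < δ) (hm : moment w δ ≠ ∞) (hK : K ≠ ∞)
    (h : HasAtomBound M K) (h2 : HasLpBound M 2 2 C) (hM : IsDominated w M) {i : ℤ}
    {k : Fin n → ℤ} {f : (Fin n → ℝ) → ℂ} (hf : IsSquareAtom i k f) :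
    ∃ F : (Fin n → ℝ) → ℂ, MemLp F 1 volume ∧
      eLpNorm F 1 volume ≤ K * (volume (dyadicCube i k) ^ (1 / 2 : ℝ) * eLpNorm f 2 volume) ∧
      ∀ g, MemLp g ∞ volume → HaarForm M g f (bracket g F) := by
  have hw : ∑' m, w m ≠ ∞ := ne_top_of_le_ne_top hm (tsum_weight_le_moment w hδ)
  obtain ⟨F, hF2, hF⟩ := h2.exists_memLp_two hf.memLp
  have hF1 : eLpNorm F 1 volume ≤
      K * (volume (dyadicCube i k) ^ (1 / 2 : ℝ) * eLpNorm f 2 volume) := by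
    refine eLpNorm_le_of_forall_isTest (inferInstance : ENNReal.HolderConjugate 1 ∞) (by simp) hF2.1
      fun g hg => ?_
    have h1 := h.haarForm hK hM hw (hg.memLp ∞) hf
    rw [(hF g (hg.memLp 2)).unique h1.1]
    refine h1.2.trans (le_of_eq ?_)
    ring
  have hFm : MemLp F 1 volume := by
    refine ⟨hF2.1, hF1.trans_lt ?_⟩
    have := hf.memLp.2.ne
    have := volume_dyadicCube_ne_top i k
    finiteness
  refine ⟨F, hFm, hF1, fun g hg => ?_⟩
  have h1 := h.haarForm hK hM hw hg hf
  -- The representation is known only for square integrable `g`. Truncations of a bounded `g` are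
  -- square integrable, and both sides pass to the limit.
  suffices formValue M g f = bracket g F by rw [← this]; exact h1.1
  have htr2 : ∀ R : ℕ, MemLp (trunc R g) 2 volume := fun R => by
    obtain ⟨c, hc⟩ : ∃ c : ℝ, ∀ᵐ x, ‖g x‖ ≤ c := by
      refine ⟨(eLpNorm g ∞ volume).toReal, ?_⟩
      have := hg.2.ne
      rw [eLpNorm_exponent_top] at this ⊢
      filter_upwards [enorm_ae_le_eLpNormEssSup g volume] with x hx
      rw [← toReal_enorm]
      exact ENNReal.toReal_mono this hx
    exact memLp_indicator_of_bound Metric.isClosed_closedBall.measurableSet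
      measure_closedBall_lt_top.ne hg.1 hc 2
  have t1 := tendsto_formValue_trunc hδ hm hK h hM hg hf
  have e1 : ∀ R, formValue M (trunc R g) f = bracket (trunc R g) F := fun R =>
    (h.haarForm hK hM hw (memLp_trunc hg R) hf).1.unique (hF _ (htr2 R))
  simp only [e1] at t1
  refine tendsto_nhds_unique t1 ?_
  have h_int : Integrable fun x => g x * F x := hg.integrable_mul hFm
  refine tendsto_integral_of_dominated_convergence (fun x => ‖g x * F x‖)
    (fun R => ((memLp_trunc hg R).1.mul hFm.1)) h_int.norm (fun R => ?_) ?_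
  · refine Filter.Eventually.of_forall fun x => ?_
    rw [norm_mul, norm_mul]
    exact mul_le_mul_of_nonneg_right (norm_indicator_le_norm_self g x) (norm_nonneg _)
  · refine Filter.Eventually.of_forall fun x => tendsto_const_nhds.congr' ?_
    obtain ⟨R₀, h₀⟩ := exists_nat_ge ‖x‖
    filter_upwards [Filter.eventually_ge_atTop R₀] with R hR
    rw [trunc, Set.indicator_of_mem]
    rw [mem_closedBall_zero_iff]
    exact h₀.trans (by exact_mod_cast hR)

end

/-! ### Bounded atoms -/

lemma isSquareAtom_of_bound {f : (Fin n → ℝ) → ℂ} (hfm : AEStronglyMeasurable f volume) {i : ℤ}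
    {k : Fin n → ℤ} (h0 : ∀ᵐ x, x ∉ dyadicCube i k → f x = 0) {c : ℝ} (hc : ∀ᵐ x, ‖f x‖ ≤ c)
    (hi : ∫ x, f x = 0) : IsSquareAtom i k f ∧
      volume (dyadicCube i k) ^ (1 / 2 : ℝ) * eLpNorm f 2 volume ≤
        volume (dyadicCube i k) * ENNReal.ofReal c := by
  set V := volume (dyadicCube i k) with hV
  have hVt : V ≠ ∞ := volume_dyadicCube_ne_top i k
  have hle : eLpNorm f 2 volume ≤ V ^ (1 / 2 : ℝ) * ENNReal.ofReal c := by
    rw [eLpNorm_eq_restrict h0]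
    refine (eLpNorm_le_of_ae_bound (ae_restrict_of_ae hc)).trans (le_of_eq ?_)
    rw [Measure.restrict_apply_univ]
    norm_num [hV]
  refine ⟨⟨⟨hfm, hle.trans_lt (by finiteness)⟩, h0, hi⟩, ?_⟩
  calc _ ≤ V ^ (1 / 2 : ℝ) * (V ^ (1 / 2 : ℝ) * ENNReal.ofReal c) := mul_le_mul_right hle _
    _ = V ^ (1 / 2 + 1 / 2 : ℝ) * ENNReal.ofReal c := by
        rw [ENNReal.rpow_add_of_nonneg _ _ (by norm_num) (by norm_num), mul_assoc]
    _ = _ := by norm_num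

lemma volume_dyadicCube_ne_zero (i : ℤ) (k : Fin n → ℤ) : volume (dyadicCube i k) ≠ 0 := by
  rw [volume_dyadicCube]; exact two_zpow_ne_zero _

lemma exists_isSquareAtom_of_isDyadicAtom {a : Lp ℂ 1 (volume : Measure (Fin n → ℝ))}
    (ha : IsDyadicAtom a) : ∃ i k, IsSquareAtom i k a ∧
      volume (dyadicCube i k) ^ (1 / 2 : ℝ) * eLpNorm a 2 volume ≤ 1 := by
  obtain ⟨i, k, h0, hb, hi⟩ := ha
  obtain ⟨h1, h2⟩ := isSquareAtom_of_bound (Lp.aestronglyMeasurable a) h0 hb hi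
  refine ⟨i, k, h1, h2.trans (le_of_eq ?_)⟩
  have hV := volume_dyadicCube_ne_top i k
  have hV0 := volume_dyadicCube_ne_zero i k
  rw [Measure.real, ← ENNReal.toReal_inv, ENNReal.ofReal_toReal (by simpa using hV0),
    ENNReal.mul_inv_cancel hV0 hV]

section

variable {w : (Fin n → ℤ) → ℝ≥0∞} {δ : ℝ} {M : ℤ → HaarIndex n → HaarIndex n → ℂ} {C K : ℝ≥0∞}

/-! ### From the Hardy space to `L¹` -/

lemma exists_clm_scaleForm (hM : IsDominated w M) (hsymm : ∀ m, w (-m) = w m)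
    (hw : ∑' m, w m ≠ ∞) (g : Lp ℂ ∞ (volume : Measure (Fin n → ℝ))) (j : ℤ) :
    ∃ φ : Lp ℂ 1 (volume : Measure (Fin n → ℝ)) →L[ℂ] ℂ,
      ∀ f : Lp ℂ 1 (volume : Measure (Fin n → ℝ)), φ f = scaleForm M j g f := by
  set D := 4 ^ n * (∑' m, w m) with hD
  have hDt : D ≠ ∞ := by finiteness
  refine ⟨LinearMap.mkContinuous
    { toFun := fun f => scaleForm M j g f
      map_add' := fun f f' => ?_
      map_smul' := fun c f => ?_ } (D.toReal * ‖g‖) fun f => ?_, fun f => rfl⟩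
  · simp only [← scaleForm_swapMatrix M]
    rw [← scaleForm_add_left (inferInstance : ENNReal.HolderConjugate ∞ 1)
      (isDominated_swapMatrix hM hsymm) hw (Lp.memLp f) (Lp.memLp f') (Lp.memLp g)]
    exact scaleForm_congr _ j (Lp.coeFn_add f f') (ae_eq_refl _)
  · simp only [← scaleForm_swapMatrix M, RingHom.id_apply, smul_eq_mul]
    rw [← scaleForm_smul_left]
    exact scaleForm_congr _ j (Lp.coeFn_smul c f) (ae_eq_refl _)
  · rw [mul_assoc]
    refine norm_le_of_enorm_le hDt (by positivity) ?_
    refine (enorm_scaleForm_le (inferInstance : ENNReal.HolderConjugate 1 ∞) hM (Lp.memLp g)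
      (Lp.memLp f) j).trans (le_of_eq ?_)
    rw [eLpNorm_coe_eq_ofReal_norm, eLpNorm_coe_eq_ofReal_norm, ← ENNReal.ofReal_mul (norm_nonneg _)]

/-- The double series over scales and atoms converges absolutely, by the uniform bound on atoms and
`∑ |c i| < ∞`. At a fixed scale the form is continuous on `L¹`, so summing over atoms first gives
the series for `f`; summing over scales first gives the pairings with the images of the atoms. -/
lemma exists_of_isAtomicDecomposition (hsymm : ∀ m, w (-m) = w m) (hδ : 0 < δ)
    (hm : moment w δ ≠ ∞) (hK : K ≠ ∞) (h : HasAtomBound M K) (h2 : HasLpBound M 2 2 C)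
    (hM : IsDominated w M) {f : Lp ℂ 1 (volume : Measure (Fin n → ℝ))} {c : ℕ → ℂ}
    {a : ℕ → Lp ℂ 1 (volume : Measure (Fin n → ℝ))} (hf : IsAtomicDecomposition f c a) :
    ∃ F : Lp ℂ 1 (volume : Measure (Fin n → ℝ)), ‖F‖ ≤ K.toReal * ∑' i, ‖c i‖ ∧
      ∀ g : Lp ℂ ∞ (volume : Measure (Fin n → ℝ)), HaarForm M g f (bracket g F) := by
  have hw : ∑' m, w m ≠ ∞ := ne_top_of_le_ne_top hm (tsum_weight_le_moment w hδ)
  obtain ⟨ha, hc, hsum⟩ := hf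
  have hatom : ∀ i, ∃ F : Lp ℂ 1 (volume : Measure (Fin n → ℝ)), ‖F‖ ≤ K.toReal ∧
      ∀ g : Lp ℂ ∞ (volume : Measure (Fin n → ℝ)), HaarForm M g (a i) (bracket g F) := by
    intro i
    obtain ⟨j, k, h1, h1'⟩ := exists_isSquareAtom_of_isDyadicAtom (ha i)
    obtain ⟨F, hF, hF1, hF2⟩ := exists_memLp_one_of_isSquareAtom hδ hm hK h h2 hM h1
    refine ⟨hF.toLp F, ?_, fun g => ?_⟩
    · rw [Lp.norm_toLp]
      refine ENNReal.toReal_mono hK (hF1.trans ?_)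
      exact mul_le_of_le_one_right' h1'
    · rw [bracket_congr (ae_eq_refl _) (MemLp.coeFn_toLp hF)]
      exact hF2 g (Lp.memLp g)
  choose F hF hFa using hatom
  have hle : ∀ i, ‖c i • F i‖ ≤ K.toReal * ‖c i‖ := fun i => by
    rw [norm_smul, mul_comm]
    exact mul_le_mul_of_nonneg_right (hF i) (norm_nonneg _)
  have hcK : Summable fun i => K.toReal * ‖c i‖ := hc.mul_left _
  have hFs : Summable fun i => c i • F i := Summable.of_norm_bounded hcK hle
  refine ⟨∑' i, c i • F i, ?_, fun g => ⟨summable_haarTerm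
    (inferInstance : ENNReal.HolderConjugate 1 ∞) hM hw (Lp.memLp g) (Lp.memLp f), ?_⟩⟩
  · rw [← tsum_mul_left]
    exact tsum_of_norm_bounded hcK.hasSum hle
  have hs : Summable fun r : ℤ × ℕ => c r.2 * scaleForm M r.1 g (a r.2) := by
    refine summable_of_tsum_enorm_ne_top (fun r => le_rfl) ?_
    rw [ENNReal.tsum_prod', ENNReal.tsum_comm]
    have hbound : ∀ i, ∑' j, ‖c i * scaleForm M j g (a i)‖ₑ ≤
        K * eLpNorm g ∞ volume * ‖c i‖ₑ := by
      intro i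
      obtain ⟨j, k, h1, h1'⟩ := exists_isSquareAtom_of_isDyadicAtom (ha i)
      simp only [enorm_mul, ENNReal.tsum_mul_left]
      rw [mul_comm]
      refine mul_le_mul_left ?_ _
      rw [ENNReal.tsum_eq_iSup_sum]
      refine iSup_le fun J => (h j k g (a i) (Lp.memLp g) h1 J).trans ?_
      exact mul_le_mul_right (mul_le_of_le_one_right' h1') _
    refine ne_top_of_le_ne_top ?_ (ENNReal.tsum_le_tsum hbound)
    rw [ENNReal.tsum_mul_left]
    have h1 : ∑' i, ‖c i‖ₑ ≠ ∞ := by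
      have := hc.tsum_ofReal_ne_top
      simpa only [ofReal_norm] using this
    have := Lp.eLpNorm_ne_top g
    finiteness
  have hj : ∀ j, HasSum (fun i => c i * scaleForm M j g (a i)) (scaleForm M j g f) := by
    intro j
    obtain ⟨φ, hφ⟩ := exists_clm_scaleForm hM hsymm hw g j
    have := φ.hasSum hsum
    have e : ∀ i, φ (c i • a i) = c i * scaleForm M j g (a i) := fun i => by
      rw [map_smul, hφ, smul_eq_mul]
    simpa only [Function.comp_def, e, hφ f] using this
  have h1 : HasSum (fun j => scaleForm M j g f) (∑' r : ℤ × ℕ, c r.2 * scaleForm M r.1 g (a r.2)) :=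
    hs.hasSum.prod_fiberwise hj
  have h2 : HasSum (fun i => c i * bracket g (F i))
      (∑' r : ℤ × ℕ, c r.2 * scaleForm M r.1 g (a r.2)) := by
    have hs' := (Equiv.prodComm ℕ ℤ).hasSum_iff.2 hs.hasSum
    refine hs'.prod_fiberwise fun i => ?_
    exact (hFa i g).2.mul_left (c i)
  have h3 : HasSum (fun i => c i * bracket g (F i)) (bracket g (∑' i, c i • F i : Lp ℂ 1 _)) := by
    have := ((pairing n 1 ∞).flip g).hasSum hFs.hasSum
    simpa only [ContinuousLinearMap.flip_apply, map_smul, smul_eq_mul, pairing_apply] using this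
  rw [h3.unique h2]
  exact h1

lemma eq_of_forall_bracket_eq {F F' : Lp ℂ 1 (volume : Measure (Fin n → ℝ))}
    (h : ∀ g : Lp ℂ ∞ (volume : Measure (Fin n → ℝ)), bracket g F = bracket g F') : F = F' := by
  have h0 : pairing n 1 ∞ (F - F') = 0 := by
    ext g
    rw [map_sub, sub_apply, pairing_apply, pairing_apply, h g, sub_self]
    rfl
  have h1 := norm_le_norm_pairing (q := ∞) (by simp) (F - F')
  rw [h0, norm_zero] at h1
  exact sub_eq_zero.1 (norm_le_zero_iff.1 h1)

/-- An integrable function is determined by its pairings with `L^∞`, so the image does not depend on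
the atomic decomposition and the infimum over all decompositions may be taken. -/
theorem boundedHardyToL1_haarForm (hsymm : ∀ m, w (-m) = w m) (hδ : 0 < δ)
    (hm : moment w δ ≠ ∞) (hK : K ≠ ∞) (h : HasAtomBound M K) (h2 : HasLpBound M 2 2 C)
    (hM : IsDominated w M) : BoundedHardyToL1 (HaarForm M) := by
  have hloc : ∀ f : Lp ℂ 1 (volume : Measure (Fin n → ℝ)), LocallyIntegrable f volume :=
    fun f => (Lp.memLp f).locallyIntegrable le_rfl
  let R : Submodule ℂ (dyadicHardy n × Lp ℂ 1 (volume : Measure (Fin n → ℝ))) :=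
    { carrier := {r | ∀ g : Lp ℂ ∞ (volume : Measure (Fin n → ℝ)),
        HaarForm M g r.1.1 (pairing n 1 ∞ r.2 g)}
      zero_mem' := fun g => by
        simp only [Prod.snd_zero, map_zero, zero_apply]
        exact (haarForm_zero_right M g).congr (ae_eq_refl _) (Lp.coeFn_zero _ _ _).symm
      add_mem' := fun {r r'} hr hr' g => by
        simp only [Prod.snd_add, map_add, add_apply]
        exact ((hr g).add_right (hr' g) (hloc _) (hloc _)).congr (ae_eq_refl _)
          (Lp.coeFn_add _ _).symm
      smul_mem' := fun c r hr g => by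
        simp only [Prod.smul_snd, map_smul, smul_apply, smul_eq_mul]
        exact ((hr g).smul_right c).congr (ae_eq_refl _) (Lp.coeFn_smul _ _).symm }
  obtain ⟨S, hS⟩ := exists_linearMap_mem R fun f => by
    obtain ⟨c, a, hf⟩ := f.2
    obtain ⟨F, -, hF⟩ := exists_of_isAtomicDecomposition hsymm hδ hm hK h h2 hM hf
    exact ⟨F, fun g => by rw [pairing_apply]; exact hF g⟩
  replace hS : ∀ (f : dyadicHardy n) (g : Lp ℂ ∞ (volume : Measure (Fin n → ℝ))),
      HaarForm M g f.1 (bracket g (S f)) := fun f g => by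
    rw [← pairing_apply]; exact hS f g
  -- The added `1` makes the constant positive, so that it can be divided out before passing to the
  -- infimum.
  refine ⟨S, K.toReal + 1, fun f => ?_, fun g f => hS f g⟩
  have hpos : 0 < K.toReal + 1 := by positivity
  rw [← div_le_iff₀' hpos]
  obtain ⟨c₀, a₀, hf₀⟩ := f.2
  refine le_csInf ⟨_, c₀, a₀, hf₀, rfl⟩ ?_
  rintro r ⟨c, a, hf, rfl⟩
  obtain ⟨F, hF, hFg⟩ := exists_of_isAtomicDecomposition hsymm hδ hm hK h h2 hM hf
  have : S f = F := eq_of_forall_bracket_eq fun g => (hS f g).unique (hFg g)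
  rw [div_le_iff₀' hpos, this]
  refine hF.trans (mul_le_mul_of_nonneg_right (by linarith) (tsum_nonneg fun i => norm_nonneg _))

end

/-! ### The orthants -/

/-- The index of the cube of side one at the origin in the orthant of the lattice point `l`. -/
def orthant (l : Fin n → ℤ) : Fin n → ℤ := fun a => if l a < 0 then -1 else 0

/-- The dyadic ancestors of a unit cube end up being those of the unit cube at the origin in the
same orthant. The latter thus serves as a common reference cube for the whole orthant. -/
lemma exists_cell_eq_orthant (l : Fin n → ℤ) :
    ∃ r, cell r l = orthant l ∧ cell r (orthant l) = orthant l := by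
  refine ⟨Finset.univ.sup fun a => (l a).natAbs, ?_, ?_⟩
  · funext a
    set r := Finset.univ.sup fun a => (l a).natAbs with hr
    have h1 : (l a).natAbs ≤ r := Finset.le_sup (f := fun a => (l a).natAbs) (Finset.mem_univ a)
    have h2 : (l a).natAbs < 2 ^ r := h1.trans_lt Nat.lt_two_pow_self
    have h3 : |l a| < 2 ^ r := by
      rw [Int.abs_eq_natAbs]; exact_mod_cast h2
    rw [abs_lt] at h3
    have hp : (0 : ℤ) < 2 ^ r := by positivity
    simp only [cell, orthant]
    split_ifs with h
    · rw [Int.ediv_eq_iff_of_pos hp]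
      constructor <;> linarith
    · exact Int.ediv_eq_zero_of_lt (by linarith) h3.2
  · funext a
    set r := Finset.univ.sup fun a => (l a).natAbs with hr
    have hp : (1 : ℤ) ≤ 2 ^ r := one_le_pow₀ (by norm_num)
    simp only [cell, orthant]
    split_ifs with h
    · rw [Int.ediv_eq_iff_of_pos (by linarith)]
      constructor <;> linarith
    · simp

lemma orthant_eq_of_cell_eq {i : ℕ} {l l' : Fin n → ℤ} (h : cell i l = cell i l') :
    orthant l = orthant l' := by
  have hp : (0 : ℤ) < 2 ^ i := by positivity
  have key : ∀ a, l a < 0 ↔ l' a < 0 := fun a => by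
    have h1 : l a / 2 ^ i = l' a / 2 ^ i := congrFun h a
    rw [← not_le, ← not_le, ← Int.ediv_nonneg_iff_of_pos hp, h1, Int.ediv_nonneg_iff_of_pos hp]
  funext a
  simp only [orthant, key a]

/-- The restriction to a cube of side one, corrected to have mean zero. -/
def corrected (l : Fin n → ℤ) (g : (Fin n → ℝ) → ℂ) : (Fin n → ℝ) → ℂ :=
  (dyadicCube 0 l).indicator g -
    (cellInt g 0 l) • (dyadicCube 0 (orthant l)).indicator (fun _ => (1 : ℂ))

lemma volume_dyadicCube_zero (l : Fin n → ℤ) : volume (dyadicCube 0 l) = 1 := by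
  rw [volume_dyadicCube]; simp

lemma memLp_indicator_dyadicCube (i : ℤ) (l : Fin n → ℤ) (p : ℝ≥0∞) :
    MemLp ((dyadicCube i l).indicator (fun _ => (1 : ℂ))) p volume :=
  memLp_indicator_const p (measurableSet_dyadicCube i l) 1 (Or.inr (volume_dyadicCube_ne_top i l))

section

variable {g g' : (Fin n → ℝ) → ℂ}

lemma exists_isSquareAtom_corrected (l : Fin n → ℤ) :
    ∃ r : ℕ, ∀ g : (Fin n → ℝ) → ℂ, MemLp g 2 volume →
      IsSquareAtom (0 - r) (orthant l) (corrected l g) := by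
  obtain ⟨r, h1, h2⟩ := exists_cell_eq_orthant l
  have hsub : ∀ {l'}, cell r l' = orthant l → dyadicCube 0 l' ⊆ dyadicCube (0 - r) (orthant l) := by
    intro l' hl' x hx
    rw [mem_dyadicCube, floorAt_sub, mem_dyadicCube.1 hx, hl']
  refine ⟨r, fun g hg => ⟨?_, ?_, ?_⟩⟩
  · exact (hg.indicator (measurableSet_dyadicCube 0 l)).sub
      ((memLp_indicator_dyadicCube 0 (orthant l) 2).const_smul _)
  · refine Filter.Eventually.of_forall fun x hx => ?_
    simp only [corrected, Pi.sub_apply, Pi.smul_apply]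
    rw [Set.indicator_of_notMem fun h => hx (hsub h1 h),
      Set.indicator_of_notMem fun h => hx (hsub h2 h)]
    simp
  · have i1 : Integrable ((dyadicCube 0 l).indicator g) :=
      (integrableOn_dyadicCube (hg.locallyIntegrable (by norm_num)) 0 l).integrable_indicator
        (measurableSet_dyadicCube 0 l)
    have i2 : Integrable ((dyadicCube 0 (orthant l)).indicator (fun _ => (1 : ℂ))) :=
      memLp_one_iff_integrable.1 (memLp_indicator_dyadicCube 0 (orthant l) 1)
    have e : ∫ x, corrected l g x = ∫ x, ((dyadicCube 0 l).indicator g x -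
        cellInt g 0 l * (dyadicCube 0 (orthant l)).indicator (fun _ => (1 : ℂ)) x) := rfl
    rw [e, integral_sub i1 (i2.const_mul _), integral_const_mul, integral_indicator (measurableSet_dyadicCube 0 l),
      integral_indicator (measurableSet_dyadicCube 0 _), setIntegral_const, Measure.real,
      volume_dyadicCube_zero]
    simp [cellInt]

lemma eLpNorm_corrected_le (hg : MemLp g 2 volume) (l : Fin n → ℤ) :
    eLpNorm (corrected l g) 2 volume ≤ 2 * eLpNorm g 2 volume := by
  have h1 : eLpNorm ((dyadicCube 0 l).indicator g) 2 volume ≤ eLpNorm g 2 volume :=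
    eLpNorm_indicator_le _
  have h2 : ‖cellInt g 0 l‖ₑ ≤ eLpNorm g 2 volume := by
    refine (enorm_cellInt_le g 0 l).trans ?_
    have := eLpNorm_one_le_of_support (i := 0) (k := l)
      (hg.1.indicator (measurableSet_dyadicCube 0 l))
      (Filter.Eventually.of_forall fun x hx => Set.indicator_of_notMem hx g)
    rw [volume_dyadicCube_zero, ENNReal.one_rpow, one_mul,
      eLpNorm_indicator_eq_eLpNorm_restrict (measurableSet_dyadicCube 0 l),
      eLpNorm_one_eq_lintegral_enorm] at this
    exact this.trans h1
  have h3 : eLpNorm ((dyadicCube 0 (orthant l)).indicator (fun _ => (1 : ℂ))) 2 volume ≤ 1 := by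
    refine (eLpNorm_indicator_const_le _ _).trans (le_of_eq ?_)
    rw [volume_dyadicCube_zero]; simp
  calc _ ≤ eLpNorm ((dyadicCube 0 l).indicator g) 2 volume + eLpNorm ((cellInt g 0 l) •
        (dyadicCube 0 (orthant l)).indicator (fun _ => (1 : ℂ))) 2 volume :=
        eLpNorm_sub_le (hg.indicator (measurableSet_dyadicCube 0 l)).1
          ((memLp_indicator_dyadicCube 0 (orthant l) 2).const_smul _).1 (by norm_num)
    _ ≤ eLpNorm g 2 volume + eLpNorm g 2 volume * 1 := by
        rw [eLpNorm_const_smul]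
        exact add_le_add h1 (mul_le_mul' h2 h3)
    _ = _ := by ring

lemma cellInt_congr (h : g =ᵐ[volume] g') (N : ℤ) (l : Fin n → ℤ) : cellInt g N l = cellInt g' N l :=
  setIntegral_congr_ae (measurableSet_dyadicCube N l) (by filter_upwards [h] with x hx _ using hx)

lemma corrected_congr (h : g =ᵐ[volume] g') (l : Fin n → ℤ) :
    corrected l g =ᵐ[volume] corrected l g' := by
  unfold corrected
  rw [cellInt_congr h]
  filter_upwards [h] with x hx
  simp only [Pi.sub_apply, Set.indicator, hx]

lemma corrected_add (hg : LocallyIntegrable g volume) (hg' : LocallyIntegrable g' volume)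
    (l : Fin n → ℤ) : corrected l (g + g') = corrected l g + corrected l g' := by
  have : cellInt (g + g') 0 l = cellInt g 0 l + cellInt g' 0 l :=
    integral_add (integrableOn_dyadicCube hg 0 l) (integrableOn_dyadicCube hg' 0 l)
  unfold corrected
  rw [this, Set.indicator_add', add_smul]
  abel

lemma corrected_smul (c : ℂ) (g : (Fin n → ℝ) → ℂ) (l : Fin n → ℤ) :
    corrected l (c • g) = c • corrected l g := by
  have : cellInt (c • g) 0 l = c * cellInt g 0 l := by
    simp only [cellInt, Pi.smul_apply, smul_eq_mul, integral_const_mul]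
  unfold corrected
  have e : (dyadicCube 0 l).indicator (c • g) = c • (dyadicCube 0 l).indicator g :=
    Set.indicator_const_smul (dyadicCube 0 l) c g
  rw [this, e, smul_sub, mul_smul]

end

/-! ### Oscillation -/

lemma integrable_mul_of_support {a F : (Fin n → ℝ) → ℂ} (ha : AEStronglyMeasurable a volume) {i : ℤ}
    {k : Fin n → ℤ} (h0 : ∀ᵐ x, x ∉ dyadicCube i k → a x = 0) {c : ℝ} (hc : ∀ᵐ x, ‖a x‖ ≤ c)
    (hF : LocallyIntegrable F volume) : Integrable fun x => a x * F x := by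
  have h : Integrable ((dyadicCube i k).indicator F) :=
    (integrableOn_dyadicCube hF i k).integrable_indicator (measurableSet_dyadicCube i k)
  refine (h.bdd_mul ha hc).congr ?_
  filter_upwards [h0] with x hx
  by_cases hxQ : x ∈ dyadicCube i k
  · simp only [Set.indicator_of_mem hxQ]
  · rw [hx hxQ]; simp

/-- The mean oscillations are controlled by the pairings with atoms. -/
lemma oscillation_le_of_forall_atom {F : (Fin n → ℝ) → ℂ} (hF : LocallyIntegrable F volume) {B : ℝ}
    (h : ∀ a : Lp ℂ 1 (volume : Measure (Fin n → ℝ)), IsDyadicAtom a → ‖bracket a F‖ ≤ B) (j : ℤ)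
    (k : Fin n → ℤ) : oscillation F j k ≤ 2 * B := by
  set Q := dyadicCube j k with hQ
  have hQm : MeasurableSet Q := measurableSet_dyadicCube j k
  set V := volume.real Q with hV
  have hV0 : 0 < V := ENNReal.toReal_pos (volume_dyadicCube_ne_zero j k) (volume_dyadicCube_ne_top j k)
  have hFQ : IntegrableOn F Q volume := integrableOn_dyadicCube hF j k
  have hconst : ∀ c : ℂ, IntegrableOn (fun _ : Fin n → ℝ => c) Q volume := fun c =>
    integrableOn_const (volume_dyadicCube_ne_top j k)
  set m := ⨍ y in Q, F y with hm
  set s : (Fin n → ℝ) → ℂ := fun x => conjSign (F x - m) with hs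
  have hsm : AEStronglyMeasurable s volume :=
    (measurable_conjSign.comp_aemeasurable
      (hF.aestronglyMeasurable.aemeasurable.sub_const m)).aestronglyMeasurable
  have hsQ : IntegrableOn s Q volume :=
    Integrable.mono (hconst 1) hsm.restrict
      (Filter.Eventually.of_forall fun x => by simpa using norm_conjSign_le _)
  set c := ⨍ y in Q, s y with hc
  have hcn : ‖c‖ ≤ 1 := by
    rw [hc, setAverage_eq, norm_smul, norm_inv, Real.norm_of_nonneg hV0.le, inv_mul_le_iff₀ hV0,
      mul_one]
    have := norm_setIntegral_le_of_norm_le_const (μ := volume) (s := Q) (f := s) (C := 1)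
      (volume_dyadicCube_ne_top j k).lt_top (fun x _ => norm_conjSign_le _)
    simpa using this
  have hmean : ∀ {u : (Fin n → ℝ) → ℂ}, IntegrableOn u Q volume →
      ∫ x in Q, (u x - ⨍ y in Q, u y) = 0 := by
    intro u hu
    rw [integral_sub hu (hconst _), setIntegral_const, setAverage_eq, ← hV, smul_inv_smul₀ hV0.ne',
      sub_self]
  have hsc : Integrable (fun x => s x - c) (volume.restrict Q) := Integrable.sub hsQ (hconst c)
  have hFm : Integrable (fun x => F x - m) (volume.restrict Q) := Integrable.sub hFQ (hconst m)
  -- The conjugate sign of `F - m`, made mean zero by subtracting its own mean. Since `‖s - c‖ ≤ 2`,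
  -- the factor `(2 V)⁻¹` makes it an atom and causes the `2` in the conclusion.
  set u : (Fin n → ℝ) → ℂ := Q.indicator fun x => (((2 * V)⁻¹ : ℝ) : ℂ) * (s x - c) with hu
  have hum : AEStronglyMeasurable u volume :=
    ((hsm.sub aestronglyMeasurable_const).const_mul _).indicator hQm
  have hub : ∀ x, ‖u x‖ ≤ V⁻¹ := by
    intro x
    refine (norm_indicator_le_norm_self _ x).trans ?_
    rw [norm_mul, Complex.norm_real, Real.norm_of_nonneg (by positivity), mul_inv]
    have h1 : ‖s x - c‖ ≤ 2 := (norm_sub_le _ _).trans (by linarith [norm_conjSign_le (F x - m)])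
    calc 2⁻¹ * V⁻¹ * ‖s x - c‖ ≤ 2⁻¹ * V⁻¹ * 2 := by gcongr
      _ = _ := by ring
  have hu1 : MemLp u 1 volume :=
    memLp_one_iff_integrable.2 (IntegrableOn.integrable_indicator (hsc.const_mul _) hQm)
  have hae := MemLp.coeFn_toLp hu1
  have hatom : IsDyadicAtom (hu1.toLp u) := by
    refine ⟨j, k, ?_, ?_, ?_⟩
    · filter_upwards [hae] with x hx hxQ
      rw [hx, hu, Set.indicator_of_notMem hxQ]
    · filter_upwards [hae] with x hx
      rw [hx]; exact hub x
    · rw [integral_congr_ae hae, hu, integral_indicator hQm, integral_const_mul, hmean hsQ, mul_zero]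
  have hkey : bracket u F = (((2 * V)⁻¹ * ∫ x in Q, ‖F x - m‖ : ℝ) : ℂ) := by
    have hsF : Integrable (fun x => s x * (F x - m)) (volume.restrict Q) :=
      hFm.bdd_mul hsm.restrict
        (Filter.Eventually.of_forall fun x => norm_conjSign_le _)
    have e1 : bracket u F = (((2 * V)⁻¹ : ℝ) : ℂ) * ∫ x in Q, (s x - c) * F x := by
      rw [bracket, ← integral_const_mul, ← integral_indicator hQm]
      refine integral_congr_ae (Filter.Eventually.of_forall fun x => ?_)
      by_cases hx : x ∈ Q
      · simp only [hu, Set.indicator_of_mem hx, mul_assoc]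
      · simp only [hu, Set.indicator_of_notMem hx, zero_mul]
    -- Both `s - c` and `F - m` integrate to zero over `Q`, so the subtracted mean can be moved from
    -- one factor to the other.
    have e2 : ∫ x in Q, (s x - c) * F x = ∫ x in Q, s x * (F x - m) := by
      have : ∀ x, (s x - c) * F x = (s x * (F x - m) + m * (s x - c)) - c * (F x - m) := fun x => by
        ring
      simp only [this]
      rw [integral_sub (f := fun x => s x * (F x - m) + m * (s x - c))
        (hsF.add (hsc.const_mul m)) (hFm.const_mul c),
        integral_add hsF (hsc.const_mul m), integral_const_mul, integral_const_mul,
        hmean hsQ, hmean hFQ]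
      simp
    rw [e1, e2]
    simp only [hs, conjSign_mul]
    rw [integral_complex_ofReal, ← Complex.ofReal_mul]
  have h1 := h _ hatom
  rw [bracket_congr hae (ae_eq_refl F), hkey, Complex.norm_real, Real.norm_of_nonneg] at h1
  · rw [oscillation, setAverage_eq, smul_eq_mul]
    rw [mul_inv, mul_assoc, inv_mul_le_iff₀ (by norm_num)] at h1
    exact h1
  · have : 0 ≤ ∫ x in Q, ‖F x - m‖ := integral_nonneg fun x => norm_nonneg _
    positivity

/-! ### From `L^∞` to the space of functions of bounded mean oscillation -/

section

variable {w : (Fin n → ℤ) → ℝ≥0∞} {M : ℤ → HaarIndex n → HaarIndex n → ℂ} {K : ℝ≥0∞}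
  {f : (Fin n → ℝ) → ℂ}

lemma HasAtomBound.haarForm_swap (hK : K ≠ ∞) (h : HasAtomBound (swapMatrix M) K)
    (hM : IsDominated w (swapMatrix M)) (hw : ∑' m, w m ≠ ∞) (hf : MemLp f ∞ volume) {i : ℤ}
    {k : Fin n → ℤ} {g : (Fin n → ℝ) → ℂ} (hg : IsSquareAtom i k g) :
    HaarForm M g f (formValue M g f) ∧ ‖formValue M g f‖ₑ ≤ K * (eLpNorm f ∞ volume *
      (volume (dyadicCube i k) ^ (1 / 2 : ℝ) * eLpNorm g 2 volume)) := by
  have h1 := h.haarForm hK hM hw hf hg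
  have e : formValue (swapMatrix M) f g = formValue M g f := by
    simp only [formValue, scaleForm_swapMatrix]
  rw [e] at h1
  exact ⟨h1.1.swap, h1.2⟩

/-- The local representing functions. -/
lemma exists_local_representation (hK : K ≠ ∞) (h : HasAtomBound (swapMatrix M) K)
    (hM : IsDominated w (swapMatrix M)) (hw : ∑' m, w m ≠ ∞) (hf : MemLp f ∞ volume)
    (l : Fin n → ℤ) : ∃ G : (Fin n → ℝ) → ℂ, MemLp G 2 volume ∧
      ∀ g, MemLp g 2 volume → HaarForm M (corrected l g) f (bracket g G) := by
  obtain ⟨r, hr⟩ := exists_isSquareAtom_corrected l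
  set D := K * (eLpNorm f ∞ volume * volume (dyadicCube (0 - r : ℤ) (orthant l)) ^ (1 / 2 : ℝ)) * 2
    with hD
  have hDt : D ≠ ∞ := by
    have := hf.2.ne
    have := volume_dyadicCube_ne_top (0 - r : ℤ) (orthant l)
    finiteness
  have hv : ∀ g, MemLp g 2 volume → HaarForm M (corrected l g) f (formValue M (corrected l g) f) :=
    fun g hg => (h.haarForm_swap hK hM hw hf (hr g hg)).1
  have hloc : ∀ {g : (Fin n → ℝ) → ℂ}, MemLp g 2 volume → LocallyIntegrable g volume :=
    fun hg => hg.locallyIntegrable (by norm_num)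
  -- The corrected restriction of `g` is a square integrable atom on a cube which depends on `l`
  -- only. The functional is therefore bounded on `L²`, and Riesz' theorem applies.
  obtain ⟨F, hF⟩ := exists_pairing_two_eq (LinearMap.mkContinuous
    { toFun := fun g : Lp ℂ 2 (volume : Measure (Fin n → ℝ)) => formValue M (corrected l g) f
      map_add' := fun g g' => by
        refine (hv _ (Lp.memLp (g + g'))).unique (((hv g (Lp.memLp g)).add_left
          (hv g' (Lp.memLp g')) (hloc (hr g (Lp.memLp g)).memLp)
          (hloc (hr g' (Lp.memLp g')).memLp)).congr ?_ (ae_eq_refl _))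
        rw [← corrected_add (hloc (Lp.memLp g)) (hloc (Lp.memLp g'))]
        exact corrected_congr (Lp.coeFn_add g g').symm l
      map_smul' := fun c g => by
        refine (hv _ (Lp.memLp (c • g))).unique (((hv g (Lp.memLp g)).smul_left c).congr ?_
          (ae_eq_refl _))
        rw [← corrected_smul]
        exact corrected_congr (Lp.coeFn_smul c g).symm l } D.toReal fun g => by
    refine norm_le_of_enorm_le hDt (norm_nonneg _) ?_
    refine (h.haarForm_swap hK hM hw hf (hr g (Lp.memLp g))).2.trans ?_
    rw [← eLpNorm_coe_eq_ofReal_norm]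
    calc _ ≤ K * (eLpNorm f ∞ volume * (volume (dyadicCube (0 - r : ℤ) (orthant l)) ^ (1 / 2 : ℝ) *
          (2 * eLpNorm g 2 volume))) := by
          refine mul_le_mul_right (mul_le_mul_right (mul_le_mul_right ?_ _) _) _
          exact eLpNorm_corrected_le (Lp.memLp g) l
      _ = _ := by rw [hD]; ring)
  refine ⟨F, Lp.memLp F, fun g hg => ?_⟩
  have e : bracket g F = formValue M (corrected l (hg.toLp g)) f := by
    rw [← bracket_congr (MemLp.coeFn_toLp hg) (ae_eq_refl _), ← pairing_apply, hF]
    rfl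
  rw [e]
  exact (hv _ (Lp.memLp _)).congr (corrected_congr (MemLp.coeFn_toLp hg) l) (ae_eq_refl _)

lemma HaarForm.sum_left {ι : Type*} (s : Finset ι) {u : ι → (Fin n → ℝ) → ℂ} {z : ι → ℂ}
    (hu : ∀ l ∈ s, LocallyIntegrable (u l) volume) (h : ∀ l ∈ s, HaarForm M (u l) f (z l)) :
    HaarForm M (∑ l ∈ s, u l) f (∑ l ∈ s, z l) := by
  classical
  induction s using Finset.induction_on with
  | empty => simpa using haarForm_zero_left M f
  | insert a s ha ih =>
    rw [Finset.sum_insert ha, Finset.sum_insert ha]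
    refine (h a (Finset.mem_insert_self a s)).add_left
      (ih (fun l hl => hu l (Finset.mem_insert_of_mem hl))
        fun l hl => h l (Finset.mem_insert_of_mem hl)) (hu a (Finset.mem_insert_self a s)) ?_
    have := locallyIntegrable_finsetSum' s fun l hl => hu l (Finset.mem_insert_of_mem hl)
    exact this

/-- A dyadic cube lies in a single unit cube or is a union of unit cubes with a common ancestor; in
either case one orthant contains it. -/
lemma exists_finset_floorAt (i : ℤ) (k : Fin n → ℤ) : ∃ (s : Finset (Fin n → ℤ)) (κ : Fin n → ℤ),
    (∀ x ∈ dyadicCube i k, floorAt 0 x ∈ s) ∧ ∀ l ∈ s, orthant l = κ := by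
  rcases le_total 0 i with hi | hi
  · obtain ⟨d, rfl⟩ := Int.eq_ofNat_of_zero_le hi
    refine ⟨{cell d k}, orthant (cell d k), fun x hx => ?_, fun l hl => ?_⟩
    · rw [Finset.mem_singleton, ← mem_dyadicCube.1 hx, ← floorAt_sub, sub_self]
    · rw [Finset.mem_singleton.1 hl]
  · obtain ⟨d, hd⟩ := Int.exists_eq_neg_ofNat hi
    by_cases hb : (block d k).Nonempty
    · obtain ⟨l₀, hl₀⟩ := hb
      refine ⟨block d k, orthant l₀, fun x hx => ?_, fun l hl => ?_⟩
      · rw [mem_block, ← floorAt_sub, zero_sub, ← hd]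
        exact mem_dyadicCube.1 hx
      · exact orthant_eq_of_cell_eq (i := d) (by rw [mem_block.1 hl, mem_block.1 hl₀])
    · refine ⟨block d k, 0, fun x hx => ?_, fun l hl => absurd ⟨l, hl⟩ hb⟩
      rw [mem_block, ← floorAt_sub, zero_sub, ← hd]
      exact mem_dyadicCube.1 hx

/-- The image of a bounded function. -/
lemma exists_locallyIntegrable_representation (hK : K ≠ ∞) (h : HasAtomBound (swapMatrix M) K)
    (hM : IsDominated w (swapMatrix M)) (hw : ∑' m, w m ≠ ∞) (hf : MemLp f ∞ volume) :
    ∃ F : (Fin n → ℝ) → ℂ, LocallyIntegrable F volume ∧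
      ∀ i k g, IsSquareAtom i k g → HaarForm M g f (bracket g F) := by
  choose G hG hGg using exists_local_representation hK h hM hw hf
  -- On each unit cube the representing function of that cube is taken. Within an orthant all of
  -- them are normalized by the same reference cube, so they fit together without further constants.
  set F : (Fin n → ℝ) → ℂ := fun x => G (floorAt 0 x) x with hFdef
  have hFG : ∀ l, Set.EqOn (G l) F (dyadicCube 0 l) := fun l x hx => by
    rw [hFdef]
    simp only [mem_dyadicCube.1 hx]
  have hloc : ∀ {g : (Fin n → ℝ) → ℂ}, MemLp g 2 volume → LocallyIntegrable g volume :=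
    fun hg => hg.locallyIntegrable (by norm_num)
  refine ⟨F, ?_, fun i k g hg => ?_⟩
  · rw [locallyIntegrable_iff]
    intro S hS
    obtain ⟨R, hR⟩ := hS.isBounded.subset_closedBall 0
    set s := Finset.Icc (fun _ : Fin n => ⌊(2 : ℝ) ^ (0 : ℤ) * (-R)⌋) (fun _ => ⌊(2 : ℝ) ^ (0 : ℤ) * R⌋)
    have hsub : S ⊆ ⋃ l ∈ s, dyadicCube 0 l := by
      intro x hx
      have hxR := hR hx
      rw [mem_closedBall_zero_iff] at hxR
      have hb a : -R ≤ x a ∧ x a ≤ R := abs_le.1 ((norm_le_pi_norm x a).trans hxR)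
      refine Set.mem_iUnion₂.2 ⟨floorAt 0 x, Finset.mem_Icc.2 ⟨fun a => ?_, fun a => ?_⟩,
        mem_dyadicCube.2 rfl⟩
      · exact Int.floor_mono (mul_le_mul_of_nonneg_left (hb a).1 (by norm_num))
      · exact Int.floor_mono (mul_le_mul_of_nonneg_left (hb a).2 (by norm_num))
    refine IntegrableOn.mono_set ?_ hsub
    rw [integrableOn_finset_iUnion]
    exact fun l _ => (integrableOn_dyadicCube (hloc (hG l)) 0 l).congr_fun (hFG l)
      (measurableSet_dyadicCube 0 l)
  · obtain ⟨s, κ, hs, hκ⟩ := exists_finset_floorAt i k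
    set u : (Fin n → ℤ) → (Fin n → ℝ) → ℂ := fun l => (dyadicCube 0 l).indicator g with hu
    have hu2 : ∀ l, MemLp (u l) 2 volume := fun l => hg.memLp.indicator (measurableSet_dyadicCube 0 l)
    have hsum : ∀ᵐ x, g x = ∑ l ∈ s, u l x := by
      filter_upwards [hg.eq_zero] with x hx
      by_cases hxs : floorAt 0 x ∈ s
      · rw [Finset.sum_eq_single_of_mem _ hxs fun l _ hl => ?_]
        · simp only [hu]
          rw [Set.indicator_of_mem (mem_dyadicCube.2 rfl)]
        · exact Set.indicator_of_notMem (fun hx' => hl (mem_dyadicCube.1 hx').symm) g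
      · have hg0 : g x = 0 := hx fun hxQ => hxs (hs x hxQ)
        rw [hg0, Finset.sum_eq_zero fun l _ => Set.indicator_apply_eq_zero.2 fun _ => hg0]
    have hcorr : ∀ l, corrected l (u l) = corrected l g := by
      intro l
      have h1 : cellInt (u l) 0 l = cellInt g 0 l :=
        setIntegral_congr_fun (measurableSet_dyadicCube 0 l) fun x hx => Set.indicator_of_mem hx g
      rw [corrected, h1, corrected]
      simp only [hu, Set.indicator_indicator, Set.inter_self]
    have hlc : ∀ l, LocallyIntegrable (corrected l g) volume := fun l => by
      obtain ⟨r, hr⟩ := exists_isSquareAtom_corrected l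
      exact hloc (hr g hg.memLp).memLp
    have hform := HaarForm.sum_left (M := M) (f := f) s (u := fun l => corrected l g)
      (z := fun l => bracket (u l) (G l)) (fun l _ => hlc l) fun l _ => by
        have := hGg l (u l) (hu2 l)
        rwa [hcorr] at this
    have h_int : ∀ l, Integrable (u l) := fun l =>
      (integrableOn_dyadicCube (hloc hg.memLp) 0 l).integrable_indicator
        (measurableSet_dyadicCube 0 l)
    -- The atom lives in one orthant, so all corrections are multiples of one indicator; they cancel
    -- by the mean zero of `g`.
    have hzero : ∑ l ∈ s, cellInt g 0 l = 0 := by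
      rw [← hg.integral_eq_zero, integral_congr_ae hsum, integral_finsetSum s fun l _ => h_int l]
      exact Finset.sum_congr rfl fun l _ =>
        (integral_indicator (measurableSet_dyadicCube 0 l)).symm
    have hg' : ∑ l ∈ s, corrected l g =ᵐ[volume] g := by
      filter_upwards [hsum] with x hx
      have e : (∑ l ∈ s, corrected l g) x = ∑ l ∈ s, u l x -
          (∑ l ∈ s, cellInt g 0 l) * (dyadicCube 0 κ).indicator (fun _ => (1 : ℂ)) x := by
        rw [Finset.sum_apply, Finset.sum_mul, ← Finset.sum_sub_distrib]
        refine Finset.sum_congr rfl fun l hl => ?_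
        rw [corrected, hκ l hl]
        rfl
      rw [e, hzero, zero_mul, sub_zero, hx]
    have hbr : ∑ l ∈ s, bracket (u l) (G l) = bracket g F := by
      have hi : ∀ l, Integrable fun x => u l x * G l x := fun l => (hu2 l).integrable_mul (hG l)
      simp only [bracket]
      rw [← integral_finsetSum s fun l _ => hi l]
      refine integral_congr_ae ?_
      filter_upwards [hsum] with x hx
      rw [hx, Finset.sum_mul]
      refine Finset.sum_congr rfl fun l _ => ?_
      by_cases hxl : x ∈ dyadicCube 0 l
      · rw [hFG l hxl]
      · simp only [hu, Set.indicator_of_notMem hxl, zero_mul]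
    rw [← hbr]
    exact hform.congr hg' (ae_eq_refl _)

lemma integrable_mul_of_isDyadicAtom {a : Lp ℂ 1 (volume : Measure (Fin n → ℝ))}
    (ha : IsDyadicAtom a) {F : (Fin n → ℝ) → ℂ} (hF : LocallyIntegrable F volume) :
    Integrable fun x => a x * F x := by
  obtain ⟨i, k, h0, hb, -⟩ := ha
  exact integrable_mul_of_support (Lp.aestronglyMeasurable a) h0 hb hF

/-- Dual to the estimate on atoms, for the transposed matrices. Pairings with atoms control the
oscillation of any representing function, so the bound does not depend on the linear selection made.
-/
theorem boundedLinftyToBMO_haarForm (hK : K ≠ ∞) (h : HasAtomBound (swapMatrix M) K)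
    (hM : IsDominated w (swapMatrix M)) (hw : ∑' m, w m ≠ ∞) :
    BoundedLinftyToBMO (HaarForm M) := by
  have hloc : ∀ f : Lp ℂ ∞ (volume : Measure (Fin n → ℝ)), LocallyIntegrable f volume :=
    fun f => (Lp.memLp f).locallyIntegrable le_top
  have hosc : ∀ (f : Lp ℂ ∞ (volume : Measure (Fin n → ℝ))) {F : (Fin n → ℝ) → ℂ},
      LocallyIntegrable F volume →
      (∀ a : Lp ℂ 1 (volume : Measure (Fin n → ℝ)), IsDyadicAtom a → HaarForm M a f (bracket a F)) →
      ∀ j k, oscillation F j k ≤ 2 * K.toReal * ‖f‖ := by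
    intro f F hF hFa j k
    rw [mul_assoc]
    refine oscillation_le_of_forall_atom hF (fun a ha => ?_) j k
    obtain ⟨i, l, h1, h1'⟩ := exists_isSquareAtom_of_isDyadicAtom ha
    obtain ⟨h2, h3⟩ := h.haarForm_swap hK hM hw (Lp.memLp f) h1
    rw [(hFa a ha).unique h2]
    refine norm_le_of_enorm_le hK (norm_nonneg _) (h3.trans ?_)
    rw [eLpNorm_coe_eq_ofReal_norm]
    exact mul_le_mul_right (mul_le_of_le_one_right' h1') _
  let R : Submodule ℂ (Lp ℂ ∞ (volume : Measure (Fin n → ℝ)) × dyadicBMO n) :=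
    { carrier := {r | ∀ a : Lp ℂ 1 (volume : Measure (Fin n → ℝ)), IsDyadicAtom a →
        HaarForm M a r.1 (bracket a r.2.1)}
      zero_mem' := fun a ha => by
        have e : bracket a ((0 : Lp ℂ ∞ (volume : Measure (Fin n → ℝ)) × dyadicBMO n).2.1) = 0 := by
          refine (bracket_congr (ae_eq_refl _) AEEqFun.coeFn_zero).trans ?_
          simp [bracket]
        rw [e]
        exact (haarForm_zero_right M a).congr (ae_eq_refl _) (Lp.coeFn_zero _ _ _).symm
      add_mem' := fun {r r'} hr hr' a ha => by
        have e : bracket a ((r + r').2.1) = bracket a r.2.1 + bracket a r'.2.1 := by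
          refine (bracket_congr (ae_eq_refl _) (AEEqFun.coeFn_add r.2.1 r'.2.1)).trans ?_
          simp only [bracket, Pi.add_apply, mul_add]
          exact integral_add (integrable_mul_of_isDyadicAtom ha r.2.2.1)
            (integrable_mul_of_isDyadicAtom ha r'.2.2.1)
        rw [e]
        exact ((hr a ha).add_right (hr' a ha) (hloc _) (hloc _)).congr (ae_eq_refl _)
          (Lp.coeFn_add _ _).symm
      smul_mem' := fun c r hr a ha => by
        have e : bracket a ((c • r).2.1) = c * bracket a r.2.1 := by
          refine (bracket_congr (ae_eq_refl _) (AEEqFun.coeFn_smul c r.2.1)).trans ?_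
          rw [bracket_comm, bracket_smul_left, bracket_comm]
        rw [e]
        exact ((hr a ha).smul_right c).congr (ae_eq_refl _) (Lp.coeFn_smul _ _).symm }
  have hex : ∀ f, ∃ F, (f, F) ∈ R := fun f => by
    obtain ⟨F, hF, hFg⟩ := exists_locallyIntegrable_representation hK h hM hw (Lp.memLp f)
    have hae := AEEqFun.coeFn_mk F hF.aestronglyMeasurable
    have hatom : ∀ a : Lp ℂ 1 (volume : Measure (Fin n → ℝ)), IsDyadicAtom a →
        HaarForm M a f (bracket a F) := fun a ha => by
      obtain ⟨i, l, h1, -⟩ := exists_isSquareAtom_of_isDyadicAtom ha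
      exact hFg i l a h1
    have hmem : AEEqFun.mk F hF.aestronglyMeasurable ∈ dyadicBMO n := by
      refine ⟨hF.congr hae.symm, 2 * K.toReal * ‖f‖, fun j k => ?_⟩
      rw [oscillation_congr hae]
      exact hosc f hF hatom j k
    refine ⟨(⟨_, hmem⟩ : dyadicBMO n), fun a ha => ?_⟩
    have e : bracket a (AEEqFun.mk F hF.aestronglyMeasurable) = bracket a F :=
      bracket_congr (ae_eq_refl _) hae
    simp only [e]
    exact hatom a ha
  obtain ⟨S, hS⟩ := exists_linearMap_mem (V := Lp ℂ ∞ (volume : Measure (Fin n → ℝ)))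
    (W := dyadicBMO n) R hex
  refine ⟨S, 2 * K.toReal, fun f => ?_, fun g f hg => hS f g hg⟩
  exact ciSup_le fun r => hosc f (S f).2.1 (fun a ha => hS f a ha) r.1 r.2

end

/-! ### Boundedness of the operators -/

section

variable {w : (Fin n → ℤ) → ℝ≥0∞} {δ : ℝ} {M : ℤ → HaarIndex n → HaarIndex n → ℂ}

theorem isBounded_haarForm (hn : 1 ≤ n) (hsymm : ∀ m, w (-m) = w m) (hδ : 0 < δ) (hδ1 : δ ≤ 1)
    (hm : moment w δ ≠ ∞) (hM : IsAdmissible w M) : IsBounded (HaarForm M) := by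
  have hw : ∑' m, w m ≠ ∞ := ne_top_of_le_ne_top hm (tsum_weight_le_moment w hδ)
  have hLp : ∀ p q : ℝ≥0∞, p.HolderConjugate q → 1 < p → p ≠ ∞ → ∃ C, HasLpBound M p q C := by
    intro p q hpq hp1 hp
    obtain ⟨C, hC, h⟩ := exists_sum_enorm_scaleForm_le hn hsymm hδ hδ1 hm hpq hp1 hp
    exact ⟨C, hC, fun g f hg hf => summable_haarTerm hpq hM.dominated hw hg hf, h M hM⟩
  obtain ⟨C₂, h2⟩ := hLp 2 2 inferInstance (by norm_num) (by norm_num)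
  obtain ⟨K, hK, hA⟩ := exists_sum_enorm_scaleForm_atom_le hn hsymm hδ hδ1 hm
  refine ⟨fun p _ hp1 hp => ?_, ?_, ?_⟩
  · have hpq : p.HolderConjugate p.conjExponent := inferInstance
    have : Fact (1 ≤ p.conjExponent) := ⟨hpq.symm.one_le⟩
    obtain ⟨C, h⟩ := hLp p p.conjExponent hpq hp1 hp.ne
    exact h.boundedOnLp hp.ne (toReal_holderConjugate hpq hp1 hp.ne).2 h2
  · exact boundedHardyToL1_haarForm hsymm hδ hm hK (hA M hM) h2 hM.dominated
  · exact boundedLinftyToBMO_haarForm hK (hA _ (hM.swap hsymm)) (hM.swap hsymm).dominated hw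

end

lemma IsBounded.mono {B B' : ((Fin n → ℝ) → ℂ) → ((Fin n → ℝ) → ℂ) → ℂ → Prop}
    (hB : IsBounded B) (h : ∀ g f z, B g f z → B' g f z) : IsBounded B' := by
  obtain ⟨h1, ⟨S, K, hS, hS'⟩, ⟨S', K', hT, hT'⟩⟩ := hB
  refine ⟨fun p _ hp1 hp => ?_, ⟨S, K, hS, fun g f => h _ _ _ (hS' g f)⟩,
    ⟨S', K', hT, fun g f hg => h _ _ _ (hT' g f hg)⟩⟩
  obtain ⟨S, hS⟩ := h1 p hp1 hp
  exact ⟨S, fun g f => h _ _ _ (hS g f)⟩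

lemma AnnihilatesOne.mono {B B' : ((Fin n → ℝ) → ℂ) → ((Fin n → ℝ) → ℂ) → ℂ → Prop}
    (hB : AnnihilatesOne B) (h : ∀ g f z, B g f z → B' g f z) : AnnihilatesOne B' :=
  fun u hu => ⟨h _ _ _ (hB u hu).1, h _ _ _ (hB u hu).2⟩

/-! ### The constant function -/

lemma bracket_haarAt_one (j : ℤ) (q : HaarIndex n) :
    bracket (haarAt j q) (fun _ => 1) = amp n j * (volume.real (dyadicCube (j + 1) (0 : Fin n → ℤ)) *
      if q.1 = (fun _ => false) then (2 : ℂ) ^ n else 0) := by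
  have h1 : ∀ x, haarAt j q x * 1 = ∑ c ∈ block 1 q.2, amp n j * haarStep q.1 q.2 c *
      (dyadicCube (j + 1) c).indicator (fun _ => (1 : ℂ)) x := by
    intro x
    rw [mul_one, haarAt_eq_haarStep]
    by_cases hx : floorAt (j + 1) x ∈ block 1 q.2
    · rw [Finset.sum_eq_single_of_mem _ hx fun c _ hc => ?_]
      · rw [Set.indicator_of_mem (mem_dyadicCube.2 rfl), mul_one]
      · rw [Set.indicator_of_notMem fun h => hc (mem_dyadicCube.1 h).symm, mul_zero]
    · rw [haarStep_eq_zero fun h => hx (mem_block.2 h), mul_zero]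
      refine (Finset.sum_eq_zero fun c hc => ?_).symm
      rw [Set.indicator_of_notMem, mul_zero]
      intro h
      rw [mem_dyadicCube.1 h] at hx
      exact hx hc
  have h2 : ∀ c : Fin n → ℤ, Integrable ((dyadicCube (j + 1) c).indicator (fun _ => (1 : ℂ)))
      volume := fun c =>
    memLp_one_iff_integrable.1 (memLp_indicator_dyadicCube (j + 1) c 1)
  have hvol : ∀ c : Fin n → ℤ, volume.real (dyadicCube (j + 1) c) =
      volume.real (dyadicCube (j + 1) (0 : Fin n → ℤ)) := fun c => by
    rw [Measure.real, Measure.real, volume_dyadicCube, volume_dyadicCube]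
  simp only [bracket, h1]
  rw [integral_finsetSum _ fun c _ => (h2 c).const_mul _]
  simp only [integral_const_mul, integral_indicator (measurableSet_dyadicCube _ _), setIntegral_const,
    hvol]
  rw [← sum_haarStep q.1 q.2, Finset.mul_sum, Finset.mul_sum]
  refine Finset.sum_congr rfl fun c _ => ?_
  simp only [Complex.real_smul, mul_one]
  ring

/-- Wavelets are orthogonal to `1`, and all the `φ` of one scale have the same integral. Hence `1`
on the right produces the vanishing row sums, and `1` on the left meets only wavelets; each scale
contributes zero. -/
lemma annihilatesOne_haarForm {w : (Fin n → ℤ) → ℝ≥0∞} {M : ℤ → HaarIndex n → HaarIndex n → ℂ}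
    (hM : IsDominated w M) (hw : ∑' m, w m ≠ ∞) (hc : IsCancellingMatrix M) :
    AnnihilatesOne (HaarForm M) := by
  intro h hh
  have hone : MemLp (fun _ : Fin n → ℝ => (1 : ℂ)) ∞ volume := memLp_top_const 1
  have hs : ∀ j, Summable (haarTerm M j h fun _ => 1) :=
    summable_haarTerm (inferInstance : ENNReal.HolderConjugate ∞ 1) hM hw
      (memLp_one_iff_integrable.2 hh) hone
  constructor
  · have h0 : ∀ j, scaleForm M j h (fun _ => 1) = 0 := by
      intro j
      have hfib : ∀ q, HasSum (fun r => haarTerm M j h (fun _ => 1) (q, r)) 0 := by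
        intro q
        have hsq : Summable fun r => haarTerm M j h (fun _ => 1) (q, r) := (hs j).prod_factor q
        have hinj : Function.Injective fun l : Fin n → ℤ => ((fun _ => false, l) : HaarIndex n) :=
          fun l l' hl => (Prod.ext_iff.1 hl).2
        rw [hsq.hasSum_iff, ← hinj.tsum_eq]
        · simp only [haarTerm, bracket_haarAt_one, if_true]
          rw [tsum_mul_right, tsum_mul_left, hc.tsum_eq_zero, mul_zero, zero_mul]
        · intro r hr
          by_cases h1 : r.1 = fun _ => false
          · exact ⟨r.2, Prod.ext h1.symm rfl⟩
          · refine absurd ?_ hr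
            simp only [haarTerm, bracket_haarAt_one, if_neg h1, mul_zero]
      exact ((hs j).hasSum.prod_fiberwise hfib).unique hasSum_zero
    refine ⟨hs, ?_⟩
    have : (fun j => scaleForm M j h fun _ => 1) = fun _ => 0 := funext h0
    exact this ▸ hasSum_zero
  · have h0 : ∀ j q, haarTerm M j (fun _ => 1) h q = 0 := by
      intro j q
      rw [haarTerm, bracket_comm, bracket_haarAt_one]
      by_cases h1 : q.1.1 = fun _ => false
      · have : q.1 = (fun _ => false, q.1.2) := Prod.ext h1 rfl
        rw [this, hc.left_eq_zero]
        simp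
      · rw [if_neg h1]
        simp
    rw [haarForm_iff]
    have h1 : ∀ j, haarTerm M j (fun _ => 1) h = fun _ => 0 := fun j => funext (h0 j)
    simp only [scaleForm, h1, tsum_zero]
    exact ⟨fun _ => summable_zero, hasSum_zero⟩

/-! ### Extension of matrices by zero -/

section

variable {ι κ : Type} {e : ι → HaarIndex n} {e' : κ → HaarIndex n}

/-- The extension by zero of matrices which are indexed by a part of the Haar functions. -/
def extendMatrix (e : ι → HaarIndex n) (e' : κ → HaarIndex n) (m : ℤ → ι → κ → ℂ) :
    ℤ → HaarIndex n → HaarIndex n → ℂ := fun j q r =>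
  Function.extend (Prod.map e e') (fun a => m j a.1 a.2) 0 (q, r)

lemma extendMatrix_apply (he : Function.Injective e) (he' : Function.Injective e')
    (m : ℤ → ι → κ → ℂ) (j : ℤ) (a : ι) (b : κ) : extendMatrix e e' m j (e a) (e' b) = m j a b :=
  (he.prodMap he').extend_apply (fun a => m j a.1 a.2) 0 (a, b)

lemma extendMatrix_eq_zero {m : ℤ → ι → κ → ℂ} {j : ℤ} {q r : HaarIndex n}
    (h : (q, r) ∉ Set.range (Prod.map e e')) : extendMatrix e e' m j q r = 0 :=
  Function.extend_apply' _ _ _ h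

lemma isDominated_extendMatrix (he : Function.Injective e) (he' : Function.Injective e')
    {w : (Fin n → ℤ) → ℝ≥0∞} {m : ℤ → ι → κ → ℂ}
    (h : ∀ j a b, ‖m j a b‖ₑ ≤ w ((e a).2 - (e' b).2)) : IsDominated w (extendMatrix e e' m) := by
  intro j q r
  by_cases hqr : (q, r) ∈ Set.range (Prod.map e e')
  · obtain ⟨⟨a, b⟩, hab⟩ := hqr
    obtain ⟨rfl, rfl⟩ := Prod.mk.inj hab
    rw [extendMatrix_apply he he']
    exact h j a b
  · rw [extendMatrix_eq_zero hqr, enorm_zero]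
    exact zero_le

lemma HaarForm.seriesHasSum (he : Function.Injective e) (he' : Function.Injective e')
    {m : ℤ → ι → κ → ℂ} {g f : (Fin n → ℝ) → ℂ} {z : ℂ}
    (h : HaarForm (extendMatrix e e' m) g f z) :
    SeriesHasSum (fun j a => haarAt j (e a)) m (fun j b => haarAt j (e' b)) g f z := by
  have hinj := he.prodMap he'
  have hterm : ∀ j (a : ι × κ), bracket g (haarAt j (e a.1)) * m j a.1 a.2 *
      bracket (haarAt j (e' a.2)) f = haarTerm (extendMatrix e e' m) j g f (Prod.map e e' a) := by
    intro j a
    rw [haarTerm, Prod.map_fst, Prod.map_snd, extendMatrix_apply he he']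
  have hzero : ∀ j, ∀ q ∉ Set.range (Prod.map e e'),
      haarTerm (extendMatrix e e' m) j g f q = 0 := by
    intro j q hq
    rw [haarTerm, extendMatrix_eq_zero hq]
    simp
  unfold SeriesHasSum
  simp only [hterm]
  refine ⟨fun j => (hinj.summable_iff (hzero j)).2 (h.1 j), ?_⟩
  have : ∀ j, ∑' a : ι × κ, haarTerm (extendMatrix e e' m) j g f (Prod.map e e' a) =
      scaleForm (extendMatrix e e' m) j g f := fun j =>
    hinj.tsum_eq fun q hq => by
      by_contra hq'
      exact hq (hzero j q hq')
  simp only [this]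
  exact h.2

end

/-- The index of a wavelet among all the Haar functions. -/
def waveletIndex (q : Wavelet n × (Fin n → ℤ)) : HaarIndex n := (q.1.1, q.2)

/-- The index of a normalized indicator function among all the Haar functions. -/
def cubeIndex (l : Fin n → ℤ) : HaarIndex n := (fun _ => false, l)

lemma waveletIndex_injective : Function.Injective (waveletIndex (n := n)) := fun _ _ h =>
  Prod.ext (Subtype.ext (Prod.ext_iff.1 h).1) (Prod.ext_iff.1 h).2

lemma cubeIndex_injective : Function.Injective (cubeIndex (n := n)) := fun _ _ h =>
  (Prod.ext_iff.1 h).2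

lemma waveletIndex_ne (q : Wavelet n × (Fin n → ℤ)) (k : Fin n → ℤ) :
    waveletIndex q ≠ (fun _ => false, k) := fun h => q.1.2 (Prod.ext_iff.1 h).1

/-! ### The weight -/

/-- The weight `(1 + |m|) ^ (-n - s)`. -/
def decay (n : ℕ) (s : ℝ) (m : Fin n → ℤ) : ℝ≥0∞ :=
  ENNReal.ofReal ((1 + ‖m‖) ^ (-(n : ℝ) - s))

lemma decay_neg (s : ℝ) (m : Fin n → ℤ) : decay n s (-m) = decay n s m := by
  rw [decay, norm_neg, decay]

/-- Comparison with the integral of `(1 + ‖x‖) ^ (-n - s)`: on the unit cube of `m` one has `1 + ‖x‖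
≤ 2 (1 + ‖m‖)`. -/
lemma tsum_decay_ne_top {s : ℝ} (hs : 0 < s) : ∑' m, decay n s m ≠ ∞ := by
  set r : ℝ := n + s with hr
  have hr0 : 0 < r := by positivity
  have hfin : (∫⁻ x : Fin n → ℝ, ENNReal.ofReal ((1 + ‖x‖) ^ (-r))) < ∞ :=
    finite_integral_one_add_norm (by simp [hr, hs])
  have key : ∀ m : Fin n → ℤ, decay n s m ≤ ENNReal.ofReal (2 ^ r) *
      ∫⁻ x in dyadicCube 0 m, ENNReal.ofReal ((1 + ‖x‖) ^ (-r)) := by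
    intro m
    rw [← lintegral_const_mul' _ _ ENNReal.ofReal_ne_top]
    calc decay n s m = ∫⁻ _x in dyadicCube 0 m, decay n s m := by
          rw [setLIntegral_const, volume_dyadicCube_zero, mul_one]
      _ ≤ _ := by
          refine setLIntegral_mono' (measurableSet_dyadicCube 0 m) fun x hx => ?_
          rw [decay, ← ENNReal.ofReal_mul (by positivity)]
          refine ENNReal.ofReal_le_ofReal ?_
          have hxm : ‖x‖ ≤ ‖m‖ + 1 := by
            refine (pi_norm_le_iff_of_nonneg (by positivity)).2 fun a => ?_
            have h1 := hx a
            simp only [zpow_zero, one_mul] at h1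
            have h3 : |(m a : ℝ)| ≤ ‖m‖ := by
              have := norm_le_pi_norm m a
              rwa [Int.norm_eq_abs] at this
            rw [abs_le] at h3
            rw [Real.norm_eq_abs, abs_le]
            constructor <;> linarith
          have h2 : -(n : ℝ) - s = -r := by rw [hr]; ring
          rw [h2, Real.rpow_neg (by positivity), Real.rpow_neg (by positivity),
            ← div_eq_mul_inv, ← Real.div_rpow (by norm_num) (by positivity),
            ← Real.inv_rpow (by positivity)]
          refine Real.rpow_le_rpow (by positivity) ?_ hr0.le
          rw [inv_eq_one_div, div_le_div_iff₀ (by positivity) (by positivity)]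
          linarith [norm_nonneg m]
  refine ne_top_of_le_ne_top ?_ (ENNReal.tsum_le_tsum key)
  rw [ENNReal.tsum_mul_left, ← lintegral_eq_tsum_dyadicCube]
  have := hfin.ne
  finiteness

lemma moment_decay_ne_top {s δ : ℝ} (h : δ < s) : moment (decay n s) δ ≠ ∞ := by
  have e : moment (decay n s) δ = ∑' m, decay n (s - δ) m := by
    refine tsum_congr fun m => ?_
    rw [decay, decay, ← ENNReal.ofReal_mul (by positivity), ← Real.rpow_add (by positivity)]
    congr 2; ring
  rw [e]
  exact tsum_decay_ne_top (by linarith)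

lemma decay_zero (n : ℕ) (s : ℝ) : decay n s 0 = 1 := by simp [decay]

/-! ### The coefficients -/

section

variable {T : ((Fin n → ℝ) → ℂ) → ((Fin n → ℝ) → ℂ) → ℂ} {s C : ℝ}

/-- The weight which dominates the coefficients, the diagonal included. -/
def coeffWeight (n : ℕ) (s C : ℝ) (m : Fin n → ℤ) : ℝ≥0∞ :=
  ENNReal.ofReal C * (1 + ∑' l, decay n s l) * decay n s m

lemma coeffWeight_neg (s C : ℝ) (m : Fin n → ℤ) : coeffWeight n s C (-m) = coeffWeight n s C m := by
  rw [coeffWeight, decay_neg, coeffWeight]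

lemma le_coeffWeight (s C : ℝ) (m : Fin n → ℤ) :
    ENNReal.ofReal C * decay n s m ≤ coeffWeight n s C m := by
  refine mul_le_mul_left ?_ _
  exact le_mul_of_one_le_right' le_self_add

lemma moment_coeffWeight_ne_top {δ : ℝ} (hs : 0 < s) (h : δ < s) :
    moment (coeffWeight n s C) δ ≠ ∞ := by
  have e : moment (coeffWeight n s C) δ =
      ENNReal.ofReal C * (1 + ∑' l, decay n s l) * moment (decay n s) δ := moment_const_mul _ _ _
  rw [e]
  have := moment_decay_ne_top (n := n) h
  have := tsum_decay_ne_top (n := n) hs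
  finiteness

lemma enorm_le_of_norm_le {z : ℂ} (hC : 0 < C) {m : Fin n → ℤ}
    (h : ‖z‖ ≤ C * (1 + ‖m‖) ^ (-(n : ℝ) - s)) : ‖z‖ₑ ≤ ENNReal.ofReal C * decay n s m := by
  rw [decay, ← ENNReal.ofReal_mul hC.le, ← ofReal_norm]
  exact ENNReal.ofReal_le_ofReal h

lemma enorm_alpha_le
    (hA : ∀ j q r, q.2 ≠ r.2 → ‖coeffA T j q r‖ₑ ≤ ENNReal.ofReal C * decay n s (q.2 - r.2)) (j : ℤ)
    (q r : Wavelet n × (Fin n → ℤ)) : ‖alpha T j q r‖ₑ ≤ coeffWeight n s C (q.2 - r.2) := by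
  rw [alpha]
  split_ifs with h
  · rw [enorm_zero]; exact zero_le
  · exact (hA j q r h).trans (le_coeffWeight s C _)

/-- The diagonal entry is at most `C` times the total decay, which is why the weight carries the
factor `1 + ∑ decay`. -/
lemma enorm_beta_le
    (hB : ∀ j q l, q.2 ≠ l → ‖coeffB T j q l‖ₑ ≤ ENNReal.ofReal C * decay n s (q.2 - l)) (j : ℤ)
    (q : Wavelet n × (Fin n → ℤ)) (l : Fin n → ℤ) :
    ‖beta T j q l‖ₑ ≤ coeffWeight n s C (q.2 - l) := by
  rw [beta]
  split_ifs with h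
  · rw [← h, sub_self, coeffWeight, decay_zero, mul_one, enorm_neg]
    calc _ ≤ ∑' m : {m : Fin n → ℤ // m ≠ 0}, ‖coeffB T j q (q.2 + m.1)‖ₑ :=
          enorm_tsum_le_tsum_enorm
      _ ≤ ∑' m : {m : Fin n → ℤ // m ≠ 0}, ENNReal.ofReal C * decay n s m.1 := by
          refine ENNReal.tsum_le_tsum fun m => (hB j q _ ?_).trans (le_of_eq ?_)
          · intro h'
            exact m.2 (by simpa using h'.symm)
          · rw [sub_add_cancel_left, decay_neg]
      _ ≤ ∑' m, ENNReal.ofReal C * decay n s m :=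
          ENNReal.tsum_comp_le_tsum_of_injective Subtype.val_injective _
      _ ≤ _ := by
          rw [ENNReal.tsum_mul_left]
          exact mul_le_mul_right le_add_self _
  · exact (hB j q l h).trans (le_coeffWeight s C _)

lemma tsum_beta (hs : 0 < s)
    (hB : ∀ j q l, q.2 ≠ l → ‖coeffB T j q l‖ₑ ≤ ENNReal.ofReal C * decay n s (q.2 - l)) (j : ℤ)
    (q : Wavelet n × (Fin n → ℤ)) : ∑' l, beta T j q l = 0 := by
  classical
  have hsum : Summable fun l => beta T j q l := by
    refine summable_of_tsum_enorm_ne_top (enorm_beta_le hB j q) ?_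
    refine ((Equiv.subLeft q.2).tsum_eq (coeffWeight n s C)).trans_ne ?_
    simp only [coeffWeight, ENNReal.tsum_mul_left]
    have := tsum_decay_ne_top (n := n) hs
    finiteness
  rw [hsum.tsum_eq_add_tsum_ite q.2, ← (Equiv.addLeft q.2).tsum_eq
    (fun l => if l = q.2 then 0 else beta T j q l)]
  have h1 : beta T j q q.2 = -∑' m : {m : Fin n → ℤ // m ≠ 0}, coeffB T j q (q.2 + m.1) := by
    rw [beta, if_pos rfl]
  have h2 := tsum_subtype {m : Fin n → ℤ | m ≠ 0} fun m => coeffB T j q (q.2 + m)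
  rw [h1, neg_add_eq_zero]
  refine h2.trans (tsum_congr fun m => ?_)
  simp only [Equiv.coe_addLeft, add_eq_left]
  by_cases hm : m = 0
  · simp [hm]
  · have : ¬ q.2 = q.2 + m := fun h => hm (by simpa using h.symm)
    rw [Set.indicator_of_mem (by exact hm), if_neg hm, beta, if_neg this]

/-- The matrices of the first operator. -/
lemma isAdmissible_alpha
    (hA : ∀ j q r, q.2 ≠ r.2 → ‖coeffA T j q r‖ₑ ≤ ENNReal.ofReal C * decay n s (q.2 - r.2)) :
    IsAdmissible (coeffWeight n s C) (extendMatrix waveletIndex waveletIndex (alpha T)) := by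
  refine ⟨isDominated_extendMatrix waveletIndex_injective waveletIndex_injective
    (enorm_alpha_le hA), Or.inl ⟨fun j k r => extendMatrix_eq_zero ?_, fun j q => ?_⟩⟩
  · rintro ⟨a, ha⟩
    exact waveletIndex_ne a.1 k (Prod.ext_iff.1 ha).1
  -- No `φ` occurs on the right, so the row sums vanish trivially.
  · have : ∀ l, extendMatrix waveletIndex waveletIndex (alpha T) j q (fun _ => false, l) = 0 :=
      fun l => extendMatrix_eq_zero fun ⟨a, ha⟩ => waveletIndex_ne a.2 l (Prod.ext_iff.1 ha).2
    simp only [this, tsum_zero]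

/-- The matrices of the second operator. -/
lemma isCancellingMatrix_beta (hs : 0 < s)
    (hB : ∀ j q l, q.2 ≠ l → ‖coeffB T j q l‖ₑ ≤ ENNReal.ofReal C * decay n s (q.2 - l)) :
    IsCancellingMatrix (extendMatrix waveletIndex cubeIndex (beta T)) := by
  have h0 : ∀ j k r, extendMatrix waveletIndex cubeIndex (beta T) j (fun _ => false, k) r = 0 :=
    fun j k r => extendMatrix_eq_zero fun ⟨a, ha⟩ => waveletIndex_ne a.1 k (Prod.ext_iff.1 ha).1
  refine ⟨h0, fun j q => ?_⟩
  by_cases hq : q.1 = fun _ => false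
  · have : q = (fun _ => false, q.2) := Prod.ext hq rfl
    rw [this]
    simp only [h0, tsum_zero]
  · have : q = waveletIndex (⟨q.1, hq⟩, q.2) := rfl
    rw [this]
    have e : ∀ l, extendMatrix waveletIndex cubeIndex (beta T) j (waveletIndex (⟨q.1, hq⟩, q.2))
        (fun _ => false, l) = beta T j (⟨q.1, hq⟩, q.2) l := fun l =>
      extendMatrix_apply waveletIndex_injective cubeIndex_injective (beta T) j _ l
    rw [tsum_congr e]
    exact tsum_beta hs hB j _

lemma isAdmissible_beta (hs : 0 < s)
    (hB : ∀ j q l, q.2 ≠ l → ‖coeffB T j q l‖ₑ ≤ ENNReal.ofReal C * decay n s (q.2 - l)) :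
    IsAdmissible (coeffWeight n s C) (extendMatrix waveletIndex cubeIndex (beta T)) :=
  ⟨isDominated_extendMatrix waveletIndex_injective cubeIndex_injective (enorm_beta_le hB),
    Or.inl (isCancellingMatrix_beta hs hB)⟩

/-- The matrix `γ` of `T` is the transpose of the matrix `β` of the transposed `T`, so everything
about `𝒲` is inherited from `𝒱`. -/
lemma formW_of_formV_swap {g f : (Fin n → ℝ) → ℂ} {z : ℂ}
    (h : FormV (fun g f => T f g) f g z) : FormW T g f z := by
  have hg : ∀ j k r, gamma T j k r = beta (fun g f => T f g) j r k := by
    intro j k r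
    simp only [gamma, beta, eq_comm (a := k)]
    rfl
  have hterm : ∀ j (a : (Fin n → ℤ) × (Wavelet n × (Fin n → ℤ))),
      bracket g (phi j a.1) * gamma T j a.1 a.2 * bracket (psi j a.2) f =
      bracket f (psi j a.swap.1) * beta (fun g f => T f g) j a.swap.1 a.swap.2 *
        bracket (phi j a.swap.2) g := by
    intro j a
    rw [hg, bracket_comm g, bracket_comm f]
    simp only [Prod.fst_swap, Prod.snd_swap]
    ring
  unfold FormW SeriesHasSum
  simp only [hterm]
  refine ⟨fun j => (Equiv.prodComm _ _).summable_iff.2 (h.1 j), ?_⟩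
  convert h.2 using 2 with j
  exact (Equiv.prodComm (Fin n → ℤ) (Wavelet n × (Fin n → ℤ))).tsum_eq
    fun a => bracket f (psi j a.1) * beta (fun g f => T f g) j a.1 a.2 * bracket (phi j a.2) g

end

end BCR

end

/-! ### The main theorem -/

theorem theorem2p1 (n : ℕ) (hn : 1 ≤ n)
    (T : ((Fin n → ℝ) → ℂ) → ((Fin n → ℝ) → ℂ) → ℂ) (s C : ℝ) (hs : 0 < s) (hC : 0 < C)
    (hT : ∀ (j : ℤ) (k l : Fin n → ℤ), k ≠ l → ∀ ψ ψ' : BCR.Wavelet n,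
      ‖BCR.coeffA T j (ψ, k) (ψ', l)‖ + ‖BCR.coeffB T j (ψ, k) l‖ + ‖BCR.coeffC T j k (ψ', l)‖
        ≤ C * (1 + ‖k - l‖) ^ (-(n : ℝ) - s)) :
    (BCR.IsBounded (BCR.FormU T) ∧ BCR.IsBounded (BCR.FormV T) ∧ BCR.IsBounded (BCR.FormW T)) ∧
      BCR.AnnihilatesOne (BCR.FormV T) ∧ BCR.AnnihilatesOne (BCR.FormW T) := by
  have hA : ∀ j (q r : BCR.Wavelet n × (Fin n → ℤ)), q.2 ≠ r.2 →
      ‖BCR.coeffA T j q r‖ₑ ≤ ENNReal.ofReal C * BCR.decay n s (q.2 - r.2) := fun j q r h =>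
    BCR.enorm_le_of_norm_le hC (le_trans (by
      linarith [norm_nonneg (BCR.coeffB T j q r.2), norm_nonneg (BCR.coeffC T j q.2 r)])
      (hT j q.2 r.2 h q.1 r.1))
  have hB : ∀ j (q : BCR.Wavelet n × (Fin n → ℤ)) l, q.2 ≠ l →
      ‖BCR.coeffB T j q l‖ₑ ≤ ENNReal.ofReal C * BCR.decay n s (q.2 - l) := fun j q l h =>
    BCR.enorm_le_of_norm_le hC (le_trans (by
      linarith [norm_nonneg (BCR.coeffA T j q (q.1, l)), norm_nonneg (BCR.coeffC T j q.2 (q.1, l))])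
      (hT j q.2 l h q.1 q.1))
  -- The coefficients `c` of `T` are the coefficients `b` of its transpose, and the size condition
  -- is symmetric in `k` and `l`.
  have hB' : ∀ j (q : BCR.Wavelet n × (Fin n → ℤ)) l, q.2 ≠ l →
      ‖BCR.coeffB (fun g f => T f g) j q l‖ₑ ≤ ENNReal.ofReal C * BCR.decay n s (q.2 - l) := by
    intro j q l h
    rw [← BCR.decay_neg, neg_sub]
    refine BCR.enorm_le_of_norm_le hC (le_trans ?_ (hT j l q.2 h.symm q.1 q.1))
    change ‖BCR.coeffC T j l q‖ ≤ _
    linarith [norm_nonneg (BCR.coeffA T j (q.1, l) q), norm_nonneg (BCR.coeffB T j (q.1, l) q.2)]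
  -- The moment is finite because `δ < s`; `δ ≤ 1` is needed in the boundary and tail estimates.
  obtain ⟨δ, hδ, hδ1, hδs⟩ : ∃ δ : ℝ, 0 < δ ∧ δ ≤ 1 ∧ δ < s :=
    ⟨min (s / 2) 1, lt_min (by linarith) one_pos, min_le_right _ _,
      (min_le_left _ _).trans_lt (by linarith)⟩
  have hsymm := BCR.coeffWeight_neg (n := n) s C
  have hm := BCR.moment_coeffWeight_ne_top (n := n) (C := C) hs hδs
  have hw : ∑' m, BCR.coeffWeight n s C m ≠ ⊤ :=
    ne_top_of_le_ne_top hm (BCR.tsum_weight_le_moment _ hδ)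
  have hV := BCR.isAdmissible_beta hs hB
  have hW := BCR.isAdmissible_beta hs hB'
  refine ⟨⟨?_, ?_, ?_⟩, ?_, ?_⟩
  · exact (BCR.isBounded_haarForm hn hsymm hδ hδ1 hm (BCR.isAdmissible_alpha hA)).mono fun g f z h =>
      h.seriesHasSum BCR.waveletIndex_injective BCR.waveletIndex_injective
  · exact (BCR.isBounded_haarForm hn hsymm hδ hδ1 hm hV).mono fun g f z h =>
      h.seriesHasSum BCR.waveletIndex_injective BCR.cubeIndex_injective
  · exact (BCR.isBounded_haarForm hn hsymm hδ hδ1 hm (hW.swap hsymm)).mono fun g f z h =>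
      BCR.formW_of_formV_swap
        (h.swap.seriesHasSum BCR.waveletIndex_injective BCR.cubeIndex_injective)
  · exact (BCR.annihilatesOne_haarForm hV.dominated hw (BCR.isCancellingMatrix_beta hs hB)).mono
      fun g f z h => h.seriesHasSum BCR.waveletIndex_injective BCR.cubeIndex_injective
  · have hann := BCR.annihilatesOne_haarForm hW.dominated hw (BCR.isCancellingMatrix_beta hs hB')
    exact fun u hu => ⟨BCR.formW_of_formV_swap ((hann u hu).2.seriesHasSum
      BCR.waveletIndex_injective BCR.cubeIndex_injective), BCR.formW_of_formV_swap
        ((hann u hu).1.seriesHasSum BCR.waveletIndex_injective BCR.cubeIndex_injective)⟩
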